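/- **Setting.** Let $\Omega\subset\mathbb R^3$ be a closed ball centred at $0$ with a positive, integrable, rotation invariant density $\rho$, and $m=\int_\Omega\rho$. Let $\mathcal C$ be a finite dimensional space of ($C^1$) maps $v:\Omega\to\mathbb R^3$ with $\int_\Omega v\rho=0$ that contains $v_0(x)=x$ and is invariant under $v\mapsto\Gamma v$ and $v\mapsto\Gamma v\circ\Gamma^{-1}$, $\Gamma\in SO(3)$. Let $I(v)$, $I_{ij}(v)=e_i\cdot\int_\Omega v\wedge(e_j\wedge v)\rho$, be the matrix of inertia, and $I(v_0)=I_0\,\mathrm{Id}$. Let $\mathcal S$ be a smooth local section through $v_0$ with coordinates $(J,z)\in\mathbb R^3\times\mathbb R^n$ in a neighbourhood of $0$, i.e. a smooth injective immersion $(J,z)\mapsto w(J,z)\in\mathcal C$, $w(0)=v_0$, with $I(w(J,z))=\mathrm{diag}(I_0+J_1,I_0+J_2,I_0+J_3)$, such that $\dim\mathcal C=n+9$ and $\mathcal S$ is transversal at $v_0$ to the orbit $\{v_0\circ\Gamma:\Gamma\in SO(3)\}$. Call $(J,z)$ regular if it lies in the coordinate domain and $J_1,J_2,J_3$ are distinct.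 The elastic potential energy is $V_e=\frac1\varepsilon V_0$, where $V_0:\mathcal C\to\mathbb R$ is invariant under the two actions, smooth near $v_0$, and has a local minimum at $v_0$ whose Hessian in the coordinates $(J,z)$ is nondegenerate. The planar configurations are $v=\Gamma(\alpha)\,\Gamma(\beta)\,w(J,z)\circ\Gamma(\beta)^{-1}$, with $\Gamma(\theta)$ the rotation by $\theta$ about $e_3$, and $T_r=\frac12\int_\Omega|\dot v|^2\rho=\frac12\sum_{i,k} a_{ik}\dot q_i\dot q_k$, $q=(\alpha,\beta,J,z)$. Let $(R,\psi)$ be the polar coordinates of the centre of mass, $\chi=\alpha-\psi$, $G,M>0$, and let $\kappa>0$ be any constant. Put $$V_g=-\frac{GMm}{R}+\kappa\frac{GM}{R^3}\bigl[-J_1+2J_2-J_3+3(J_1-J_2)\cos^2(\chi+\beta)\bigr],\qquad \mathcal L=\frac m2(\dot R^2+R^2\dot\psi^2)+T_r-V_g-V_e .$$ The variable $\psi$ is cyclic. For $p\in\mathbb R$ let $\tilde{\mathcal L}=\mathcal L-p\,\dot\psi$ be the reduced Lagrangian in $y=(R,\chi,\beta,J,z)$, where $\dot\psi$ is expressed through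 $(y,\dot y)$ by solving $\partial\mathcal L/\partial\dot\psi=p$, and let $$\tilde V=\frac{p^2}{2(mR^2+I_0+J_3)}+V_g+V_e .$$ Let $R_0>0$ be a nondegenerate local minimum of $V_{G0}(R)=-\frac{GMm}{R}+\frac{p^2}{2(mR^2+I_0)}$. **Theorem 4.1.** There are $\varepsilon_0>0$ and $C>0$ such that for every $0<\varepsilon<\varepsilon_0$ there is exactly one $(\bar R,\bar J,\bar z)$, with $\bar R>0$ and $(\bar J,\bar z)$ in the coordinate domain, such that $|\bar R-R_0|\le C\varepsilon$, $\|(\bar J,\bar z)\|\le C\varepsilon$, $\bar J_1<\bar J_2<\bar J_3$, and all points of the 1:1 spin–orbit resonance manifold $$\mathcal M=\{(\bar R,\chi,\beta,\bar J,\bar z)\mid \chi+\beta=0\}$$ are critical points of $\tilde V$ at which the Hessian of $\tilde V$ is positive on every vector not tangent to $\mathcal M$. Moreover, let $F(\dot\beta,\dot J,\dot z;J,z)$ be any Rayleigh dissipation function, smooth for regular $(J,z)$ and all velocities, which for each regular $(J,z)$ has, as a function of $(\dot\beta,\dot J,\dot z)$, a nondegenerate local minimum at $0$. Then $\mathcal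 M$, with zero velocity, is an asymptotically stable equilibrium of $$\frac{d}{dt}\frac{\partial\tilde{\mathcal L}}{\partial\dot y_k}-\frac{\partial\tilde{\mathcal L}}{\partial y_k}=-\frac{\partial F}{\partial\dot y_k}$$ on the set where $R>0$ and $(J,z)$ is regular. That is: for every $\eta>0$ there is $\delta>0$ such that every solution on an interval $[0,T)$ starting at distance less than $\delta$ from $\mathcal M\times\{0\}$ in the phase space of the $(y,\dot y)$ stays at distance less than $\eta$; and there is $\delta>0$ such that, from every initial datum at distance less than $\delta$ from $\mathcal M\times\{0\}$, a solution exists for all $t\ge0$, and for every such solution the distance of $(y(t),\dot y(t))$ from $\mathcal M\times\{0\}$ tends to $0$ as $t\to+\infty$. -/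

import Mathlib

open scoped ContDiff Topology Matrix

noncomputable section

namespace SpinOrbit

/-! ### The body and the two actions of the rotation group -/

/-- Euclidean three-space. -/
abbrev E3 : Type := EuclideanSpace ℝ (Fin 3)

/-- The rotation group `SO(3)`. -/
abbrev SO3 : Type := Matrix.specialOrthogonalGroup (Fin 3) ℝ

/-- The material space: a closed ball of radius `r` in Euclidean three-space. -/
abbrev Ball (r : ℝ) : Type := Metric.closedBall (0 : E3) r

/-- Lebesgue measure on the ball. -/
def ballVolume (r : ℝ) : MeasureTheory.Measure (Ball r) :=
  MeasureTheory.Measure.comap Subtype.val MeasureTheory.volume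

/-- A rotation acting on a vector. -/
def rot (Γ : SO3) : E3 →L[ℝ] E3 := Matrix.toEuclideanCLM (𝕜 := ℝ) (Γ : Matrix (Fin 3) (Fin 3) ℝ)

theorem norm_rot (Γ : SO3) (x : E3) : ‖rot Γ x‖ = ‖x‖ := by
  have h1 : rot Γ ∈ unitary (E3 →L[ℝ] E3) :=
    Unitary.map_mem (Matrix.toEuclideanCLM (n := Fin 3) (𝕜 := ℝ))
      ((Matrix.mem_specialOrthogonalGroup_iff.1 Γ.2).1)
  exact ContinuousLinearMap.norm_map_of_mem_unitary h1 x

/-- A rotation acting on the points of the ball. -/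
def rotBall (r : ℝ) (Γ : SO3) : C(Ball r, Ball r) where
  toFun x := ⟨rot Γ x, by
    have hx := x.2
    rw [mem_closedBall_zero_iff] at hx ⊢
    rwa [norm_rot]⟩
  continuous_toFun := by fun_prop

/-- The action `(Γ, v) ↦ Γ v` (rigid rotation in space). -/
def act₁ {r : ℝ} (Γ : SO3) (v : C(Ball r, E3)) : C(Ball r, E3) where
  toFun x := rot Γ (v x)
  continuous_toFun := by fun_prop

/-- The action `(Γ, v) ↦ Γ v ∘ Γ⁻¹` (rotation of the deformation inside the body). -/
def act₂ {r : ℝ} (Γ : SO3) (v : C(Ball r, E3)) : C(Ball r, E3) :=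
  act₁ Γ (v.comp (rotBall r Γ⁻¹))

/-- The identical deformation `v₀(x) = x`. -/
def identical (r : ℝ) : C(Ball r, E3) where
  toFun x := x
  continuous_toFun := by fun_prop

/-- The rotation by the angle `θ` about the third axis. -/
def planarRot (θ : ℝ) : SO3 :=
  ⟨!![Real.cos θ, -Real.sin θ, 0; Real.sin θ, Real.cos θ, 0; 0, 0, 1], by
    have h := Real.sin_sq_add_cos_sq θ
    rw [Matrix.mem_specialOrthogonalGroup_iff, Matrix.mem_orthogonalGroup_iff]
    constructor
    · ext i j
      fin_cases i <;> fin_cases j <;>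
        simp [Matrix.mul_apply, Fin.sum_univ_three] <;> nlinarith
    · simp [Matrix.det_fin_three]
      nlinarith⟩

/-- A rotation invariant elastic ball with finitely many degrees of freedom: a rotation invariant
positive density, and a finite dimensional space `conf` of (`C¹`) configurations relative to the
center of mass, invariant under both actions and containing the identical deformation. -/
structure ElasticBody where
  radius : ℝ
  radius_pos : 0 < radius
  density : Ball radius → ℝ
  density_pos : ∀ x, 0 < density x
  density_integrable : MeasureTheory.Integrable density (ballVolume radius)
  density_rot : ∀ (Γ : SO3) (x : Ball radius), density (rotBall radius Γ x) = density x
  conf : Submodule ℝ C(Ball radius, E3)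
  conf_finite : FiniteDimensional ℝ conf
  conf_C1 : ∀ v ∈ conf, ∃ f : E3 → E3, ContDiff ℝ 1 f ∧ ∀ x, v x = f x
  conf_center : ∀ v ∈ conf, ∫ x, density x • v x ∂(ballVolume radius) = 0
  conf_act₁ : ∀ (Γ : SO3), ∀ v ∈ conf, act₁ Γ v ∈ conf
  conf_act₂ : ∀ (Γ : SO3), ∀ v ∈ conf, act₂ Γ v ∈ conf
  identical_mem : identical radius ∈ conf

namespace ElasticBody

variable (B : ElasticBody)

/-- The mass of the body. -/
def mass : ℝ := ∫ x, B.density x ∂(ballVolume B.radius)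

/-- The identical deformation as an element of the space of configurations. -/
def v₀ : B.conf := ⟨identical B.radius, B.identical_mem⟩

/-- The matrix of inertia `I_{ij}(v) = e_i · ∫ v ∧ (e_j ∧ v) ρ`. -/
def inertia (v : C(Ball B.radius, E3)) : Matrix (Fin 3) (Fin 3) ℝ :=
  Matrix.of fun i j =>
    ∫ x, ((v x).ofLp ⨯₃ ((Pi.single j 1 : Fin 3 → ℝ) ⨯₃ (v x).ofLp)) i * B.density x
      ∂(ballVolume B.radius)

/-- The common value of the principal moments of inertia of the identical deformation. -/
def I₀ : ℝ := B.inertia (identical B.radius) 2 2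

end ElasticBody

/-- The coordinates `(J, z)` of a section: `J_i = I_i - I_0`, and `n` further coordinates `z`. -/
abbrev Shape (n : ℕ) : Type := (Fin 3 → ℝ) × (Fin n → ℝ)

/-- A local section `𝒮` through `v₀`, with coordinates `(J, z)`, inside the set `𝒟` of the
configurations whose matrix of inertia is diagonal. It is transversal to the orbit of `v₀` under
`v ↦ v ∘ R` and complementary to it in `𝒟`: `𝒟` has codimension 3 in the space of configurations,
and `𝒮` has codimension 3 in `𝒟`. -/
structure AdaptedSection (B : ElasticBody) (n : ℕ) where
  /-- the domain of the coordinates -/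
  U : Set (Shape n)
  isOpen_U : IsOpen U
  zero_mem : 0 ∈ U
  /-- the configuration with coordinates `(J, z)` -/
  w : Shape n → B.conf
  smooth : ContDiffOn ℝ ∞ w U
  injOn : Set.InjOn w U
  immersion : ∀ s ∈ U, Function.Injective (fderiv ℝ w s)
  w_zero : w 0 = B.v₀
  inertia_eq : ∀ s ∈ U, B.inertia (w s) = Matrix.diagonal fun i => B.I₀ + s.1 i
  codim : Module.finrank ℝ B.conf = n + 9
  /-- No nonzero infinitesimal rotation `x ↦ ξ ∧ x` is tangent to `𝒮` at `v₀`. -/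
  transversal : ∀ (s : Shape n) (ξ : Fin 3 → ℝ),
    (∀ x : Ball B.radius,
      ((fderiv ℝ w 0 s : B.conf) : C(Ball B.radius, E3)) x = WithLp.toLp 2 (ξ ⨯₃ (x : E3).ofLp)) →
    ξ = 0

/-- The set of the coordinates of the points of the section with distinct principal moments of
inertia. -/
def AdaptedSection.regular {B : ElasticBody} {n : ℕ} (S : AdaptedSection B n) : Set (Shape n) :=
  {s | s ∈ S.U ∧ s.1 0 ≠ s.1 1 ∧ s.1 0 ≠ s.1 2 ∧ s.1 1 ≠ s.1 2}

/-- A bilinear form is nondegenerate. -/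
def NondegenerateForm {V : Type*} [NormedAddCommGroup V] [NormedSpace ℝ V]
    (b : V →L[ℝ] V →L[ℝ] ℝ) : Prop :=
  ∀ u, (∀ u', b u u' = 0) → u = 0

/-- The second derivative of `f` at `x`. -/
def hessian {V : Type*} [NormedAddCommGroup V] [NormedSpace ℝ V] (f : V → ℝ) (x : V) :
    V →L[ℝ] V →L[ℝ] ℝ :=
  fderiv ℝ (fderiv ℝ f) x

/-- An elastic (and self-gravitational) potential energy, up to the factor `1 / ε`: it is invariant
under both actions, smooth near `v₀`, it has a minimum at `v₀`, and this minimum is nondegenerate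
as a function of the coordinates `(J, z)`. -/
structure ElasticPotential {B : ElasticBody} {n : ℕ} (S : AdaptedSection B n) where
  V : B.conf → ℝ
  invariant₁ : ∀ (Γ : SO3) (v u : B.conf),
    (u : C(Ball B.radius, E3)) = act₁ Γ (v : C(Ball B.radius, E3)) → V u = V v
  invariant₂ : ∀ (Γ : SO3) (v u : B.conf),
    (u : C(Ball B.radius, E3)) = act₂ Γ (v : C(Ball B.radius, E3)) → V u = V v
  smooth : ∃ N : Set B.conf, IsOpen N ∧ B.v₀ ∈ N ∧ ContDiffOn ℝ ∞ V N
  isLocalMin : IsLocalMin V B.v₀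
  nondegenerate : NondegenerateForm (hessian (fun s => V (S.w s)) 0)

/-- A Rayleigh dissipation function `F(β', J', z'; J, z)`, written `F (J, z) (β', J', z')`: it is
smooth, and as a function of the velocities it has a nondegenerate minimum at `0`. -/
structure Dissipation {B : ElasticBody} {n : ℕ} (S : AdaptedSection B n) where
  F : Shape n → ℝ × Shape n → ℝ
  smooth : ContDiffOn ℝ ∞ (Function.uncurry F) (S.regular ×ˢ Set.univ)
  isLocalMin : ∀ s ∈ S.regular, IsLocalMin (F s) 0
  nondegenerate : ∀ s ∈ S.regular, NondegenerateForm (hessian (F s) 0)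

/-! ### Kinetic energy, Lagrangian and reduced Lagrangian -/

/-- The coordinates `q = (α, β, J, z)` of the configuration relative to the center of mass. -/
abbrev BodyCoord (n : ℕ) : Type := ℝ × ℝ × Shape n

/-- The reduced coordinates `y = (R, χ, β, J, z)`. Thus `y.2 = (χ, β, J, z)`,
`y.2.2 = (β, J, z)` and `y.2.2.2 = (J, z)`. -/
abbrev Coord (n : ℕ) : Type := ℝ × ℝ × ℝ × Shape n

section Mechanics

variable {B : ElasticBody} {n : ℕ} (S : AdaptedSection B n)

/-- The planar configuration `Γ(α) R(β) w ∘ R(β)⁻¹` with coordinates `(α, β, J, z)`. -/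
def configuration (q : BodyCoord n) : C(Ball B.radius, E3) :=
  act₁ (planarRot q.1) (act₂ (planarRot q.2.1) (S.w q.2.2 : C(Ball B.radius, E3)))

/-- The coefficients `a_{ik}` of the kinetic energy of the body relative to its center of mass, as
a bilinear form in two velocities: `∫ ⟨∂_u v, ∂_u' v⟩ ρ`. -/
def kineticForm (q u u' : BodyCoord n) : ℝ :=
  ∫ x, inner ℝ (fderiv ℝ (configuration S) q u x) (fderiv ℝ (configuration S) q u' x) * B.density x
    ∂(ballVolume B.radius)

/-- The kinetic energy relative to the center of mass, `T_r = ½ ∑ a_{ik} q_i' q_k'`. -/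
def kineticEnergy (q u : BodyCoord n) : ℝ := kineticForm S q u u / 2

/-- The gravitational potential energy in the quadrupole approximation, with `μ = G M`, body mass
`m`, and the tidal part multiplied by `κ`. -/
def gravity (μ m κ R : ℝ) (J : Fin 3 → ℝ) (γ : ℝ) : ℝ :=
  -(μ * m / R) + κ * (μ / R ^ 3) * (-J 0 + 2 * J 1 - J 2 + 3 * (J 0 - J 1) * Real.cos γ ^ 2)

variable (V : ElasticPotential S) (μ κ p ε : ℝ)

/-- The Lagrangian at the position `(R, ψ, χ, β, J, z)`, where `y = (R, χ, β, J, z)`, and the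
velocity `(R', ψ', χ', β', J', z')`, where `v = (R', χ', β', J', z')`. The body is rotated by
`α = χ + ψ`. -/
def lagrangian (ψ : ℝ) (y : Coord n) (ψ' : ℝ) (v : Coord n) : ℝ :=
  B.mass / 2 * (v.1 ^ 2 + y.1 ^ 2 * ψ' ^ 2)
    + kineticEnergy S (y.2 + (ψ, 0, 0)) (v.2 + (ψ', 0, 0))
    - gravity μ B.mass κ y.1 y.2.2.2.1 (y.2.1 + y.2.2.1)
    - V.V (S.w y.2.2.2) / ε

/-- The velocity `ψ'` as a function of the other coordinates and velocities, obtained by solving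
`∂ℒ/∂ψ' = p`, that is, `m R² ψ' + a₁₁ (χ' + ψ') + ∑_{k ≥ 2} a_{1k} q_k' = p`. -/
def psiVelocity (y v : Coord n) : ℝ :=
  (p - kineticForm S y.2 (1, 0, 0) v.2) /
    (B.mass * y.1 ^ 2 + kineticForm S y.2 (1, 0, 0) (1, 0, 0))

/-- The reduced Lagrangian `ℒ - ψ' ∂ℒ/∂ψ'` at total angular momentum `p`. As `ψ` is cyclic, it is
set equal to `0`. -/
def reducedLagrangian (y v : Coord n) : ℝ :=
  lagrangian S V μ κ ε 0 y (psiVelocity S p y v) v - psiVelocity S p y v * p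

/-- The effective potential of the reduced system. -/
def effectivePotential (y : Coord n) : ℝ :=
  p ^ 2 / (2 * (B.mass * y.1 ^ 2 + B.I₀ + y.2.2.2.1 2))
    + gravity μ B.mass κ y.1 y.2.2.2.1 (y.2.1 + y.2.2.1)
    + V.V (S.w y.2.2.2) / ε

/-- The function `V_{G0}(R) = -μ m / R + p² / (2 (m R² + I₀))`. -/
def orbitalPotential (B : ElasticBody) (μ p R : ℝ) : ℝ :=
  -(μ * B.mass / R) + p ^ 2 / (2 * (B.mass * R ^ 2 + B.I₀))

/-- `y` with velocity `v` is a solution, on the time interval `I`, of the Lagrange equations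
`d/dt ∂L/∂y_k' - ∂L/∂y_k = -∂F/∂y_k'` of the reduced Lagrangian `L` (written as an equality of
covectors). The dissipation function acts on the velocities of `(β, J, z)` only. -/
structure IsSolution (D : Dissipation S) (I : Set ℝ) (y v : ℝ → Coord n) : Prop where
  mem_domain : ∀ t ∈ I, 0 < (y t).1 ∧ (y t).2.2.2 ∈ S.regular
  hasDeriv : ∀ t ∈ I, HasDerivWithinAt y (v t) I t
  differentiable : DifferentiableOn ℝ v I
  equation : ∀ t ∈ I, HasDerivWithinAt
    (fun τ => fderiv ℝ (fun u => reducedLagrangian S V μ κ p ε (y τ) u) (v τ))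
    (fderiv ℝ (fun x => reducedLagrangian S V μ κ p ε x (v t)) (y t)
      - fderiv ℝ (fun u : Coord n => D.F (y t).2.2.2 u.2.2) (v t)) I t

/-- The 1:1 spin-orbit resonance manifold `{(R, χ, β, J, z) | χ + β = 0}` at given `R` and
`s = (J, z)`. -/
def resonanceManifold (R : ℝ) (s : Shape n) : Set (Coord n) :=
  {y | y.1 = R ∧ y.2.1 + y.2.2.1 = 0 ∧ y.2.2.2 = s}

/-- `(R, J, z)` is as required of `(R̄, J̄, z̄)` in the definition of the resonance manifold, with
distance at most `δ` from `(R₀, 0, 0)`. -/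
structure IsResonance (R₀ δ R : ℝ) (s : Shape n) : Prop where
  pos : 0 < R
  mem : s ∈ S.U
  critical : ∀ y ∈ resonanceManifold R s,
    HasFDerivAt (effectivePotential S V μ κ p ε) (0 : Coord n →L[ℝ] ℝ) y
  /-- The Hessian is positive in all the directions that are not tangent to the manifold. -/
  transversal_min : ∀ y ∈ resonanceManifold R s, ∀ u : Coord n,
    (¬ ∃ c : ℝ, u = (0, c, -c, 0)) → 0 < hessian (effectivePotential S V μ κ p ε) y u u
  shape_small : ‖s‖ ≤ δ
  radius_close : |R - R₀| ≤ δ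
  ordered : s.1 0 < s.1 1 ∧ s.1 1 < s.1 2

/-- The set `N × {0}` of the phase space, where `N` is a set of positions, is an asymptotically
stable equilibrium of the Lagrange equations with dissipation: it is Lyapunov stable, the solutions
that start near it exist for all positive times, and they tend to it. -/
structure AsymptoticallyStable (D : Dissipation S) (N : Set (Coord n)) : Prop where
  stable : ∀ η > 0, ∃ δ > 0, ∀ (T : ℝ) (y v : ℝ → Coord n),
    IsSolution S V μ κ p ε D (Set.Ico 0 T) y v →
    Metric.infDist (y 0, v 0) (N ×ˢ {0}) < δ →
    ∀ t ∈ Set.Ico 0 T, Metric.infDist (y t, v t) (N ×ˢ {0}) < η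
  exists_global : ∃ δ > 0, ∀ a b : Coord n, Metric.infDist (a, b) (N ×ˢ {0}) < δ →
    ∃ y v : ℝ → Coord n, y 0 = a ∧ v 0 = b ∧ IsSolution S V μ κ p ε D (Set.Ici 0) y v
  attractive : ∃ δ > 0, ∀ y v : ℝ → Coord n,
    IsSolution S V μ κ p ε D (Set.Ici 0) y v →
    Metric.infDist (y 0, v 0) (N ×ˢ {0}) < δ →
    Filter.Tendsto (fun t => Metric.infDist (y t, v t) (N ×ˢ {0})) Filter.atTop (𝓝 0)

end Mechanics

end SpinOrbit

end

/-! ### Autonomous differential equations: global solutions, stability, invariance principle -/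

/-! Since cos² = 1 - sin², the effective potential is f (R, J, z) + W (J, z) / ε + T (R, J) sin² (χ
+ β), where f = `softPotential` does not depend on ε, W = `shapePotential`, and T = `tidalCoeff` is
a positive multiple of J₁ - J₀ (indices start at 0).

Existence. On χ + β = 0 the last term has zero differential. After multiplication of the shape
equations by ε, the system ∂f/∂R = 0, dW + ε d_s f = 0 with s = (J, z) is regular at ε = 0, is
solved there by (R₀, 0), and has invertible linearisation, so the implicit function theorem gives a
locally unique curve of solutions (`exists_curve_of_critical_points`). Its initial shape velocity s₁
is the elastic response to the force -d_s f. The components of d_s f along J are strictly decreasing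
and those along z vanish. For a general stiffness this would not order the components of s₁;
rotation invariance does it (`lt_of_response`). A half-turn exchanging two axes preserves the
stiffness, and comparing s₁ with its image gives J₀ < J₁ < J₂. The image may leave the tangent space
of the section, but only by an infinitesimal rotation, which costs no elastic energy; this is a
dimension count (`exists_decomposition`). Hence T > 0, and the Hessian is positive transversally to
the manifold (`eventually_stiff_hessian_pos`, `hessian_libration`).

Stability. Eliminating ψ' leaves a Lagrangian G(v,v)/2 + b v - W̃ with W̃ the effective potential
(`reducedLagrangian_eq`). The metric G degenerates at v₀, where the angle β loses its meaning, but
it is positive definite at nearby shapes with J₀ ≠ J₁ (`injective_bodyVelocity`). The energy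
G(v,v)/2 + W̃ does not increase near the manifold. All data except the solution itself are invariant
under (χ, β) ↦ (χ + c, β - c), so Lyapunov's theorem and LaSalle's principle are used modulo the
kernel of the projection `toNormal` (`asymptoticStability_of_dissipation`).

Friction does not act on R and χ. The invariance principle therefore needs that a motion with frozen
β, J, z is at rest (`stationary_of_no_dissipation`): the symmetry makes the absolute angular
velocity of the body constant, so the tidal torque vanishes and χ + β = 0; then χ is constant, and
conservation of p ≠ 0 makes R constant. The remaining equilibrium is a critical point of W̃, hence
lies on the manifold. -/

theorem exists_global_integralCurve {X : Type*} [NormedAddCommGroup X] [NormedSpace ℝ X]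
    [CompleteSpace X] {g : X → X} {K L : NNReal} (hK : LipschitzWith K g) (hL : ∀ x, ‖g x‖ ≤ L)
    (x₀ : X) : ∃ x : ℝ → X, x 0 = x₀ ∧ ∀ t, HasDerivAt x (g (x t)) t := by
  -- As g is bounded by L, a curve cannot leave the ball of radius L (N + 1) before time N + 1, so
  -- Picard–Lindelöf applies on the whole interval.
  have key : ∀ N : ℕ, ∃ α : ℝ → X, α 0 = x₀ ∧
      ∀ t ∈ Set.Ioo (-((N : ℝ) + 1)) (N + 1), HasDerivAt α (g (α t)) t := by
    intro N
    have hN : (0 : ℝ) ≤ N := N.cast_nonneg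
    have h0 : (0 : ℝ) ∈ Set.Icc (-((N : ℝ) + 1)) (N + 1) := ⟨by linarith, by linarith⟩
    have hp : IsPicardLindelof (fun _ : ℝ => g) (⟨0, h0⟩ : Set.Icc (-((N : ℝ) + 1)) (N + 1)) x₀
        (L * (N + 1)) 0 L K := by
      refine IsPicardLindelof.of_time_independent (fun x _ => hL x) (hK.lipschitzOnWith) ?_
      simp
    obtain ⟨α, h1, h2⟩ := hp.exists_eq_forall_mem_Icc_hasDerivWithinAt₀
    exact ⟨α, h1, fun t ht => (h2 t ⟨ht.1.le, ht.2.le⟩).hasDerivAt (Icc_mem_nhds ht.1 ht.2)⟩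
  choose α hα0 hα using key
  have hcomp : ∀ M N : ℕ, M ≤ N →
      Set.EqOn (α N) (α M) (Set.Ioo (-((M : ℝ) + 1)) (M + 1)) := by
    intro M N hMN
    have hM : (0 : ℝ) ≤ M := M.cast_nonneg
    have hMN' : (M : ℝ) ≤ N := by exact_mod_cast hMN
    refine ODE_solution_unique_of_mem_Ioo (v := fun _ => g) (s := fun _ => Set.univ) (K := K)
      (t₀ := 0)
      (fun t _ => hK.lipschitzOnWith) ⟨by linarith, by linarith⟩
      (fun t ht => ⟨hα N t ⟨by linarith [ht.1], by linarith [ht.2]⟩, trivial⟩)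
      (fun t ht => ⟨hα M t ht, trivial⟩) (by rw [hα0, hα0])
  have hval : ∀ (N : ℕ) (t : ℝ), |t| < N + 1 → α ⌈|t|⌉₊ t = α N t := by
    intro N t ht
    have h1 := Nat.le_ceil |t|
    have hmem : t ∈ Set.Ioo (-((⌈|t|⌉₊ : ℝ) + 1)) (⌈|t|⌉₊ + 1) := by
      rw [Set.mem_Ioo, ← abs_lt]; linarith
    rcases le_total ⌈|t|⌉₊ N with h | h
    · exact (hcomp _ _ h hmem).symm
    · exact hcomp _ _ h (by rw [Set.mem_Ioo, ← abs_lt]; exact ht)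
  -- The pieces agree by uniqueness. Piece N lives up to N + 1, which keeps t in the open interval
  -- of the piece with index ⌈|t|⌉.
  refine ⟨fun t => α ⌈|t|⌉₊ t, by simp [hα0], fun t => ?_⟩
  have h1 := Nat.le_ceil |t|
  have hd := hα ⌈|t|⌉₊ t (by rw [Set.mem_Ioo, ← abs_lt]; linarith)
  refine hd.congr_of_eventuallyEq ?_
  have : ∀ᶠ s : ℝ in 𝓝 t, |s| < (⌈|t|⌉₊ : ℝ) + 1 :=
    (continuous_abs.tendsto t).eventually (gt_mem_nhds (by linarith))
  filter_upwards [this] with s hs using hval _ s hs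

section Lyapunov

variable {X : Type*} [NormedAddCommGroup X] [NormedSpace ℝ X] [FiniteDimensional ℝ X]
  {P : X →L[ℝ] X} {x₀ : X} {H : X → ℝ} {r : ℝ}

/-- The tube ‖P x - x₀‖ ≤ η is unbounded along the kernel of P. Its slice by the fixed points of P
is compact and carries all values of a function with H ∘ P = H. -/
theorem isCompact_range_inter_closedBall (η : ℝ) :
    IsCompact {x : X | P x = x ∧ ‖x - x₀‖ ≤ η} := by
  have : {x : X | P x = x ∧ ‖x - x₀‖ ≤ η} = {x | P x = x} ∩ Metric.closedBall x₀ η := by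
    ext x; simp [dist_eq_norm]
  rw [this]
  have := FiniteDimensional.proper ℝ X
  exact (isCompact_closedBall x₀ η).inter_left (isClosed_eq P.continuous continuous_id)

/-- Lyapunov's stability theorem, with a positive definite function modulo the kernel of the
projection `P`. -/
theorem lyapunov_stability (hPP : ∀ x, P (P x) = P x) (hP₀ : P x₀ = x₀) (hr : 0 < r)
    (hHP : ∀ x, H (P x) = H x)
    (hHc : ContinuousOn H {x | ‖P x - x₀‖ < r})
    (hmin : ∀ x, ‖P x - x₀‖ < r → P x ≠ x₀ → H x₀ < H x) {η : ℝ} (hη : 0 < η) :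
    ∃ δ > 0, ∀ (T : ℝ) (x : ℝ → X), ContinuousOn x (Set.Ico 0 T) →
      (∀ t ∈ Set.Ico 0 T, (∀ τ ∈ Set.Icc 0 t, ‖P (x τ) - x₀‖ < r) → H (x t) ≤ H (x 0)) →
      ‖P (x 0) - x₀‖ < δ → ∀ t ∈ Set.Ico 0 T, ‖P (x t) - x₀‖ < η := by
  -- The bound r / 2 keeps the sphere of radius η' inside the open tube where H is controlled.
  set η' := min η (r / 2) with hη'
  have hη'0 : 0 < η' := lt_min hη (by linarith)
  have hη'r : η' < r := (min_le_right _ _).trans_lt (by linarith)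
  have hS : IsCompact {x : X | P x = x ∧ ‖x - x₀‖ = η'} := by
    refine (isCompact_range_inter_closedBall (P := P) (x₀ := x₀) η').of_isClosed_subset ?_ ?_
    · exact (isClosed_eq P.continuous continuous_id).inter
        (isClosed_eq (by fun_prop) continuous_const)
    · exact fun x hx => ⟨hx.1, hx.2.le⟩
  -- A level m strictly above H x₀ and below all values of H on the sphere: a trajectory that starts
  -- below m cannot reach the sphere.
  obtain ⟨m, hm, hmS⟩ := hS.exists_forall_le' (f := H) (a := H x₀)
    (hHc.mono fun x hx => by
      simp only [Set.mem_ofPred_eq] at hx ⊢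
      rw [hx.1, hx.2]; exact hη'r)
    (fun x hx => hmin x (by rw [hx.1, hx.2]; exact hη'r) (by
      rw [hx.1]; rintro rfl
      have := hx.2
      simp at this; exact hη'0.ne this))
  have hopen : IsOpen {x | ‖P x - x₀‖ < r} :=
    isOpen_lt (by fun_prop) continuous_const
  have hca : ContinuousAt H x₀ := hHc.continuousAt (hopen.mem_nhds (by simp [hP₀, hr]))
  obtain ⟨δ₀, hδ₀, hδm⟩ := Metric.eventually_nhds_iff.1 (hca.eventually (gt_mem_nhds hm))
  refine ⟨min δ₀ η', lt_min hδ₀ hη'0, fun T x hxc hdec hx0 => ?_⟩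
  have hH0 : H (x 0) < m := by
    rw [← hHP]
    exact hδm (by rw [dist_eq_norm]; exact hx0.trans_le (min_le_left _ _))
  intro t ht
  refine lt_of_lt_of_le ?_ (min_le_left η (r / 2))
  by_contra hcon
  push Not at hcon
  set φ : ℝ → ℝ := fun τ => ‖P (x τ) - x₀‖ with hφ
  have hsub : Set.Icc 0 t ⊆ Set.Ico 0 T := fun τ hτ => ⟨hτ.1, hτ.2.trans_lt ht.2⟩
  have hφc : ContinuousOn φ (Set.Icc 0 t) :=
    ((P.continuous.comp_continuousOn (hxc.mono hsub)).sub continuousOn_const).norm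
  set A : Set ℝ := Set.Icc 0 t ∩ φ ⁻¹' (Set.Ici η') with hA
  have hAcl : IsClosed A := hφc.preimage_isClosed_of_isClosed isClosed_Icc isClosed_Ici
  have hAne : A.Nonempty := ⟨t, ⟨ht.1, le_rfl⟩, hcon⟩
  have hAbd : BddBelow A := ⟨0, fun τ hτ => hτ.1.1⟩
  -- The first time at which the trajectory is at distance at least η'. Before it the trajectory is
  -- inside the tube, so H has not increased up to t₁.
  set t₁ := sInf A with ht₁
  have ht₁A : t₁ ∈ A := hAcl.csInf_mem hAne hAbd
  have hbefore : ∀ τ ∈ Set.Icc 0 t, τ < t₁ → φ τ < η' := by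
    intro τ hτ hlt
    by_contra h
    push Not at h
    exact absurd (csInf_le hAbd (show τ ∈ A from ⟨hτ, h⟩)) (not_le.2 hlt)
  have hφt₁ : φ t₁ = η' := by
    refine le_antisymm ?_ ht₁A.2
    by_contra h
    push Not at h
    have h0 : φ 0 < η' := hx0.trans_le (min_le_right _ _)
    obtain ⟨τ, hτ, hτη⟩ := intermediate_value_Icc ht₁A.1.1
      (hφc.mono (Set.Icc_subset_Icc_right ht₁A.1.2)) (show η' ∈ Set.Icc (φ 0) (φ t₁) from
        ⟨h0.le, h.le⟩)
    rcases hτ.2.lt_or_eq with h1 | h1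
    · exact absurd hτη (hbefore τ ⟨hτ.1, hτ.2.trans ht₁A.1.2⟩ h1).ne
    · subst h1; exact absurd hτη h.ne'
  have hle := hdec t₁ (hsub ht₁A.1) (fun τ hτ => by
    rcases hτ.2.lt_or_eq with h1 | h1
    · exact (hbefore τ ⟨hτ.1, hτ.2.trans ht₁A.1.2⟩ h1).trans hη'r
    · subst h1; exact (hφt₁.trans_lt hη'r))
  have hge := hmS (P (x t₁)) ⟨hPP _, hφt₁⟩
  rw [hHP] at hge
  linarith

/-- LaSalle's invariance principle, modulo the kernel of the projection `P`. -/
theorem lasalle {g : X → X} {K L : NNReal} (hPP : ∀ x, P (P x) = P x)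
    (hHP : ∀ x, H (P x) = H x) (hHc : ContinuousOn H {x | ‖P x - x₀‖ < r})
    (hK : LipschitzWith K g) (hL : ∀ x, ‖g x‖ ≤ L) (hg : ∀ x, g (P x) = g x)
    (hinv : ∀ x : ℝ → X, (∀ t, 0 ≤ t → ‖P (x t) - x₀‖ < r) →
      (∀ t, 0 ≤ t → HasDerivWithinAt x (g (x t)) (Set.Ici 0) t) →
      (∀ t, 0 ≤ t → H (x t) = H (x 0)) → P (x 0) = x₀)
    {x : ℝ → X} {η : ℝ} (hηr : η < r) (hη : ∀ t, 0 ≤ t → ‖P (x t) - x₀‖ ≤ η)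
    (hx : ∀ t, 0 ≤ t → HasDerivWithinAt x (g (x t)) (Set.Ici 0) t)
    (hdec : AntitoneOn (fun t => H (x t)) (Set.Ici 0)) :
    Filter.Tendsto (fun t => ‖P (x t) - x₀‖) Filter.atTop (𝓝 0) := by
  have hcomp := isCompact_range_inter_closedBall (P := P) (x₀ := x₀) η
  set C := {x : X | P x = x ∧ ‖x - x₀‖ ≤ η} with hC
  have hmemC : ∀ t, 0 ≤ t → P (x t) ∈ C := fun t ht => ⟨hPP _, hη t ht⟩
  have hCN : C ⊆ {x | ‖P x - x₀‖ < r} := fun y hy => by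
    simp only [Set.mem_ofPred_eq]; rw [hy.1]; exact hy.2.trans_lt hηr
  obtain ⟨b, hb⟩ : BddBelow (H '' C) := (hcomp.image_of_continuousOn (hHc.mono hCN)).bddBelow
  obtain ⟨h, hh⟩ : ∃ h, Filter.Tendsto (fun t => H (x t)) Filter.atTop (𝓝 h) := by
    have hanti : Antitone fun t => H (x (max t 0)) := fun s t hst =>
      hdec (Set.mem_Ici.2 (le_max_right _ _)) (Set.mem_Ici.2 (le_max_right _ _))
        (max_le_max_right 0 hst)
    have hbd : BddBelow (Set.range fun t => H (x (max t 0))) := ⟨b, by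
      rintro _ ⟨t, rfl⟩
      change b ≤ H (x (max t 0))
      rw [← hHP]
      exact hb ⟨_, hmemC _ (le_max_right _ _), rfl⟩⟩
    refine ⟨_, (tendsto_atTop_ciInf hanti hbd).congr' ?_⟩
    filter_upwards [Filter.eventually_ge_atTop 0] with t ht
    rw [max_eq_left ht]
  by_contra hnot
  obtain ⟨e, he, hfreq⟩ : ∃ e > 0, ∃ᶠ t in Filter.atTop, e ≤ ‖P (x t) - x₀‖ := by
    by_contra hc
    push Not at hc
    apply hnot
    rw [Metric.tendsto_nhds]
    intro e he
    filter_upwards [hc e he] with t ht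
    simpa using ht
  obtain ⟨tk, htk, htke⟩ := Filter.exists_seq_forall_of_frequently
    (hfreq.and_eventually (Filter.eventually_ge_atTop 0))
  obtain ⟨ξ, hξC, σ, hσ, hlim⟩ := hcomp.tendsto_subseq (fun k => hmemC (tk k) (htke k).2)
  set s : ℕ → ℝ := fun k => tk (σ k) with hs
  have hs0 : ∀ k, 0 ≤ s k := fun k => (htke _).2
  have hsT : Filter.Tendsto s Filter.atTop Filter.atTop := htk.comp hσ.tendsto_atTop
  obtain ⟨z, hz0, hz⟩ := exists_global_integralCurve hK hL ξ
  -- translates of the trajectory converge to `z`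
  set X' : ℕ → ℝ → X := fun k τ => x (s k + τ) - x (s k) + P (x (s k)) with hX'
  -- The points x (s k) may escape along the kernel of P. The translates are shifted by a kernel
  -- vector so that they start at P (x (s k)), which converges to ξ; the invariance of g keeps them
  -- solutions.
  have hPX : ∀ k τ, P (X' k τ) = P (x (s k + τ)) := fun k τ => by
    simp [hX', hPP]
  have hX'd : ∀ k τ, 0 ≤ τ → HasDerivWithinAt (X' k) (g (X' k τ)) (Set.Ici 0) τ := by
    intro k τ hτ
    have h1 : HasDerivWithinAt (fun τ => x (s k + τ)) (g (x (s k + τ))) (Set.Ici 0) τ := by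
      have h2 := (hx (s k + τ) (add_nonneg (hs0 k) hτ))
      have h3 : HasDerivWithinAt (fun τ : ℝ => s k + τ) 1 (Set.Ici 0) τ :=
        ((hasDerivAt_id τ).const_add (s k)).hasDerivWithinAt
      have := HasDerivWithinAt.scomp τ h2 h3 (fun u hu => Set.mem_Ici.2 (add_nonneg (hs0 k) hu))
      simpa [Function.comp_def] using this
    rw [← hg, hPX, hg]
    exact (h1.sub_const _).add_const _
  have hconv : ∀ τ, 0 ≤ τ → Filter.Tendsto (fun k => X' k τ) Filter.atTop (𝓝 (z τ)) := by
    intro τ hτ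
    have hbound : ∀ k, dist (X' k τ) (z τ) ≤ dist (P (x (s k))) ξ * Real.exp (K * (τ - 0)) := by
      intro k
      refine dist_le_of_trajectories_ODE (v := fun _ => g) (K := K) (a := 0) (b := τ)
        (fun _ => hK) (fun t ht => ((hX'd k t ht.1).continuousWithinAt).mono
          (fun u hu => hu.1)) (fun t ht => (hX'd k t ht.1).mono (Set.Ici_subset_Ici.2 ht.1))
        (fun t _ => (hz t).continuousAt.continuousWithinAt) (fun t _ => (hz t).hasDerivWithinAt)
        ?_ τ ⟨hτ, le_rfl⟩
      simp [hX', hz0]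
    have h0 : Filter.Tendsto (fun k => dist (P (x (s k))) ξ * Real.exp (K * (τ - 0)))
        Filter.atTop (𝓝 0) := by
      have := (tendsto_iff_dist_tendsto_zero.1 hlim).mul_const (Real.exp (K * (τ - 0)))
      simpa [Function.comp_def] using this
    exact tendsto_iff_dist_tendsto_zero.2 (squeeze_zero (fun _ => dist_nonneg) hbound h0)
  have hPz : ∀ τ, 0 ≤ τ → P (z τ) ∈ C := by
    intro τ hτ
    refine hcomp.isClosed.mem_of_tendsto ((P.continuous.tendsto _).comp (hconv τ hτ))
      (Filter.Eventually.of_forall fun k => ?_)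
    simp only [Function.comp]
    rw [hPX]
    exact hmemC _ (add_nonneg (hs0 k) hτ)
  -- The decreasing function t ↦ H (x t) has the same limit h along all the shifted sequences s k +
  -- τ.
  have hHz : ∀ τ, 0 ≤ τ → H (z τ) = h := by
    intro τ hτ
    have h1 : Filter.Tendsto (fun k => H (P (X' k τ))) Filter.atTop (𝓝 (H (P (z τ)))) := by
      have hopen : IsOpen {x | ‖P x - x₀‖ < r} := isOpen_lt (by fun_prop) continuous_const
      exact ((hHc.continuousAt (hopen.mem_nhds (hCN (hPz τ hτ)))).tendsto.comp
        (P.continuous.tendsto _)).comp (hconv τ hτ)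
    have h2 : Filter.Tendsto (fun k => H (P (X' k τ))) Filter.atTop (𝓝 h) := by
      simp only [hPX, hHP]
      exact hh.comp (Filter.tendsto_atTop_add_const_right _ τ hsT)
    rw [← hHP]
    exact tendsto_nhds_unique h1 h2
  have hfin := hinv z (fun t ht => (hPz t ht).2.trans_lt hηr)
    (fun t _ => (hz t).hasDerivWithinAt) (fun t ht => by rw [hHz t ht, hHz 0 le_rfl])
  rw [hz0, hξC.1] at hfin
  have hlb : e ≤ ‖ξ - x₀‖ := by
    refine ge_of_tendsto ((hlim.sub_const x₀).norm) (Filter.Eventually.of_forall fun k => ?_)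
    exact (htke (σ k)).1
  rw [hfin] at hlb
  simp at hlb
  linarith

end Lyapunov

/-- Asymptotic stability, modulo the kernel of the projection `P`, for a vector field with a
Lyapunov function satisfying the assumptions of LaSalle's invariance principle. -/
theorem asymptoticStability_of_lyapunov {X : Type*} [NormedAddCommGroup X] [NormedSpace ℝ X]
    [FiniteDimensional ℝ X] {P : X →L[ℝ] X} {x₀ : X} {H : X → ℝ} {r : ℝ} {f : X → X}
    (hPP : ∀ x, P (P x) = P x) (hP₀ : P x₀ = x₀) (hr : 0 < r)
    (hHP : ∀ x, H (P x) = H x) (hfP : ∀ x, f (P x) = f x) (hf : ContDiffAt ℝ 1 f x₀)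
    (hHd : ∀ x, ‖P x - x₀‖ < r → ∃ H' : X →L[ℝ] ℝ, HasFDerivAt H H' x ∧ H' (f x) ≤ 0)
    (hmin : ∀ x, ‖P x - x₀‖ < r → P x ≠ x₀ → H x₀ < H x)
    (hinv : ∀ x : ℝ → X, (∀ t, 0 ≤ t → ‖P (x t) - x₀‖ < r) →
      (∀ t, 0 ≤ t → HasDerivWithinAt x (f (x t)) (Set.Ici 0) t) →
      (∀ t, 0 ≤ t → H (x t) = H (x 0)) → P (x 0) = x₀) :
    (∀ η > 0, ∃ δ > 0, ∀ (T : ℝ) (x : ℝ → X), ContinuousOn x (Set.Ico 0 T) →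
      (∀ t ∈ Set.Ico 0 T, ‖P (x t) - x₀‖ < r → HasDerivWithinAt x (f (x t)) (Set.Ico 0 T) t) →
      ‖P (x 0) - x₀‖ < δ → ∀ t ∈ Set.Ico 0 T, ‖P (x t) - x₀‖ < η) ∧
    (∃ δ > 0, ∀ a, ‖P a - x₀‖ < δ → ∃ x : ℝ → X, x 0 = a ∧ ∀ t, 0 ≤ t → ‖P (x t) - x₀‖ < r ∧
      HasDerivWithinAt x (f (x t)) (Set.Ici 0) t) ∧
    (∃ δ > 0, ∀ x : ℝ → X, ContinuousOn x (Set.Ici 0) →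
      (∀ t, 0 ≤ t → ‖P (x t) - x₀‖ < r → HasDerivWithinAt x (f (x t)) (Set.Ici 0) t) →
      ‖P (x 0) - x₀‖ < δ →
      Filter.Tendsto (fun t => ‖P (x t) - x₀‖) Filter.atTop (𝓝 0)) := by
  have hHc : ContinuousOn H {x | ‖P x - x₀‖ < r} := fun x hx => by
    obtain ⟨H', h1, -⟩ := hHd x hx
    exact h1.continuousAt.continuousWithinAt
  -- the energy decreases along trajectories
  have hdec : ∀ (I : Set ℝ) (x : ℝ → X) (t₁ t₂ : ℝ), Set.Icc t₁ t₂ ⊆ I → t₁ ≤ t₂ →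
      (∀ t ∈ Set.Icc t₁ t₂, ‖P (x t) - x₀‖ < r) →
      (∀ t ∈ Set.Icc t₁ t₂, HasDerivWithinAt x (f (x t)) I t) → H (x t₂) ≤ H (x t₁) := by
    intro I x t₁ t₂ hI h12 hxr hx
    have hd : ∀ t ∈ Set.Icc t₁ t₂, ∃ d ≤ 0,
        HasDerivWithinAt (fun t => H (x t)) d (Set.Icc t₁ t₂) t := by
      intro t ht
      obtain ⟨H', h1, h2⟩ := hHd (x t) (hxr t ht)
      exact ⟨_, h2, h1.comp_hasDerivWithinAt t ((hx t ht).mono hI)⟩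
    refine antitoneOn_of_deriv_nonpos (f := fun t => H (x t)) (convex_Icc t₁ t₂) (fun t ht => ?_) (fun t ht => ?_)
      (fun t ht => ?_) (Set.left_mem_Icc.2 h12) (Set.right_mem_Icc.2 h12) h12
    · obtain ⟨d, -, h⟩ := hd t ht
      exact h.continuousWithinAt
    · obtain ⟨d, -, h⟩ := hd t (interior_subset ht)
      exact (h.mono interior_subset).differentiableWithinAt
    · obtain ⟨d, h0, h⟩ := hd t (interior_subset ht)
      rw [(h.hasDerivAt (mem_interior_iff_mem_nhds.1 ht)).deriv]
      exact h0
  -- The radius r₁ is left free: it is r in the first claim, and a smaller radius for curves that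
  -- are known to follow f only near x₀.
  have hstab : ∀ r₁, 0 < r₁ → r₁ ≤ r → ∀ η > 0, ∃ δ > 0, ∀ (T : ℝ) (x : ℝ → X),
      ContinuousOn x (Set.Ico 0 T) →
      (∀ t ∈ Set.Ico 0 T, ‖P (x t) - x₀‖ < r₁ → HasDerivWithinAt x (f (x t)) (Set.Ico 0 T) t) →
      ‖P (x 0) - x₀‖ < δ → ∀ t ∈ Set.Ico 0 T, ‖P (x t) - x₀‖ < η := by
    intro r₁ hr₁ hr₁r η hη
    obtain ⟨δ, hδ, h⟩ := lyapunov_stability (r := r₁) hPP hP₀ hr₁ hHP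
        (hHc.mono fun x (hx : _ < _) => hx.trans_le hr₁r)
        (fun x hx => hmin x (hx.trans_le hr₁r)) (η := η) hη
    refine ⟨δ, hδ, fun T x hc hx h0 => h T x hc (fun t ht hτ => ?_) h0⟩
    have hsub : Set.Icc 0 t ⊆ Set.Ico 0 T := fun τ hτ => ⟨hτ.1, hτ.2.trans_lt ht.2⟩
    exact hdec (Set.Ico 0 T) x 0 t hsub ht.1 (fun τ h => (hτ τ h).trans_le hr₁r)
      (fun τ h => hx τ (hsub h) (hτ τ h))
  have hstabI : ∀ r₁, 0 < r₁ → r₁ ≤ r → ∀ η > 0, ∃ δ > 0, ∀ x : ℝ → X,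
      ContinuousOn x (Set.Ici 0) →
      (∀ t, 0 ≤ t → ‖P (x t) - x₀‖ < r₁ → HasDerivWithinAt x (f (x t)) (Set.Ici 0) t) →
      ‖P (x 0) - x₀‖ < δ → ∀ t, 0 ≤ t → ‖P (x t) - x₀‖ < η := by
    intro r₁ hr₁ hr₁r η hη
    obtain ⟨δ, hδ, h⟩ := hstab r₁ hr₁ hr₁r η hη
    refine ⟨δ, hδ, fun x hc hx h0 t ht => ?_⟩
    have hsub : Set.Ico 0 (t + 1) ⊆ Set.Ici 0 := fun τ hτ => hτ.1
    exact h (t + 1) x (hc.mono hsub) (fun τ hτ hN => (hx τ hτ.1 hN).mono hsub) h0 t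
      ⟨ht, by linarith⟩
  -- a globally Lipschitz vector field that agrees with `f` near `x₀`
  obtain ⟨ρ, hρ, hρf⟩ := Metric.eventually_nhds_iff.1 (hf.eventually (by simp))
  set r' := min (r / 2) (ρ / 4) with hr'
  have hr'0 : 0 < r' := lt_min (by linarith) (by linarith)
  have hr'r : r' < r := (min_le_left _ _).trans_lt (by linarith)
  have hr'ρ : 2 * r' < ρ := by
    have := min_le_right (r / 2) (ρ / 4)
    linarith
  -- The bump equals 1 on the ball of radius r' and lives in the ball of radius 2 r' < ρ, where f is
  -- C¹.
  let φ : ContDiffBump x₀ := ⟨r', 2 * r', hr'0, by linarith⟩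
  set h : X → X := fun x => φ x • f x with hh
  have hts : tsupport h ⊆ Metric.closedBall x₀ (2 * r') := by
    have := φ.tsupport_eq
    rw [show φ.rOut = 2 * r' from rfl] at this
    rw [← this]
    exact closure_mono (Function.support_smul_subset_left _ _)
  have hhC : ContDiff ℝ 1 h := by
    refine contDiff_iff_contDiffAt.2 fun x => ?_
    by_cases hx : x ∈ tsupport h
    swap
    · exact contDiffAt_const.congr_of_eventuallyEq (notMem_tsupport_iff_eventuallyEq.1 hx)
    refine φ.contDiffAt.smul (hρf ?_)
    exact (Metric.mem_closedBall.1 (hts hx)).trans_lt hr'ρ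
  have hhS : HasCompactSupport h := by
    have := FiniteDimensional.proper ℝ X
    exact (isCompact_closedBall x₀ (2 * r')).of_isClosed_subset (isClosed_tsupport h) hts
  obtain ⟨K, hK⟩ := hhC.lipschitzWith_of_hasCompactSupport hhS (by simp)
  obtain ⟨L, hL⟩ := hhS.exists_bound_of_continuous hhC.continuous
  -- Cutting off at P x instead of x keeps the invariance under P, while g stays bounded and
  -- globally Lipschitz and equals f on a full tube.
  set g : X → X := fun x => h (P x) with hg
  have hgK : LipschitzWith (K * ‖P‖₊) g := hK.comp P.lipschitz
  have hgL : ∀ x, ‖g x‖ ≤ L.toNNReal := fun x => (hL _).trans (Real.le_coe_toNNReal L)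
  have hgP : ∀ x, g (P x) = g x := fun x => by simp [hg, hPP]
  have hgf : ∀ x, ‖P x - x₀‖ < r' → g x = f x := by
    intro x hx
    have : φ (P x) = 1 := φ.one_of_mem_closedBall (by
      rw [Metric.mem_closedBall, dist_eq_norm]; exact hx.le)
    simp [hg, hh, this, hfP]
  -- Trajectories confined to the tube of radius r' / 2 never see the cut-off, so f and g have the
  -- same ones there.
  obtain ⟨δ, hδ, hδ'⟩ := hstabI r' hr'0 hr'r.le (r' / 2) (by linarith)
  refine ⟨hstab r hr le_rfl, ⟨δ, hδ, fun a ha => ?_⟩, ⟨δ, hδ, fun x hxc hx hx0 => ?_⟩⟩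
  · obtain ⟨x, hx0, hx⟩ := exists_global_integralCurve hgK hgL a
    have hin := hδ' x (fun t _ => (hx t).continuousAt.continuousWithinAt)
      (fun t _ hN => by rw [← hgf _ hN]; exact (hx t).hasDerivWithinAt) (by rwa [hx0])
    refine ⟨x, hx0, fun t ht => ⟨(hin t ht).trans (by linarith), ?_⟩⟩
    rw [← hgf _ ((hin t ht).trans (by linarith))]
    exact (hx t).hasDerivWithinAt
  · have hin := hδ' x hxc (fun t ht hN => hx t ht (hN.trans hr'r)) hx0
    have hxg : ∀ t, 0 ≤ t → HasDerivWithinAt x (f (x t)) (Set.Ici 0) t := fun t ht =>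
      hx t ht ((hin t ht).trans (by linarith))
    refine lasalle (r := r') (η := r' / 2) hPP hHP
      (hHc.mono fun x (hx : _ < _) => hx.trans hr'r) hgK hgL hgP (fun z hz hzd hzH => ?_)
      (by linarith) (fun t ht => (hin t ht).le) (fun t ht => ?_) (fun s hs t _ hst => ?_)
    · exact hinv z (fun t ht => (hz t ht).trans hr'r) (fun t ht => by
        rw [← hgf _ (hz t ht)]; exact hzd t ht) hzH
    · rw [hgf _ ((hin t ht).trans (by linarith))]
      exact hxg t ht
    · have h0 : ∀ τ ∈ Set.Icc s t, 0 ≤ τ := fun τ hτ => le_trans hs hτ.1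
      exact hdec (Set.Ici 0) x s t h0 hst
        (fun τ hτ => (hin τ (h0 τ hτ)).trans (by linarith)) (fun τ hτ => hxg τ (h0 τ hτ))

/-! ### Positive definite forms and nondegenerate minima -/

section PosDef

variable {E : Type*} [NormedAddCommGroup E] [NormedSpace ℝ E] [FiniteDimensional ℝ E]

theorem exists_lower_bound_of_posDef (Q : E →L[ℝ] E) (b : E →L[ℝ] E →L[ℝ] ℝ)
    (hb : ∀ u, Q u = u → u ≠ 0 → 0 < b u u) :
    ∃ c > 0, ∀ u, Q u = u → c * ‖u‖ ^ 2 ≤ b u u := by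
  have hS : IsCompact {u : E | Q u = u ∧ ‖u‖ = 1} := by
    have := FiniteDimensional.proper ℝ E
    refine (isCompact_closedBall (0 : E) 1).of_isClosed_subset ?_ ?_
    · exact (isClosed_eq Q.continuous continuous_id).inter
        (isClosed_eq continuous_norm continuous_const)
    · intro u hu
      rw [mem_closedBall_zero_iff]; exact hu.2.le
  obtain ⟨c, hc, h⟩ := hS.exists_forall_le' (f := fun u => b u u) (a := 0)
    (by fun_prop) (fun u hu => hb u hu.1 (by
      rintro rfl
      have := hu.2
      simp at this))
  refine ⟨c, hc, fun u hu => ?_⟩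
  rcases eq_or_ne u 0 with rfl | h0
  · simp
  have hn : 0 < ‖u‖ := norm_pos_iff.2 h0
  have := h (‖u‖⁻¹ • u) ⟨by rw [map_smul, hu], by rw [norm_smul]; simp [hn.ne']⟩
  simp only [map_smul, smul_apply, smul_eq_mul] at this
  calc c * ‖u‖ ^ 2 ≤ (‖u‖⁻¹ * (‖u‖⁻¹ * b u u)) * ‖u‖ ^ 2 := by gcongr
    _ = b u u := by field_simp

/-- Replacing f y₀ by f y changes the quadratic form by at most ‖f y - f y₀‖ ‖u‖², which half of the
constant absorbs. -/
theorem eventually_lower_bound_of_posDef {Y : Type*} [TopologicalSpace Y] (Q : E →L[ℝ] E)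
    {f : Y → E →L[ℝ] E →L[ℝ] ℝ} {y₀ : Y} (hf : ContinuousAt f y₀)
    (hb : ∀ u, Q u = u → u ≠ 0 → 0 < f y₀ u u) :
    ∃ c > 0, ∀ᶠ y in 𝓝 y₀, ∀ u, Q u = u → c * ‖u‖ ^ 2 ≤ f y u u := by
  obtain ⟨c, hc, h⟩ := exists_lower_bound_of_posDef Q (f y₀) hb
  refine ⟨c / 2, by linarith, ?_⟩
  have hball : ∀ᶠ y in 𝓝 y₀, f y ∈ Metric.ball (f y₀) (c / 2) :=
    hf.eventually (Metric.ball_mem_nhds (f y₀) (by linarith))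
  filter_upwards [hball] with y hy u hu
  have h1 := h u hu
  have h2 : |(f y - f y₀) u u| ≤ ‖f y - f y₀‖ * ‖u‖ * ‖u‖ := (f y - f y₀).le_opNorm₂ u u
  replace hy : ‖f y - f y₀‖ < c / 2 := (dist_eq_norm (f y) (f y₀)).symm.trans_lt hy
  have h3 : ‖f y - f y₀‖ * ‖u‖ * ‖u‖ ≤ c / 2 * ‖u‖ * ‖u‖ := by gcongr
  have h4 := neg_abs_le ((f y - f y₀) u u)
  simp only [sub_apply] at h2 h4
  nlinarith

theorem eventually_posDef {Y : Type*} [TopologicalSpace Y]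
    {f : Y → E →L[ℝ] E →L[ℝ] ℝ} {y₀ : Y} (hf : ContinuousAt f y₀)
    (hb : ∀ u, u ≠ 0 → 0 < f y₀ u u) : ∀ᶠ y in 𝓝 y₀, ∀ u, u ≠ 0 → 0 < f y u u := by
  obtain ⟨c, hc, h⟩ := eventually_lower_bound_of_posDef (ContinuousLinearMap.id ℝ E) hf
    (fun u _ => hb u)
  filter_upwards [h] with y hy u hu
  have := hy u rfl
  have hn : 0 < ‖u‖ := norm_pos_iff.2 hu
  exact lt_of_lt_of_le (by positivity) this

/-- A function grows along the subspace fixed by `Q` near its critical points relative to this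
subspace, if its second derivative is positive definite on it. -/
theorem growth_of_hessian_posDef (Q : E →L[ℝ] E) {W : E → ℝ} {x₀ : E} (hW : ContDiffAt ℝ 2 W x₀)
    (hpos : ∀ u, Q u = u → u ≠ 0 → 0 < fderiv ℝ (fderiv ℝ W) x₀ u u) :
    ∃ r > 0, ∀ x, ‖x - x₀‖ < r → ∀ u, Q u = u → u ≠ 0 → ‖u‖ < r → fderiv ℝ W x u = 0 →
      0 < fderiv ℝ W (x + u) u ∧ W x < W (x + u) := by
  have hW1 : ContDiffAt ℝ 1 (fderiv ℝ W) x₀ := hW.fderiv_right (m := 1) (by norm_num)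
  have hW0 : ContDiffAt ℝ 0 (fderiv ℝ (fderiv ℝ W)) x₀ := hW1.fderiv_right (m := 0) (by norm_num)
  obtain ⟨c, hc, hev⟩ := eventually_lower_bound_of_posDef Q hW0.continuousAt hpos
  obtain ⟨ρ, hρ, h⟩ := Metric.eventually_nhds_iff.1
    (hev.and ((hW.eventually (by simp)).and (hW1.eventually (by simp))))
  -- Half of ρ for the base point and half for u keep the segment in the ball. Base points other
  -- than x₀ are needed for the dissipation function, whose minimum persists as the shape varies.
  refine ⟨ρ / 2, by linarith, fun x hx u hQu hu hur hcrit => ?_⟩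
  have hseg : ∀ t ∈ Set.Icc (0 : ℝ) 1, dist (x + t • u) x₀ < ρ := by
    intro t ht
    rw [dist_eq_norm]
    calc ‖x + t • u - x₀‖ = ‖(x - x₀) + t • u‖ := by congr 1; abel
      _ ≤ ‖x - x₀‖ + ‖t • u‖ := norm_add_le _ _
      _ ≤ ‖x - x₀‖ + 1 * ‖u‖ := by
        rw [norm_smul, Real.norm_of_nonneg ht.1]
        gcongr
        exact ht.2
      _ < ρ := by linarith
  have hline : ∀ t : ℝ, HasDerivAt (fun t : ℝ => x + t • u) u t := fun t => by
    simpa using ((hasDerivAt_id t).smul_const u).const_add x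
  have hφ : ∀ t ∈ Set.Icc (0 : ℝ) 1, HasDerivAt (fun t : ℝ => fderiv ℝ W (x + t • u) u)
      (fderiv ℝ (fderiv ℝ W) (x + t • u) u u) t := by
    intro t ht
    have h1 := ((h (hseg t ht)).2.2.differentiableAt (by simp)).hasFDerivAt
    have h2 := h1.comp_hasDerivAt t (hline t)
    exact (ContinuousLinearMap.apply ℝ ℝ u).hasFDerivAt.comp_hasDerivAt t h2
  have hψ : ∀ t ∈ Set.Icc (0 : ℝ) 1, HasDerivAt (fun t : ℝ => W (x + t • u))
      (fderiv ℝ W (x + t • u) u) t := by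
    intro t ht
    have h1 := ((h (hseg t ht)).2.1.differentiableAt (by simp)).hasFDerivAt
    exact h1.comp_hasDerivAt t (hline t)
  have hn : 0 < ‖u‖ := norm_pos_iff.2 hu
  have hpos' : ∀ t ∈ Set.Icc (0 : ℝ) 1, 0 < fderiv ℝ (fderiv ℝ W) (x + t • u) u u := by
    intro t ht
    exact lt_of_lt_of_le (by positivity) ((h (hseg t ht)).1 u hQu)
  have hmono : StrictMonoOn (fun t : ℝ => fderiv ℝ W (x + t • u) u) (Set.Icc 0 1) := by
    refine strictMonoOn_of_deriv_pos (convex_Icc 0 1)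
      (fun t ht => (hφ t ht).continuousAt.continuousWithinAt) (fun t ht => ?_)
    rw [(hφ t (interior_subset ht)).deriv]
    exact hpos' t (interior_subset ht)
  have hφpos : ∀ t ∈ Set.Ioc (0 : ℝ) 1, 0 < fderiv ℝ W (x + t • u) u := by
    intro t ht
    have := hmono (Set.left_mem_Icc.2 zero_le_one) ⟨ht.1.le, ht.2⟩ ht.1
    simpa [hcrit] using this
  have hmono2 : StrictMonoOn (fun t : ℝ => W (x + t • u)) (Set.Icc 0 1) := by
    refine strictMonoOn_of_deriv_pos (convex_Icc 0 1)
      (fun t ht => (hψ t ht).continuousAt.continuousWithinAt) (fun t ht => ?_)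
    rw [(hψ t (interior_subset ht)).deriv]
    rw [interior_Icc] at ht
    exact hφpos t ⟨ht.1, ht.2.le⟩
  refine ⟨by simpa using hφpos 1 ⟨one_pos, le_rfl⟩, ?_⟩
  simpa using hmono2 (Set.left_mem_Icc.2 zero_le_one) (Set.right_mem_Icc.2 zero_le_one) one_pos

/-- A positive semidefinite symmetric form vanishes at `u` only if `u` is in its kernel. -/
theorem eq_zero_of_posSemidef {V : Type*} [NormedAddCommGroup V] [NormedSpace ℝ V]
    {b : V →L[ℝ] V →L[ℝ] ℝ} (hsymm : ∀ u v, b u v = b v u) (hb : ∀ u, 0 ≤ b u u) {u : V}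
    (hu : b u u = 0) (v : V) : b u v = 0 := by
  by_contra hne
  have key : ∀ t : ℝ, 0 ≤ t * 2 * b u v + b v v := by
    intro t
    have := hb (t • u + v)
    simp only [map_add, map_smul, add_apply, smul_apply,
      smul_eq_mul, hu, hsymm v u] at this
    linarith
  -- This value of t makes the affine function of t equal to -1.
  have := key (-(b v v + 1) / (2 * b u v))
  field_simp at this
  linarith

/-- A null vector of a semidefinite form lies in its kernel, which is trivial by nondegeneracy. -/
theorem posDef_of_nondegenerate {V : Type*} [NormedAddCommGroup V] [NormedSpace ℝ V]
    {b : V →L[ℝ] V →L[ℝ] ℝ} (hsymm : ∀ u v, b u v = b v u) (hb : ∀ u, 0 ≤ b u u)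
    (hnd : ∀ u, (∀ v, b u v = 0) → u = 0) (u : V) (hu : u ≠ 0) : 0 < b u u := by
  refine lt_of_le_of_ne (hb u) fun h => hu (hnd u fun v => ?_)
  exact eq_zero_of_posSemidef hsymm hb h.symm v

/-- The second derivative along a line. -/
theorem hasDerivAt_fderiv_line {V : Type*} [NormedAddCommGroup V] [NormedSpace ℝ V]
    {f : V → ℝ} {x : V} (hf : ContDiffAt ℝ 2 f x) (u : V) :
    (∀ᶠ t : ℝ in 𝓝 0, HasDerivAt (fun t : ℝ => f (x + t • u)) (fderiv ℝ f (x + t • u) u) t) ∧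
    HasDerivAt (fun t : ℝ => fderiv ℝ f (x + t • u) u) (fderiv ℝ (fderiv ℝ f) x u u) 0 := by
  have hline : ∀ t : ℝ, HasDerivAt (fun t : ℝ => x + t • u) u t := fun t => by
    simpa using ((hasDerivAt_id t).smul_const u).const_add x
  have h0 : x + (0 : ℝ) • u = x := by simp
  constructor
  · have hc : Filter.Tendsto (fun t : ℝ => x + t • u) (𝓝 0) (𝓝 x) := by
      have := (hline 0).continuousAt.tendsto
      rwa [h0] at this
    filter_upwards [hc.eventually (hf.eventually (by simp))] with t ht
    exact ((ht.differentiableAt (by simp)).hasFDerivAt).comp_hasDerivAt t (hline t)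
  · have h1 := ((hf.fderiv_right (m := 1) (by norm_num)).differentiableAt (by simp)).hasFDerivAt
    rw [← h0] at h1
    have h2 := h1.comp_hasDerivAt (0 : ℝ) (hline 0)
    rw [h0] at h2
    exact (ContinuousLinearMap.apply ℝ ℝ u).hasFDerivAt.comp_hasDerivAt (0 : ℝ) h2

/-- The first derivative vanishes at x, so a negative second derivative along u would make f
strictly decreasing on a short ray from x. -/
theorem hessian_nonneg_of_isLocalMin {V : Type*} [NormedAddCommGroup V] [NormedSpace ℝ V]
    {f : V → ℝ} {x : V} (hf : ContDiffAt ℝ 2 f x) (hmin : IsLocalMin f x) (u : V) :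
    0 ≤ fderiv ℝ (fderiv ℝ f) x u u := by
  by_contra hneg
  push Not at hneg
  obtain ⟨h1, h2⟩ := hasDerivAt_fderiv_line hf u
  have hcrit : fderiv ℝ f x = 0 := hmin.fderiv_eq_zero
  -- the derivative along the line is negative for small positive times
  have h3 : ∀ᶠ t : ℝ in 𝓝[>] 0, fderiv ℝ f (x + t • u) u < 0 := by
    have := h2.tendsto_slope.mono_left (nhdsWithin_mono (0 : ℝ)
      (fun t (ht : 0 < t) => (ne_of_gt ht : t ≠ 0)))
    filter_upwards [this.eventually (gt_mem_nhds hneg), self_mem_nhdsWithin] with t ht ht0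
    simp only [slope_def_field, sub_zero, zero_smul, add_zero, hcrit,
      zero_apply] at ht
    have ht0' : 0 < t := ht0
    by_contra hc
    push Not at hc
    exact absurd ht (not_lt.2 (div_nonneg hc ht0'.le))
  have hc : Filter.Tendsto (fun t : ℝ => x + t • u) (𝓝 0) (𝓝 x) := by
    have : Continuous fun t : ℝ => x + t • u := by fun_prop
    simpa using this.tendsto 0
  have h4 := (hc.eventually hmin)
  obtain ⟨a, ha, ha'⟩ := Metric.eventually_nhds_iff.1 (h1.and h4)
  obtain ⟨b, hb, hb'⟩ := mem_nhdsGT_iff_exists_Ioo_subset.1 h3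
  have hb0 : (0 : ℝ) < b := hb
  set t₁ := min (a / 2) (b / 2) with ht₁
  have ht₁0 : 0 < t₁ := lt_min (by linarith) (by linarith)
  have ht₁a : t₁ < a := (min_le_left _ _).trans_lt (by linarith)
  have ht₁b : t₁ < b := (min_le_right _ _).trans_lt (by linarith)
  have hmem : ∀ t ∈ Set.Icc 0 t₁, dist t 0 < a := fun t ht => by
    rw [Real.dist_eq, sub_zero, abs_of_nonneg ht.1]; linarith [ht.2]
  have hanti : StrictAntiOn (fun t : ℝ => f (x + t • u)) (Set.Icc 0 t₁) := by
    refine strictAntiOn_of_deriv_neg (convex_Icc 0 t₁)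
      (fun t ht => (ha' (hmem t ht)).1.continuousAt.continuousWithinAt) (fun t ht => ?_)
    rw [(ha' (hmem t (interior_subset ht))).1.deriv]
    rw [interior_Icc] at ht
    exact hb' ⟨ht.1, ht.2.trans ht₁b⟩
  have h5 := hanti (Set.left_mem_Icc.2 ht₁0.le) (Set.right_mem_Icc.2 ht₁0.le) ht₁0
  have h6 := (ha' (hmem t₁ (Set.right_mem_Icc.2 ht₁0.le))).2
  simp at h5 h6
  linarith

theorem hessian_symm {V : Type*} [NormedAddCommGroup V] [NormedSpace ℝ V]
    {f : V → ℝ} {x : V} (hf : ContDiffAt ℝ 2 f x) (u v : V) :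
    fderiv ℝ (fderiv ℝ f) x u v = fderiv ℝ (fderiv ℝ f) x v u :=
  (hf.isSymmSndFDerivAt (by simp)) u v

end PosDef

/-! ### Mechanical systems with dissipation -/

section Mechanical

set_option maxSynthPendingDepth 3

variable {E : Type*} [NormedAddCommGroup E] [NormedSpace ℝ E]

/-- The generalized force `∂L/∂y - F` of the Lagrangian `L = G(v,v)/2 + b v - W` with the
dissipative force `F`. -/
noncomputable def generalizedForce (G : E → E →L[ℝ] E →L[ℝ] ℝ) (b : E → E →L[ℝ] ℝ) (W : E → ℝ)
    (F : E → E → E →L[ℝ] ℝ) (y v : E) : E →L[ℝ] ℝ :=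
  (1 / 2 : ℝ) • ((fderiv ℝ G y).flip v).flip v + (fderiv ℝ b y).flip v - fderiv ℝ W y - F y v

/-- The acceleration that solves the Lagrange equations of `L = G(v,v)/2 + b v - W` with the
dissipative force `F`. -/
noncomputable def acceleration (G : E → E →L[ℝ] E →L[ℝ] ℝ) (b : E → E →L[ℝ] ℝ) (W : E → ℝ)
    (F : E → E → E →L[ℝ] ℝ) (y v : E) : E :=
  (G y).inverse (generalizedForce G b W F y v - fderiv ℝ G y v v - fderiv ℝ b y v)

variable {G : E → E →L[ℝ] E →L[ℝ] ℝ} {b : E → E →L[ℝ] ℝ} {W : E → ℝ}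
    {F : E → E → E →L[ℝ] ℝ}

/-- Definiteness gives injectivity into the dual, and the dimensions agree. The mass matrix is
inverted this way in `apply_acceleration`, and the finite dimension of the dual is read off from the
elastic Hessian in `exists_curve_of_critical_points`. -/
theorem exists_equiv_of_posDef [FiniteDimensional ℝ E] {g : E →L[ℝ] E →L[ℝ] ℝ}
    (hg : ∀ u, u ≠ 0 → 0 < g u u) :
    ∃ e : E ≃L[ℝ] (E →L[ℝ] ℝ), (e : E →L[ℝ] E →L[ℝ] ℝ) = g := by
  have hinj : Function.Injective (g : E →ₗ[ℝ] (E →L[ℝ] ℝ)) := by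
    rw [← LinearMap.ker_eq_bot, LinearMap.ker_eq_bot']
    intro u hu
    by_contra h0
    have h1 := hg u h0
    have h2 : g u = 0 := hu
    rw [h2] at h1
    simp at h1
  have hdim : Module.finrank ℝ E = Module.finrank ℝ (E →L[ℝ] ℝ) := by
    rw [← (LinearMap.toContinuousLinearMap : (E →ₗ[ℝ] ℝ) ≃ₗ[ℝ] (E →L[ℝ] ℝ)).finrank_eq]
    exact (Subspace.dual_finrank_eq).symm
  refine ⟨(LinearEquiv.ofInjectiveOfFinrankEq _ hinj hdim).toContinuousLinearEquiv, ?_⟩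
  ext u v
  rfl

theorem ContDiffAt.clm_flip {X A B C : Type*} [NormedAddCommGroup X] [NormedSpace ℝ X]
    [NormedAddCommGroup A] [NormedSpace ℝ A] [NormedAddCommGroup B] [NormedSpace ℝ B]
    [NormedAddCommGroup C] [NormedSpace ℝ C] {n : WithTop ℕ∞} {f : X → A →L[ℝ] B →L[ℝ] C} {x : X}
    (hf : ContDiffAt ℝ n f x) : ContDiffAt ℝ n (fun x => (f x).flip) x :=
  (ContinuousLinearMap.flipₗᵢ ℝ A B C).contDiff.contDiffAt.comp x hf

/-- Inversion is smooth at an invertible operator. One derivative of G, b and W is spent in the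
forces; the remaining C¹ regularity makes the cut-off field Lipschitz. -/
theorem contDiffAt_acceleration [FiniteDimensional ℝ E] {y₀ v₀ : E} (hG : ContDiffAt ℝ 2 G y₀)
    (hb : ContDiffAt ℝ 2 b y₀) (hW : ContDiffAt ℝ 2 W y₀)
    (hF : ContDiffAt ℝ 1 (Function.uncurry F) (y₀, v₀)) (hpos : ∀ u, u ≠ 0 → 0 < G y₀ u u) :
    ContDiffAt ℝ 1 (fun x : E × E => acceleration G b W F x.1 x.2) (y₀, v₀) := by
  have hfst : ContDiffAt ℝ 1 (Prod.fst : E × E → E) (y₀, v₀) := contDiffAt_fst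
  have hsnd : ContDiffAt ℝ 1 (Prod.snd : E × E → E) (y₀, v₀) := contDiffAt_snd
  have hG' : ContDiffAt ℝ 1 (fun x : E × E => fderiv ℝ G x.1) (y₀, v₀) :=
    (hG.fderiv_right (m := 1) (by norm_num)).comp (y₀, v₀) hfst
  have hb' : ContDiffAt ℝ 1 (fun x : E × E => fderiv ℝ b x.1) (y₀, v₀) :=
    (hb.fderiv_right (m := 1) (by norm_num)).comp (y₀, v₀) hfst
  have hW' : ContDiffAt ℝ 1 (fun x : E × E => fderiv ℝ W x.1) (y₀, v₀) :=
    (hW.fderiv_right (m := 1) (by norm_num)).comp (y₀, v₀) hfst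
  have hforce : ContDiffAt ℝ 1 (fun x : E × E => generalizedForce G b W F x.1 x.2) (y₀, v₀) := by
    unfold generalizedForce
    have h1 : ContDiffAt ℝ 1 (fun x : E × E => (fderiv ℝ G x.1).flip x.2) (y₀, v₀) :=
      hG'.clm_flip.clm_apply hsnd
    have h2 : ContDiffAt ℝ 1 (fun x : E × E => ((fderiv ℝ G x.1).flip x.2).flip x.2) (y₀, v₀) :=
      h1.clm_flip.clm_apply hsnd
    have h3 : ContDiffAt ℝ 1 (fun x : E × E => (fderiv ℝ b x.1).flip x.2) (y₀, v₀) :=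
      hb'.clm_flip.clm_apply hsnd
    have h4 : ContDiffAt ℝ 1
        (fun x : E × E => (1 / 2 : ℝ) • ((fderiv ℝ G x.1).flip x.2).flip x.2) (y₀, v₀) :=
      h2.const_smul (1 / 2 : ℝ)
    have h5 : ContDiffAt ℝ 1 (fun x : E × E => F x.1 x.2) (y₀, v₀) := hF
    have h6 := h4.add h3
    have h7 := h6.sub hW'
    exact h7.sub h5
  obtain ⟨e, he⟩ := exists_equiv_of_posDef hpos
  have hinv : ContDiffAt ℝ 1 (fun x : E × E => (G x.1).inverse) (y₀, v₀) := by
    have h1 : ContDiffAt ℝ 1 (ContinuousLinearMap.inverse : (E →L[ℝ] E →L[ℝ] ℝ) → _) (G y₀) := by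
      rw [← he]
      have : CompleteSpace E := FiniteDimensional.complete ℝ E
      exact contDiffAt_map_inverse e
    exact h1.comp (y₀, v₀) ((hG.of_le (by norm_num)).comp (y₀, v₀) hfst)
  exact hinv.clm_apply ((hforce.sub ((hG'.clm_apply hsnd).clm_apply hsnd)).sub
    (hb'.clm_apply hsnd))

theorem apply_acceleration [FiniteDimensional ℝ E] {y v : E} (hpos : ∀ u, u ≠ 0 → 0 < G y u u) :
    G y (acceleration G b W F y v) =
      generalizedForce G b W F y v - fderiv ℝ G y v v - fderiv ℝ b y v := by
  obtain ⟨e, he⟩ := exists_equiv_of_posDef hpos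
  unfold acceleration
  rw [← he, ContinuousLinearMap.inverse_equiv]
  simp

/-- The Lagrange equations, solved for the acceleration. -/
theorem hasDerivWithinAt_momentum_iff [FiniteDimensional ℝ E] {I : Set ℝ} {t : ℝ}
    (hI : UniqueDiffWithinAt ℝ I t) {y v : ℝ → E}
    (hG : DifferentiableAt ℝ G (y t)) (hb : DifferentiableAt ℝ b (y t))
    (hpos : ∀ u, u ≠ 0 → 0 < G (y t) u u) (hy : HasDerivWithinAt y (v t) I t) :
    (DifferentiableWithinAt ℝ v I t ∧ HasDerivWithinAt (fun τ => G (y τ) (v τ) + b (y τ))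
        (generalizedForce G b W F (y t) (v t)) I t) ↔
      HasDerivWithinAt v (acceleration G b W F (y t) (v t)) I t := by
  have key : ∀ a, HasDerivWithinAt v a I t → HasDerivWithinAt (fun τ => G (y τ) (v τ) + b (y τ))
      (fderiv ℝ G (y t) (v t) (v t) + G (y t) a + fderiv ℝ b (y t) (v t)) I t := by
    intro a ha
    have h1 := hG.hasFDerivAt.comp_hasDerivWithinAt t hy
    have h2 := hb.hasFDerivAt.comp_hasDerivWithinAt t hy
    exact (h1.clm_apply ha).add h2
  constructor
  · rintro ⟨hv, hm⟩
    have h1 := hv.hasDerivWithinAt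
    have h2 := hI.eq_deriv I (key _ h1) hm
    have h3 := apply_acceleration (b := b) (W := W) (F := F) (v := v t) hpos
    have h4 : G (y t) (derivWithin v I t) = G (y t) (acceleration G b W F (y t) (v t)) := by
      rw [h3, ← h2]; abel
    obtain ⟨e, he⟩ := exists_equiv_of_posDef hpos
    rw [← he] at h4
    rw [← e.injective h4]
    exact h1
  · intro hv
    refine ⟨hv.differentiableWithinAt, ?_⟩
    have := key _ hv
    rw [apply_acceleration hpos] at this
    convert this using 1
    abel

/-- The energy balance. -/
theorem hasFDerivAt_energy [FiniteDimensional ℝ E] {y v : E} (hG : DifferentiableAt ℝ G y)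
    (hW : DifferentiableAt ℝ W y) (hsymm : ∀ u u', G y u u' = G y u' u)
    (hpos : ∀ u, u ≠ 0 → 0 < G y u u) :
    ∃ H' : E × E →L[ℝ] ℝ, HasFDerivAt (fun x : E × E => 1 / 2 * G x.1 x.2 x.2 + W x.1) H' (y, v) ∧
      H' (v, acceleration G b W F y v) = -F y v v := by
  have h1 : HasFDerivAt (fun x : E × E => G x.1) ((fderiv ℝ G y).comp
      (ContinuousLinearMap.fst ℝ E E)) (y, v) :=
    HasFDerivAt.comp (y, v) (g := G) hG.hasFDerivAt hasFDerivAt_fst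
  have h2 : HasFDerivAt (fun x : E × E => W x.1) ((fderiv ℝ W y).comp
      (ContinuousLinearMap.fst ℝ E E)) (y, v) :=
    HasFDerivAt.comp (y, v) (g := W) hW.hasFDerivAt hasFDerivAt_fst
  have h3 : HasFDerivAt (fun x : E × E => x.2) (ContinuousLinearMap.snd ℝ E E) (y, v) :=
    hasFDerivAt_snd
  refine ⟨_, (((h1.clm_apply h3).clm_apply h3).const_mul (1 / 2)).add h2, ?_⟩
  have h4 := congrArg (fun l : E →L[ℝ] ℝ => l v)
    (apply_acceleration (b := b) (W := W) (F := F) (v := v) hpos)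
  simp only [generalizedForce, sub_apply, add_apply, smul_apply, ContinuousLinearMap.flip_apply,
    smul_eq_mul] at h4
  simp only [add_apply, smul_apply, ContinuousLinearMap.flip_apply, smul_eq_mul,
    ContinuousLinearMap.comp_apply, ContinuousLinearMap.coe_fst', ContinuousLinearMap.coe_snd']
  -- The terms in the derivative of b cancel, since gyroscopic forces do no work; those in the
  -- derivative of G cancel as 1/2 + 1/2 - 1, once the symmetry of G has merged the two terms
  -- containing the acceleration.
  have h5 := hsymm v (acceleration G b W F y v)
  linarith

end Mechanical

section Mechanical

set_option maxSynthPendingDepth 3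

variable {E : Type*} [NormedAddCommGroup E] [NormedSpace ℝ E]

/-- The vector Q y - y lies in the kernel of Q, so translation by it leaves g unchanged and carries
y to Q y. -/
theorem fderiv_of_projection_invariant {Y : Type*} [NormedAddCommGroup Y] [NormedSpace ℝ Y]
    {Q : E →L[ℝ] E} (hQQ : ∀ y, Q (Q y) = Q y) {g : E → Y} (hg : ∀ y, g (Q y) = g y) (y : E) :
    fderiv ℝ g (Q y) = fderiv ℝ g y ∧
      (DifferentiableAt ℝ g (Q y) → DifferentiableAt ℝ g y) := by
  have h1 : (fun z => g (z + (Q y - y))) = g := by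
    funext z
    rw [← hg, ← hg z]
    simp [hQQ]
  have h2 : y + (Q y - y) = Q y := by abel
  constructor
  · have := fderiv_comp_add_right (𝕜 := ℝ) (f := g) (x := y) (Q y - y)
    rw [h1, h2] at this
    exact this.symm
  · intro h
    rw [← h1]
    rw [← h2] at h
    exact (differentiableAt_comp_add_right _).2 h

/-- The Lagrange equations of `L = G(v,v)/2 + b v - W` with the dissipative force `F` at time `t`,
for a curve defined on `I`. -/
def LagrangeEquations (G : E → E →L[ℝ] E →L[ℝ] ℝ) (b : E → E →L[ℝ] ℝ) (W : E → ℝ)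
    (F : E → E → E →L[ℝ] ℝ) (I : Set ℝ) (y v : ℝ → E) (t : ℝ) : Prop :=
  HasDerivWithinAt y (v t) I t ∧ DifferentiableWithinAt ℝ v I t ∧
    HasDerivWithinAt (fun τ => G (y τ) (v τ) + b (y τ)) (generalizedForce G b W F (y t) (v t)) I t

/-- Asymptotic stability of a relative minimum of the potential energy for a mechanical system with
gyroscopic and dissipative forces, modulo the kernel of the projection `Q`. -/
theorem asymptoticStability_of_dissipation [FiniteDimensional ℝ E]
    {G : E → E →L[ℝ] E →L[ℝ] ℝ} {b : E → E →L[ℝ] ℝ} {W : E → ℝ} {F : E → E → E →L[ℝ] ℝ}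
    {Q : E →L[ℝ] E} {y₀ : E} {ρ : ℝ} (hQQ : ∀ y, Q (Q y) = Q y) (hQ₀ : Q y₀ = y₀)
    (hGQ : ∀ y, G (Q y) = G y) (hbQ : ∀ y, b (Q y) = b y) (hWQ : ∀ y, W (Q y) = W y)
    (hFQ : ∀ y v, F (Q y) v = F y v)
    (hG : ContDiffAt ℝ 2 G y₀) (hb : ContDiffAt ℝ 2 b y₀) (hW : ContDiffAt ℝ 2 W y₀)
    (hF : ContDiffAt ℝ 1 (Function.uncurry F) (y₀, 0))
    (hsymm : ∀ᶠ y in 𝓝 y₀, ∀ u u', G y u u' = G y u' u) (hpos : ∀ u, u ≠ 0 → 0 < G y₀ u u)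
    (hWmin : ∀ᶠ y in 𝓝 y₀, Q y ≠ y₀ → W y₀ < W y)
    (hFdiss : ∀ᶠ x : E × E in 𝓝 (y₀, 0), 0 ≤ F x.1 x.2 x.2) (hρ : 0 < ρ)
    (hinv : ∀ y v : ℝ → E, (∀ t, 0 ≤ t → ‖Q (y t) - y₀‖ < ρ ∧ ‖v t‖ < ρ) →
      (∀ t, 0 ≤ t → LagrangeEquations G b W F (Set.Ici 0) y v t) →
      (∀ t, 0 ≤ t → F (y t) (v t) (v t) = 0) → Q (y 0) = y₀ ∧ v 0 = 0) :
    ∃ r > 0, r ≤ ρ ∧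
    (∀ η > 0, ∃ δ > 0, ∀ (T : ℝ) (y v : ℝ → E), ContinuousOn y (Set.Ico 0 T) →
      ContinuousOn v (Set.Ico 0 T) →
      (∀ t ∈ Set.Ico 0 T, ‖Q (y t) - y₀‖ < r → ‖v t‖ < r →
        LagrangeEquations G b W F (Set.Ico 0 T) y v t) →
      ‖Q (y 0) - y₀‖ < δ → ‖v 0‖ < δ → ∀ t ∈ Set.Ico 0 T, ‖Q (y t) - y₀‖ < η ∧ ‖v t‖ < η) ∧
    (∃ δ > 0, ∀ a c, ‖Q a - y₀‖ < δ → ‖c‖ < δ → ∃ y v : ℝ → E, y 0 = a ∧ v 0 = c ∧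
      ∀ t, 0 ≤ t → ‖Q (y t) - y₀‖ < r ∧ LagrangeEquations G b W F (Set.Ici 0) y v t) ∧
    (∃ δ > 0, ∀ y v : ℝ → E, ContinuousOn y (Set.Ici 0) → ContinuousOn v (Set.Ici 0) →
      (∀ t, 0 ≤ t → ‖Q (y t) - y₀‖ < r → ‖v t‖ < r →
        LagrangeEquations G b W F (Set.Ici 0) y v t) →
      ‖Q (y 0) - y₀‖ < δ → ‖v 0‖ < δ →
      Filter.Tendsto (fun t => ‖Q (y t) - y₀‖) Filter.atTop (𝓝 0) ∧
      Filter.Tendsto (fun t => ‖v t‖) Filter.atTop (𝓝 0)) := by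
  -- Only positions are projected: the velocity along the kernel of Q must also tend to zero.
  set P : E × E →L[ℝ] E × E := Q.prodMap (ContinuousLinearMap.id ℝ E) with hP
  set x₀ : E × E := (y₀, 0) with hx₀
  set H : E × E → ℝ := fun x => 1 / 2 * G x.1 x.2 x.2 + W x.1 with hH
  set f : E × E → E × E := fun x => (x.2, acceleration G b W F x.1 x.2) with hf
  have hPapp : ∀ y v, P (y, v) = (Q y, v) := fun _ _ => rfl
  have hnorm : ∀ (x : E × E) (s : ℝ), ‖P x - x₀‖ < s ↔ ‖Q x.1 - y₀‖ < s ∧ ‖x.2‖ < s := by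
    intro x s
    simp [hP, hx₀, Prod.norm_def]
  have hPev : ∀ p : E → Prop, (∀ᶠ y in 𝓝 y₀, p y) → ∀ᶠ x : E × E in 𝓝 x₀, p x.1 := fun p hp =>
    (continuous_fst.tendsto x₀).eventually hp
  obtain ⟨r₀, hr₀, hev⟩ := Metric.eventually_nhds_iff.1
    (((hPev _ ((hG.eventually (by simp)).and ((hb.eventually (by simp)).and
      (hW.eventually (by simp))))).and (hPev _ (hsymm.and
      ((eventually_posDef hG.continuousAt hpos).and hWmin)))).and hFdiss)
  set r := min r₀ ρ with hr
  have hr0 : 0 < r := lt_min hr₀ hρ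
  -- The local hypotheses are read at Q y, which is near y₀, and carried to y by invariance; y
  -- itself may be far away.
  have hgood : ∀ y v, ‖Q y - y₀‖ < r → ‖v‖ < r →
      (DifferentiableAt ℝ G y ∧ DifferentiableAt ℝ b y ∧ DifferentiableAt ℝ W y) ∧
      (∀ u u', G y u u' = G y u' u) ∧ (∀ u, u ≠ 0 → 0 < G y u u) ∧ (Q y ≠ y₀ → W y₀ < W y) ∧
      0 ≤ F y v v := by
    intro y v h1 h2
    have h3 : dist (P (y, v)) x₀ < r₀ := by
      rw [dist_eq_norm]
      exact ((hnorm (y, v) r).2 ⟨h1, h2⟩).trans_le (min_le_left _ _)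
    obtain ⟨⟨⟨a1, a2, a3⟩, b1, b2, b3⟩, c⟩ := hev h3
    simp only [hPapp] at a1 a2 a3 b1 b2 b3 c
    refine ⟨⟨?_, ?_, ?_⟩, ?_, ?_, ?_, ?_⟩
    · exact (fderiv_of_projection_invariant hQQ hGQ y).2 (a1.differentiableAt (by simp))
    · exact (fderiv_of_projection_invariant hQQ hbQ y).2 (a2.differentiableAt (by simp))
    · exact (fderiv_of_projection_invariant hQQ hWQ y).2 (a3.differentiableAt (by simp))
    · rwa [hGQ] at b1
    · rwa [hGQ] at b2
    · rwa [hQQ, hWQ] at b3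
    · rwa [hFQ] at c
  have hfP : ∀ x, f (P x) = f x := by
    rintro ⟨y, v⟩
    simp only [hf, hPapp, acceleration, generalizedForce, hGQ, hFQ,
      (fderiv_of_projection_invariant hQQ hGQ y).1, (fderiv_of_projection_invariant hQQ hbQ y).1,
      (fderiv_of_projection_invariant hQQ hWQ y).1]
  have hHd : ∀ x, ‖P x - x₀‖ < r →
      ∃ H' : E × E →L[ℝ] ℝ, HasFDerivAt H H' x ∧ H' (f x) = - F x.1 x.2 x.2 := by
    rintro ⟨y, v⟩ hx
    obtain ⟨h1, h2⟩ := (hnorm _ _).1 hx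
    obtain ⟨⟨a1, a2, a3⟩, b1, b2, b3, c⟩ := hgood y v h1 h2
    exact hasFDerivAt_energy a1 a3 b1 b2
  have hmotion : ∀ (I : Set ℝ) (y v : ℝ → E) (t : ℝ), UniqueDiffWithinAt ℝ I t →
      ‖Q (y t) - y₀‖ < r → ‖v t‖ < r → (LagrangeEquations G b W F I y v t ↔
        HasDerivWithinAt (fun t => (y t, v t)) (f (y t, v t)) I t) := by
    intro I y v t hI h1 h2
    obtain ⟨⟨a1, a2, a3⟩, b1, b2, b3, c⟩ := hgood (y t) (v t) h1 h2
    constructor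
    · rintro ⟨m1, m2⟩
      exact m1.prodMk ((hasDerivWithinAt_momentum_iff hI a1 a2 b2 m1).1 m2)
    · intro h
      have m1 : HasDerivWithinAt y (v t) I t :=
        (ContinuousLinearMap.fst ℝ E E).hasFDerivAt.comp_hasDerivWithinAt t h
      have m2 : HasDerivWithinAt v (acceleration G b W F (y t) (v t)) I t :=
        (ContinuousLinearMap.snd ℝ E E).hasFDerivAt.comp_hasDerivWithinAt t h
      exact ⟨m1, (hasDerivWithinAt_momentum_iff hI a1 a2 b2 m1).2 m2⟩
  have hIci : ∀ t : ℝ, 0 ≤ t → UniqueDiffWithinAt ℝ (Set.Ici 0) t := fun t ht =>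
    uniqueDiffOn_Ici 0 t ht
  have hmain := asymptoticStability_of_lyapunov (P := P) (x₀ := x₀) (H := H) (r := r) (f := f)
    (by rintro ⟨y, v⟩; simp [hP, hQQ]) (by simp [hP, hx₀, hQ₀]) hr0
    (by rintro ⟨y, v⟩; simp [hP, hH, hGQ, hWQ]) hfP
    (contDiffAt_snd.prodMk (contDiffAt_acceleration hG hb hW hF hpos))
    (fun x hx => by
      obtain ⟨H', h1, h2⟩ := hHd x hx
      refine ⟨H', h1, ?_⟩
      obtain ⟨h3, h4⟩ := (hnorm _ _).1 hx
      have := (hgood x.1 x.2 h3 h4).2.2.2.2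
      rw [h2]; linarith)
    (by
      rintro ⟨y, v⟩ hx hne
      obtain ⟨h3, h4⟩ := (hnorm _ _).1 hx
      obtain ⟨-, -, b2, b3, -⟩ := hgood y v h3 h4
      simp only [hH, hx₀, map_zero, mul_zero, zero_add]
      by_cases hv : v = 0
      · subst hv
        have : Q y ≠ y₀ := fun h => hne (by simp [hP, hx₀, h])
        simpa using b3 this
      · have h5 := b2 v hv
        by_cases hy : Q y = y₀
        · rw [← hWQ y, hy]; linarith
        · have := b3 hy
          linarith)
    (by
      intro x hxr hx hHc
      have hxr' := fun t ht => (hnorm (x t) r).1 (hxr t ht)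
      have hres := hinv (fun t => (x t).1) (fun t => (x t).2)
        (fun t ht => ⟨(hxr' t ht).1.trans_le (min_le_right _ _),
          (hxr' t ht).2.trans_le (min_le_right _ _)⟩)
        (fun t ht => (hmotion _ _ _ t (hIci t ht) (hxr' t ht).1 (hxr' t ht).2).2 (hx t ht))
        (fun t ht => by
          obtain ⟨H', h1, h2⟩ := hHd (x t) (hxr t ht)
          have h3 := h1.comp_hasDerivWithinAt t (hx t ht)
          have h4 : HasDerivWithinAt (H ∘ x) 0 (Set.Ici 0) t :=
            (hasDerivWithinAt_const t (Set.Ici 0) (H (x 0))).congr (fun s hs => hHc s hs)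
              (hHc t ht)
          have h5 := (hIci t ht).eq_deriv _ h3 h4
          rw [h2] at h5
          linarith)
      exact Prod.ext hres.1 hres.2)
  obtain ⟨c1, ⟨δ₂, hδ₂, c2⟩, ⟨δ₃, hδ₃, c3⟩⟩ := hmain
  refine ⟨r, hr0, min_le_right _ _, fun η hη => ?_, ⟨δ₂, hδ₂, fun a c ha hc => ?_⟩,
    ⟨δ₃, hδ₃, fun y v hy hv hmot h0 h0' => ?_⟩⟩
  · obtain ⟨δ, hδ, h⟩ := c1 η hη
    refine ⟨δ, hδ, fun T y v hy hv hmot h0 h0' t ht => ?_⟩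
    refine (hnorm (y t, v t) η).1 (h T (fun t => (y t, v t)) (hy.prodMk hv) (fun t ht hN => ?_)
      ((hnorm (y 0, v 0) δ).2 ⟨h0, h0'⟩) t ht)
    obtain ⟨h3, h4⟩ := (hnorm _ _).1 hN
    exact (hmotion _ y v t (uniqueDiffOn_Ico 0 T t ht) h3 h4).1 (hmot t ht h3 h4)
  · obtain ⟨x, hx0, hx⟩ := c2 (a, c) ((hnorm (a, c) δ₂).2 ⟨ha, hc⟩)
    refine ⟨fun t => (x t).1, fun t => (x t).2, congrArg Prod.fst hx0, congrArg Prod.snd hx0, fun t ht => ?_⟩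
    obtain ⟨h3, h4⟩ := (hnorm _ _).1 (hx t ht).1
    exact ⟨h3, (hmotion _ _ _ t (hIci t ht) h3 h4).2 (hx t ht).2⟩
  · have := c3 (fun t => (y t, v t)) (hy.prodMk hv) (fun t ht hN => by
      obtain ⟨h3, h4⟩ := (hnorm _ _).1 hN
      exact (hmotion _ y v t (hIci t ht) h3 h4).1 (hmot t ht h3 h4))
      ((hnorm (y 0, v 0) δ₃).2 ⟨h0, h0'⟩)
    constructor
    · refine squeeze_zero (fun _ => norm_nonneg _) (fun t => ?_) this
      simp [hP, hx₀, Prod.norm_def]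
    · refine squeeze_zero (fun _ => norm_nonneg _) (fun t => ?_) this
      simp [hP, hx₀, Prod.norm_def]

end Mechanical

/-- A continuous one-parameter group of linear maps of a finite dimensional space is generated by a
linear map. -/
theorem exists_generator {V : Type*} [NormedAddCommGroup V] [NormedSpace ℝ V]
    [FiniteDimensional ℝ V] {T : ℝ → V →L[ℝ] V} (hadd : ∀ a b, T (a + b) = (T a).comp (T b))
    (h0 : T 0 = ContinuousLinearMap.id ℝ V) (hc : ∀ u, Continuous fun t => T t u) :
    ∃ A : V →L[ℝ] V, ∀ t, HasDerivAt T ((T t).comp A) t := by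
  have : CompleteSpace V := FiniteDimensional.complete ℝ V
  have hT : Continuous T := continuous_clm_apply.2 hc
  -- The integral J is differentiable, and J h / h tends to the identity, so J h is invertible for
  -- some h. Then T t = (J (t + h) - J t) (J h)⁻¹ inherits the differentiability.
  set J : ℝ → V →L[ℝ] V := fun h => ∫ s in (0 : ℝ)..h, T s with hJ
  have hJd : ∀ t, HasDerivAt J (T t) t := fun t =>
    intervalIntegral.integral_hasDerivAt_right (hT.intervalIntegrable _ _)
      (hT.stronglyMeasurableAtFilter _ _) hT.continuousAt
  obtain ⟨h, hu⟩ : ∃ h : ℝ, IsUnit (J h) := by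
    have h1 : Filter.Tendsto (fun t : ℝ => t⁻¹ • J t) (𝓝[≠] 0) (𝓝 1) := by
      have := (hJd 0).tendsto_slope
      rw [h0] at this
      refine this.congr fun t => ?_
      simp [slope, hJ]
    have h2 : ∀ᶠ t : ℝ in 𝓝[≠] 0, IsUnit (t⁻¹ • J t) :=
      h1.eventually (Units.isOpen.mem_nhds (isUnit_one : IsUnit (1 : V →L[ℝ] V)))
    obtain ⟨t, ht, ht0⟩ := (h2.and self_mem_nhdsWithin).exists
    refine ⟨t, ?_⟩
    have ht0' : t ≠ 0 := ht0
    have := ht.smul (Units.mk0 t ht0')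
    simpa [Units.smul_def, smul_smul, ht0'] using this
  obtain ⟨j, hj⟩ := hu
  have hTJ : ∀ t, (T t).comp (J h) = J (t + h) - J t := by
    intro t
    have h1 : (T t).comp (J h) = ∫ s in (0 : ℝ)..h, T (t + s) := by
      have := ((ContinuousLinearMap.compL ℝ V V V) (T t)).intervalIntegral_comp_comm
        (hT.intervalIntegrable 0 h) (μ := MeasureTheory.volume)
      simp only [ContinuousLinearMap.compL_apply] at this
      rw [hJ]
      simp only
      rw [← this]
      simp only [hadd]
    rw [h1, intervalIntegral.integral_comp_add_left (f := T), add_zero, hJ]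
    simp only
    rw [intervalIntegral.integral_interval_sub_left (hT.intervalIntegrable _ _)
      (hT.intervalIntegrable _ _)]
  have hinv : (J h).comp (↑j⁻¹ : V →L[ℝ] V) = ContinuousLinearMap.id ℝ V := by
    rw [← hj]; exact j.mul_inv
  have hTeq : ∀ t, T t = (J (t + h) - J t).comp (↑j⁻¹ : V →L[ℝ] V) := by
    intro t
    rw [← hTJ, ContinuousLinearMap.comp_assoc, hinv, ContinuousLinearMap.comp_id]
  refine ⟨(T h - T 0).comp (↑j⁻¹ : V →L[ℝ] V), fun t => ?_⟩
  have h1 : HasDerivAt (fun t => J (t + h) - J t) (T (t + h) - T t) t :=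
    ((hJd (t + h)).comp_add_const t h).sub (hJd t)
  have h2 : HasDerivAt (fun t => (J (t + h) - J t).comp (↑j⁻¹ : V →L[ℝ] V))
      ((T (t + h) - T t).comp (↑j⁻¹ : V →L[ℝ] V)) t :=
    ((ContinuousLinearMap.compL ℝ V V V).flip (↑j⁻¹ : V →L[ℝ] V)).hasFDerivAt.comp_hasDerivAt t h1
  have h3 := h2.congr_of_eventuallyEq (Filter.Eventually.of_forall hTeq)
  have h4 : (T t).comp ((T h - T 0).comp (↑j⁻¹ : V →L[ℝ] V)) =
      (T (t + h) - T t).comp (↑j⁻¹ : V →L[ℝ] V) := by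
    rw [← ContinuousLinearMap.comp_assoc, ContinuousLinearMap.comp_sub, ← hadd, ← hadd, add_zero]
  rw [h4]
  exact h3

/-! ### Rotations of the ball and invariance of its measure -/

namespace SpinOrbit

theorem rot_apply (Γ : SO3) (x : E3) (i : Fin 3) :
    rot Γ x i = ∑ k, (Γ : Matrix (Fin 3) (Fin 3) ℝ) i k * x k := by
  simp [rot, Matrix.ofLp_toEuclideanCLM, Matrix.mulVec, dotProduct]

theorem rot_mul (Γ Γ' : SO3) (x : E3) : rot (Γ * Γ') x = rot Γ (rot Γ' x) := by
  simp [rot]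

theorem rot_one (x : E3) : rot 1 x = x := by
  simp [rot]

theorem rotBall_mul (r : ℝ) (Γ Γ' : SO3) (x : Ball r) :
    rotBall r (Γ * Γ') x = rotBall r Γ (rotBall r Γ' x) :=
  Subtype.ext (rot_mul Γ Γ' x)

theorem rotBall_one (r : ℝ) (x : Ball r) : rotBall r 1 x = x :=
  Subtype.ext (rot_one x)

theorem planarRot_add (a b : ℝ) : planarRot (a + b) = planarRot a * planarRot b := by
  apply Subtype.ext
  ext i j
  fin_cases i <;> fin_cases j <;>
    simp [planarRot, Real.cos_add, Real.sin_add] <;> ring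

theorem planarRot_zero : planarRot 0 = 1 := by
  apply Subtype.ext
  ext i j
  fin_cases i <;> fin_cases j <;> simp [planarRot]

theorem planarRot_neg (a : ℝ) : planarRot (-a) = (planarRot a)⁻¹ := by
  rw [eq_inv_iff_mul_eq_one, ← planarRot_add, neg_add_cancel, planarRot_zero]

/-- A rotation is a linear isometry of the whole space and maps the ball onto itself. -/
theorem measurePreserving_rotBall (r : ℝ) (Γ : SO3) :
    MeasureTheory.MeasurePreserving (rotBall r Γ) (ballVolume r) (ballVolume r) := by
  refine ⟨(rotBall r Γ).continuous.measurable, ?_⟩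
  have hm : MeasurableSet (Metric.closedBall (0 : E3) r) := measurableSet_closedBall
  have hrm : Measurable (rot Γ) := (rot Γ).continuous.measurable
  have hvol : MeasureTheory.MeasurePreserving (rot Γ) (MeasureTheory.volume : MeasureTheory.Measure E3)
      MeasureTheory.volume := by
    let e : E3 ≃ₗᵢ[ℝ] E3 :=
      { toFun := rot Γ
        invFun := rot Γ⁻¹
        left_inv := fun x => by rw [← rot_mul, inv_mul_cancel, rot_one]
        right_inv := fun x => by rw [← rot_mul, mul_inv_cancel, rot_one]
        map_add' := fun x y => map_add _ _ _
        map_smul' := fun c x => map_smul _ _ _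
        norm_map' := fun x => norm_rot Γ x }
    exact e.measurePreserving
  ext S hS
  rw [MeasureTheory.Measure.map_apply (rotBall r Γ).continuous.measurable hS]
  unfold ballVolume
  have hemb := MeasurableEmbedding.subtype_coe hm
  rw [hemb.comap_apply, hemb.comap_apply]
  have hset : Subtype.val '' (rotBall r Γ ⁻¹' S) = rot Γ ⁻¹' (Subtype.val '' S) := by
    ext x
    constructor
    · rintro ⟨y, hy, rfl⟩
      exact ⟨rotBall r Γ y, hy, rfl⟩
    · rintro ⟨y, hy, hyx⟩
      have hx : x ∈ Metric.closedBall (0 : E3) r := by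
        rw [mem_closedBall_zero_iff, ← norm_rot Γ x, ← hyx, ← mem_closedBall_zero_iff]
        exact y.2
      refine ⟨⟨x, hx⟩, ?_, rfl⟩
      have : rotBall r Γ ⟨x, hx⟩ = y := Subtype.ext hyx.symm
      rw [Set.mem_preimage, this]
      exact hy
  rw [hset, hvol.measure_preimage (hemb.measurableSet_image.2 hS).nullMeasurableSet]

/-- Since r > 0, the closed ball is the closure of the open one, so a nonempty relatively open
subset contains a nonempty open set of the space. -/
theorem isOpenPosMeasure_ballVolume {r : ℝ} (hr : 0 < r) :
    (ballVolume r).IsOpenPosMeasure := by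
  refine ⟨fun S hS hne h0 => ?_⟩
  obtain ⟨U, hU, rfl⟩ := isOpen_induced_iff.1 hS
  have hm : MeasurableSet (Metric.closedBall (0 : E3) r) := measurableSet_closedBall
  unfold ballVolume at h0
  rw [(MeasurableEmbedding.subtype_coe hm).comap_apply] at h0
  obtain ⟨x, hx⟩ := hne
  have hx2 : (x : E3) ∈ closure (Metric.ball (0 : E3) r) := by
    rw [closure_ball _ hr.ne']; exact x.2
  obtain ⟨y, hy⟩ := mem_closure_iff.1 hx2 U hU hx
  have hsub : U ∩ Metric.ball (0 : E3) r ⊆ Subtype.val '' (Subtype.val ⁻¹' U : Set (Ball r)) :=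
    fun z hz => ⟨⟨z, Metric.ball_subset_closedBall hz.2⟩, hz.1, rfl⟩
  have h1 := (hU.inter Metric.isOpen_ball).measure_pos MeasureTheory.volume ⟨y, hy⟩
  exact absurd (MeasureTheory.measure_mono_null hsub h0) h1.ne'

namespace ElasticBody

variable (B : ElasticBody)

theorem integrable_mul_density (φ : C(Ball B.radius, ℝ)) :
    MeasureTheory.Integrable (fun x => φ x * B.density x) (ballVolume B.radius) := by
  refine B.density_integrable.bdd_mul (c := ‖φ‖) φ.continuous.aestronglyMeasurable ?_
  exact Filter.Eventually.of_forall fun x => φ.norm_coe_le_norm x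

/-- The density is positive and the measure charges open sets, so continuity turns vanishing almost
everywhere into vanishing everywhere. -/
theorem eq_zero_of_integral_eq_zero (φ : C(Ball B.radius, ℝ)) (hφ : ∀ x, 0 ≤ φ x)
    (h : ∫ x, φ x * B.density x ∂(ballVolume B.radius) = 0) (x) : φ x = 0 := by
  have := isOpenPosMeasure_ballVolume B.radius_pos
  rw [MeasureTheory.integral_eq_zero_iff_of_nonneg
    (fun x => mul_nonneg (hφ x) (B.density_pos x).le) (B.integrable_mul_density φ)] at h
  have h1 : (φ : Ball B.radius → ℝ) =ᵐ[ballVolume B.radius] fun _ => 0 := by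
    filter_upwards [h] with y hy
    simpa [(B.density_pos y).ne'] using hy
  exact congrFun ((φ.continuous.ae_eq_iff_eq _ continuous_const).1 h1) x

theorem integral_comp_rotBall (Γ : SO3) (φ : C(Ball B.radius, ℝ)) :
    ∫ x, φ (rotBall B.radius Γ x) * B.density x ∂(ballVolume B.radius) =
      ∫ x, φ x * B.density x ∂(ballVolume B.radius) := by
  have hemb : MeasurableEmbedding (rotBall B.radius Γ) := by
    refine (Topology.IsClosedEmbedding.measurableEmbedding ?_)
    refine (rotBall B.radius Γ).continuous.isClosedEmbedding fun x y hxy => ?_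
    have := congrArg (rotBall B.radius Γ⁻¹) hxy
    rwa [← rotBall_mul, ← rotBall_mul, inv_mul_cancel, rotBall_one, rotBall_one] at this
  rw [← (measurePreserving_rotBall B.radius Γ).integral_comp hemb
    (fun x => φ x * B.density x)]
  simp only [B.density_rot]

end ElasticBody

end SpinOrbit

/-! ### Linear actions of the rotations on the space of configurations -/

noncomputable section

set_option maxSynthPendingDepth 3

namespace SpinOrbit

theorem inner_rot (Γ : SO3) (x y : E3) : inner ℝ (rot Γ x) (rot Γ y) = inner ℝ x y := by
  let e : E3 →ₗᵢ[ℝ] E3 := ⟨(rot Γ).toLinearMap, norm_rot Γ⟩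
  exact e.inner_map_map x y

theorem continuous_planarRot_apply : Continuous fun p : ℝ × E3 => rot (planarRot p.1) p.2 := by
  have h : Continuous fun p : ℝ × E3 => (WithLp.toLp 2 fun i =>
      ∑ k, (planarRot p.1 : Matrix (Fin 3) (Fin 3) ℝ) i k * p.2 k : E3) := by
    refine (PiLp.continuous_toLp 2 _).comp (continuous_pi fun i => ?_)
    fin_cases i <;> simp [planarRot, Fin.sum_univ_three] <;> fun_prop
  refine h.congr fun p => ?_
  ext i
  simp [rot_apply]

namespace ElasticBody

variable (B : ElasticBody)

instance : FiniteDimensional ℝ B.conf := B.conf_finite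

/-- Rotations in space acting on configurations, `v ↦ Γ v`. -/
def rotConf (Γ : SO3) : B.conf →L[ℝ] B.conf :=
  LinearMap.toContinuousLinearMap
    ({
      toFun := fun v => ⟨act₁ Γ v, B.conf_act₁ Γ v v.2⟩
      map_add' := fun u v => by
        apply Subtype.ext
        ext x : 1
        exact map_add (rot Γ) _ _
      map_smul' := fun c v => by
        apply Subtype.ext
        ext x : 1
        exact map_smul (rot Γ) _ _ } : B.conf →ₗ[ℝ] B.conf)

/-- The two given actions generate this one: v ∘ Γ⁻¹ is Γ⁻¹ applied to Γ v ∘ Γ⁻¹. -/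
theorem comp_rotBall_mem (Γ : SO3) (v : B.conf) :
    (v : C(Ball B.radius, E3)).comp (rotBall B.radius Γ⁻¹) ∈ B.conf := by
  have h := B.conf_act₁ Γ⁻¹ _ (B.conf_act₂ Γ v v.2)
  convert h using 1
  ext x : 1
  change _ = rot Γ⁻¹ (rot Γ _)
  rw [← rot_mul, inv_mul_cancel, rot_one]

/-- Rotations of the body acting on configurations, `v ↦ v ∘ Γ⁻¹`. -/
def bodyRotConf (Γ : SO3) : B.conf →L[ℝ] B.conf :=
  LinearMap.toContinuousLinearMap
    ({
      toFun := fun v => ⟨(v : C(Ball B.radius, E3)).comp (rotBall B.radius Γ⁻¹),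
        B.comp_rotBall_mem Γ v⟩
      map_add' := fun _ _ => rfl
      map_smul' := fun _ _ => rfl } : B.conf →ₗ[ℝ] B.conf)

theorem rotConf_apply (Γ : SO3) (v : B.conf) (x : Ball B.radius) :
    (B.rotConf Γ v : C(Ball B.radius, E3)) x = rot Γ ((v : C(Ball B.radius, E3)) x) := rfl

theorem bodyRotConf_apply (Γ : SO3) (v : B.conf) (x : Ball B.radius) :
    (B.bodyRotConf Γ v : C(Ball B.radius, E3)) x =
      (v : C(Ball B.radius, E3)) (rotBall B.radius Γ⁻¹ x) := rfl

attribute [irreducible] rotConf bodyRotConf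

theorem conf_ext {u v : B.conf}
    (h : ∀ x i, (u : C(Ball B.radius, E3)) x i = (v : C(Ball B.radius, E3)) x i) : u = v := by
  apply Subtype.ext
  ext x i
  exact h x i

theorem hasDerivAt_eval {f : ℝ → B.conf} {f' : B.conf} {t : ℝ} (h : HasDerivAt f f' t)
    (x : Ball B.radius) (i : Fin 3) :
    HasDerivAt (fun t => (f t : C(Ball B.radius, E3)) x i) ((f' : C(Ball B.radius, E3)) x i) t := by
  let l : B.conf →L[ℝ] ℝ := LinearMap.toContinuousLinearMap
    ({
      toFun := fun v => (v : C(Ball B.radius, E3)) x i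
      map_add' := fun _ _ => rfl
      map_smul' := fun _ _ => rfl } : B.conf →ₗ[ℝ] ℝ)
  exact l.hasFDerivAt.comp_hasDerivAt t h

theorem continuous_rotConf (u : B.conf) : Continuous fun t => B.rotConf (planarRot t) u := by
  have h : Continuous fun t => (B.rotConf (planarRot t) u : C(Ball B.radius, E3)) := by
    refine ContinuousMap.continuous_of_continuous_uncurry _ ?_
    refine (continuous_planarRot_apply.comp (continuous_fst.prodMk
      ((u : C(Ball B.radius, E3)).continuous.comp continuous_snd))).congr fun p => ?_
    exact (B.rotConf_apply _ u p.2).symm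
  exact continuous_induced_rng.2 h

theorem continuous_bodyRotConf (u : B.conf) :
    Continuous fun t => B.bodyRotConf (planarRot t) u := by
  have h : Continuous fun t => (B.bodyRotConf (planarRot t) u : C(Ball B.radius, E3)) := by
    refine ContinuousMap.continuous_of_continuous_uncurry _ ?_
    have h1 : Continuous fun p : ℝ × Ball B.radius => rotBall B.radius (planarRot p.1)⁻¹ p.2 := by
      refine continuous_induced_rng.2 ((continuous_planarRot_apply.comp
        (continuous_fst.neg.prodMk (continuous_subtype_val.comp continuous_snd))).congr fun p => ?_)
      change rot (planarRot (-p.1)) p.2 = _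
      rw [planarRot_neg]
      rfl
    refine ((u : C(Ball B.radius, E3)).continuous.comp h1).congr fun p => ?_
    exact (B.bodyRotConf_apply _ u p.2).symm
  exact continuous_induced_rng.2 h

theorem rotConf_mul (Γ Γ' : SO3) : B.rotConf (Γ * Γ') = (B.rotConf Γ).comp (B.rotConf Γ') := by
  refine ContinuousLinearMap.ext fun u => B.conf_ext fun x i => ?_
  simp only [rotConf_apply, ContinuousLinearMap.comp_apply, rot_mul]

theorem bodyRotConf_mul (Γ Γ' : SO3) :
    B.bodyRotConf (Γ * Γ') = (B.bodyRotConf Γ).comp (B.bodyRotConf Γ') := by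
  refine ContinuousLinearMap.ext fun u => B.conf_ext fun x i => ?_
  simp only [bodyRotConf_apply, ContinuousLinearMap.comp_apply, mul_inv_rev, rotBall_mul]

theorem rotConf_one : B.rotConf 1 = ContinuousLinearMap.id ℝ B.conf := by
  refine ContinuousLinearMap.ext fun u => B.conf_ext fun x i => ?_
  rw [rotConf_apply, rot_one, ContinuousLinearMap.id_apply]

theorem bodyRotConf_one : B.bodyRotConf 1 = ContinuousLinearMap.id ℝ B.conf := by
  refine ContinuousLinearMap.ext fun u => B.conf_ext fun x i => ?_
  rw [bodyRotConf_apply, inv_one, rotBall_one, ContinuousLinearMap.id_apply]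

theorem exists_spin : ∃ A : B.conf →L[ℝ] B.conf, ∀ t,
    HasDerivAt (fun t => B.rotConf (planarRot t)) ((B.rotConf (planarRot t)).comp A) t :=
  exists_generator (T := fun t => B.rotConf (planarRot t))
    (fun a b => by rw [planarRot_add, rotConf_mul]) (by rw [planarRot_zero, rotConf_one])
    B.continuous_rotConf

/-- Finite dimension turns continuity in the angle into differentiability, without differentiating
the deformation v itself. -/
theorem exists_turn : ∃ A : B.conf →L[ℝ] B.conf, ∀ t,
    HasDerivAt (fun t => B.bodyRotConf (planarRot t)) ((B.bodyRotConf (planarRot t)).comp A) t :=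
  exists_generator (T := fun t => B.bodyRotConf (planarRot t))
    (fun a b => by rw [planarRot_add, bodyRotConf_mul]) (by rw [planarRot_zero, bodyRotConf_one])
    B.continuous_bodyRotConf

/-- The generator of the rotations in space about the third axis, `v ↦ e₃ ∧ v`. -/
def spin : B.conf →L[ℝ] B.conf := B.exists_spin.choose

/-- The generator of the rotations of the body about the third axis. -/
def turn : B.conf →L[ℝ] B.conf := B.exists_turn.choose

theorem hasDerivAt_spin (t : ℝ) : HasDerivAt (fun t => B.rotConf (planarRot t))
    ((B.rotConf (planarRot t)).comp B.spin) t := B.exists_spin.choose_spec t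

theorem hasDerivAt_turn (t : ℝ) : HasDerivAt (fun t => B.bodyRotConf (planarRot t))
    ((B.bodyRotConf (planarRot t)).comp B.turn) t := B.exists_turn.choose_spec t

theorem hasDerivAt_spin_zero (v : B.conf) :
    HasDerivAt (fun t => B.rotConf (planarRot t) v) (B.spin v) 0 := by
  have h := (B.hasDerivAt_spin 0).clm_apply (hasDerivAt_const (0 : ℝ) v)
  rw [planarRot_zero, rotConf_one, map_zero, add_zero] at h
  exact h

theorem hasDerivAt_turn_zero (v : B.conf) :
    HasDerivAt (fun t => B.bodyRotConf (planarRot t) v) (B.turn v) 0 := by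
  have h := (B.hasDerivAt_turn 0).clm_apply (hasDerivAt_const (0 : ℝ) v)
  rw [planarRot_zero, bodyRotConf_one, map_zero, add_zero] at h
  exact h

theorem spin_apply (v : B.conf) (x : Ball B.radius) :
    (B.spin v : C(Ball B.radius, E3)) x 0 = -(v : C(Ball B.radius, E3)) x 1 ∧
    (B.spin v : C(Ball B.radius, E3)) x 1 = (v : C(Ball B.radius, E3)) x 0 ∧
    (B.spin v : C(Ball B.radius, E3)) x 2 = 0 := by
  have h := B.hasDerivAt_eval (B.hasDerivAt_spin_zero v) x
  have hs := Real.hasDerivAt_sin 0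
  have hc := Real.hasDerivAt_cos 0
  simp only [Real.sin_zero, Real.cos_zero, neg_zero] at hs hc
  set a := (v : C(Ball B.radius, E3)) x with ha
  refine ⟨(h 0).unique ?_, (h 1).unique ?_, (h 2).unique ?_⟩
  · have := (hc.mul_const (a 0)).add (hs.neg.mul_const (a 1))
    convert this using 1
    · funext t
      simp [rotConf_apply, rot_apply, planarRot, Fin.sum_univ_three, ha]
    · ring
  · have := (hs.mul_const (a 0)).add (hc.mul_const (a 1))
    convert this using 1
    · funext t
      simp [rotConf_apply, rot_apply, planarRot, Fin.sum_univ_three, ha]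
    · ring
  · have := hasDerivAt_const (0 : ℝ) (a 2)
    convert this using 1
    funext t
    simp [rotConf_apply, rot_apply, planarRot, Fin.sum_univ_three, ha]

theorem spin_bodyRotConf (Γ : SO3) (v : B.conf) :
    B.spin (B.bodyRotConf Γ v) = B.bodyRotConf Γ (B.spin v) := by
  refine B.conf_ext fun x i => ?_
  have h1 := B.spin_apply (B.bodyRotConf Γ v) x
  have h2 := B.spin_apply v (rotBall B.radius Γ⁻¹ x)
  rw [bodyRotConf_apply] at h1 ⊢
  fin_cases i
  · exact h1.1.trans h2.1.symm
  · exact h1.2.1.trans h2.2.1.symm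
  · exact h1.2.2.trans h2.2.2.symm

/-- For the identical deformation, turning the body is rotating it backwards in space: v₀ ∘ Γ⁻¹ =
Γ⁻¹ v₀. Hence the velocity in β vanishes at v₀ and the kinetic energy degenerates there. -/
theorem turn_v₀ : B.turn B.v₀ = -B.spin B.v₀ := by
  refine (B.hasDerivAt_turn_zero B.v₀).unique ?_
  have h : HasDerivAt (fun t => B.rotConf (planarRot t) B.v₀) (B.spin B.v₀) (-0) := by
    simpa using B.hasDerivAt_spin_zero B.v₀
  have h2 := h.scomp (0 : ℝ) (hasDerivAt_neg (0 : ℝ))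
  rw [neg_one_smul] at h2
  refine h2.congr_of_eventuallyEq (Filter.Eventually.of_forall fun t => ?_)
  refine B.conf_ext fun x i => ?_
  simp only [Function.comp, planarRot_neg, rotConf_apply, bodyRotConf_apply]
  rfl

/-! ### Second moments -/

/-- The continuous function `u_i v_j` on the ball. -/
def coordMul (i j : Fin 3) (u v : B.conf) : C(Ball B.radius, ℝ) where
  toFun x := (u : C(Ball B.radius, E3)) x i * (v : C(Ball B.radius, E3)) x j
  continuous_toFun := by fun_prop

/-- The second moments `∫ u_i v_j ρ`, as bilinear forms. -/
def moment (i j : Fin 3) : B.conf →L[ℝ] B.conf →L[ℝ] ℝ :=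
  (LinearMap.mk₂ ℝ (fun u v => ∫ x, B.coordMul i j u v x * B.density x ∂(ballVolume B.radius))
    (fun u u' v => by
      rw [← MeasureTheory.integral_add (B.integrable_mul_density _) (B.integrable_mul_density _)]
      congr 1; funext x
      simp only [coordMul, ContinuousMap.coe_mk, Submodule.coe_add, ContinuousMap.add_apply,
        PiLp.add_apply]
      ring)
    (fun c u v => by
      rw [smul_eq_mul, ← MeasureTheory.integral_const_mul]
      congr 1; funext x
      simp only [coordMul, ContinuousMap.coe_mk, Submodule.coe_smul, ContinuousMap.smul_apply,
        PiLp.smul_apply, smul_eq_mul]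
      ring)
    (fun u v v' => by
      rw [← MeasureTheory.integral_add (B.integrable_mul_density _) (B.integrable_mul_density _)]
      congr 1; funext x
      simp only [coordMul, ContinuousMap.coe_mk, Submodule.coe_add, ContinuousMap.add_apply,
        PiLp.add_apply]
      ring)
    (fun c u v => by
      rw [smul_eq_mul, ← MeasureTheory.integral_const_mul]
      congr 1; funext x
      simp only [coordMul, ContinuousMap.coe_mk, Submodule.coe_smul, ContinuousMap.smul_apply,
        PiLp.smul_apply, smul_eq_mul]
      ring)).toContinuousBilinearMap

theorem moment_apply (i j : Fin 3) (u v : B.conf) : B.moment i j u v =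
    ∫ x, B.coordMul i j u v x * B.density x ∂(ballVolume B.radius) := rfl

attribute [irreducible] moment

theorem moment_swap (i j : Fin 3) (u v : B.conf) : B.moment i j u v = B.moment j i v u := by
  simp only [moment_apply, coordMul, ContinuousMap.coe_mk]
  congr 1; funext x; ring

theorem moment_bodyRotConf (Γ : SO3) (i j : Fin 3) (u v : B.conf) :
    B.moment i j (B.bodyRotConf Γ u) (B.bodyRotConf Γ v) = B.moment i j u v := by
  rw [moment_apply, moment_apply, ← B.integral_comp_rotBall Γ⁻¹ (B.coordMul i j u v)]
  simp only [coordMul, ContinuousMap.coe_mk, bodyRotConf_apply]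

theorem moment_rotConf (Γ : SO3) (i j : Fin 3) (u v : B.conf) :
    B.moment i j (B.rotConf Γ u) (B.rotConf Γ v) =
      ∑ k, ∑ l, (Γ : Matrix (Fin 3) (Fin 3) ℝ) i k * (Γ : Matrix (Fin 3) (Fin 3) ℝ) j l *
        B.moment k l u v := by
  simp only [moment_apply, ← MeasureTheory.integral_const_mul]
  have hint : ∀ k l, MeasureTheory.Integrable (fun x =>
      (Γ : Matrix (Fin 3) (Fin 3) ℝ) i k * (Γ : Matrix (Fin 3) (Fin 3) ℝ) j l *
        (B.coordMul k l u v x * B.density x)) (ballVolume B.radius) := fun k l =>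
    (B.integrable_mul_density _).const_mul _
  simp_rw [← MeasureTheory.integral_finsetSum Finset.univ (fun l _ => hint _ l)]
  rw [← MeasureTheory.integral_finsetSum Finset.univ
    (fun k _ => MeasureTheory.integrable_finsetSum _ fun l _ => hint k l)]
  congr 1; funext x
  simp only [coordMul, ContinuousMap.coe_mk, rotConf_apply, rot_apply]
  rw [Finset.sum_mul_sum, Finset.sum_mul]
  refine Finset.sum_congr rfl fun k _ => ?_
  rw [Finset.sum_mul]
  exact Finset.sum_congr rfl fun l _ => by ring

/-- The scalar product `∫ ⟨u, v⟩ ρ`. -/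
def massForm : B.conf →L[ℝ] B.conf →L[ℝ] ℝ := ∑ i, B.moment i i

theorem massForm_eq_sum (u v : B.conf) : B.massForm u v = ∑ i, B.moment i i u v := by
  simp [massForm]

theorem massForm_apply (u v : B.conf) : B.massForm u v =
    ∫ x, inner ℝ ((u : C(Ball B.radius, E3)) x) ((v : C(Ball B.radius, E3)) x) * B.density x
      ∂(ballVolume B.radius) := by
  rw [massForm_eq_sum]
  simp only [moment_apply]
  rw [← MeasureTheory.integral_finsetSum Finset.univ (fun i _ => B.integrable_mul_density _)]
  congr 1; funext x
  rw [← Finset.sum_mul, PiLp.inner_apply]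
  congr 1
  exact Finset.sum_congr rfl fun i _ => by simp [coordMul]; ring

theorem massForm_symm (u v : B.conf) : B.massForm u v = B.massForm v u := by
  simp only [massForm_apply, real_inner_comm]

theorem massForm_pos (u : B.conf) (hu : u ≠ 0) : 0 < B.massForm u u := by
  have hnn : ∀ i, 0 ≤ B.moment i i u u := fun i => by
    rw [moment_apply]
    exact MeasureTheory.integral_nonneg fun x =>
      mul_nonneg (mul_self_nonneg _) (B.density_pos x).le
  rw [massForm_eq_sum]
  refine lt_of_le_of_ne (Finset.sum_nonneg fun i _ => hnn i) fun h => hu ?_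
  refine B.conf_ext fun x i => ?_
  have h1 := (Finset.sum_eq_zero_iff_of_nonneg fun i _ => hnn i).1 h.symm i (Finset.mem_univ i)
  rw [moment_apply] at h1
  have h2 := B.eq_zero_of_integral_eq_zero (B.coordMul i i u u) (fun x => mul_self_nonneg _) h1 x
  exact mul_self_eq_zero.1 h2

theorem massForm_rotConf (Γ : SO3) (u v : B.conf) :
    B.massForm (B.rotConf Γ u) (B.rotConf Γ v) = B.massForm u v := by
  simp only [massForm_apply, rotConf_apply, inner_rot]

theorem massForm_bodyRotConf (Γ : SO3) (u v : B.conf) :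
    B.massForm (B.bodyRotConf Γ u) (B.bodyRotConf Γ v) = B.massForm u v := by
  simp only [massForm_eq_sum, moment_bodyRotConf]

/-- This integrates v ∧ (e_j ∧ v) = |v|² e_j - v_j v. In particular the matrix of inertia is
diagonal exactly when the mixed second moments vanish. -/
theorem inertia_eq_moment (v : B.conf) (i j : Fin 3) : B.inertia v i j =
    (if i = j then ∑ k, B.moment k k v v else 0) - B.moment i j v v := by
  have key : ∀ x : Ball B.radius, (((v : C(Ball B.radius, E3)) x).ofLp ⨯₃
      ((Pi.single j 1 : Fin 3 → ℝ) ⨯₃ ((v : C(Ball B.radius, E3)) x).ofLp)) i =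
      (if i = j then ∑ k, B.coordMul k k v v x else 0) - B.coordMul i j v v x := by
    intro x
    simp only [coordMul, ContinuousMap.coe_mk, Fin.sum_univ_three]
    fin_cases i <;> fin_cases j <;> simp [cross_apply] <;> ring
  simp only [inertia, Matrix.of_apply, key, moment_apply]
  split_ifs with h
  · rw [← MeasureTheory.integral_finsetSum Finset.univ (fun i _ => B.integrable_mul_density _),
      ← MeasureTheory.integral_sub
        (MeasureTheory.integrable_finsetSum _ fun i _ => B.integrable_mul_density _)
        (B.integrable_mul_density _)]
    congr 1; funext x
    rw [sub_mul, Finset.sum_mul]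
  · rw [zero_sub, ← MeasureTheory.integral_neg]
    congr 1; funext x
    ring

end ElasticBody

end SpinOrbit

end

/-! ### Kinetic energy on the section and its nondegeneracy -/

noncomputable section

set_option maxSynthPendingDepth 3

namespace SpinOrbit

variable {B : ElasticBody} {n : ℕ} (S : AdaptedSection B n)

/-- The velocity of the body with shape `s`, as seen in a frame that moves with it, as a function of
the velocities of the coordinates `(α, β, J, z)`. -/
def bodyVelocity (s : Shape n) : BodyCoord n →L[ℝ] B.conf :=
  (ContinuousLinearMap.fst ℝ ℝ (ℝ × Shape n)).smulRight (B.spin (S.w s)) +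
  ((ContinuousLinearMap.fst ℝ ℝ (Shape n)).smulRight (B.spin (S.w s) + B.turn (S.w s)) +
    (fderiv ℝ S.w s).comp (ContinuousLinearMap.snd ℝ ℝ (Shape n))).comp
    (ContinuousLinearMap.snd ℝ ℝ (ℝ × Shape n))

theorem bodyVelocity_apply (s : Shape n) (u : BodyCoord n) : bodyVelocity S s u =
    u.1 • B.spin (S.w s) + (u.2.1 • (B.spin (S.w s) + B.turn (S.w s)) +
      fderiv ℝ S.w s u.2.2) := rfl

theorem AdaptedSection.contDiffAt {s : Shape n} (hs : s ∈ S.U) : ContDiffAt ℝ ∞ S.w s :=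
  S.smooth.contDiffAt (S.isOpen_U.mem_nhds hs)

theorem AdaptedSection.hasFDerivAt {s : Shape n} (hs : s ∈ S.U) :
    HasFDerivAt S.w (fderiv ℝ S.w s) s :=
  ((S.contDiffAt hs).differentiableAt (by simp)).hasFDerivAt

theorem contDiffAt_bodyVelocity {s : Shape n} (hs : s ∈ S.U) :
    ContDiffAt ℝ ∞ (bodyVelocity S) s := by
  have hw := S.contDiffAt hs
  have hw' : ContDiffAt ℝ ∞ (fderiv ℝ S.w) s := hw.fderiv_right (by simp)
  have h1 : ContDiffAt ℝ ∞ (fun s => B.spin (S.w s)) s := B.spin.contDiff.contDiffAt.comp s hw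
  have h2 : ContDiffAt ℝ ∞ (fun s => B.turn (S.w s)) s := B.turn.contDiff.contDiffAt.comp s hw
  have h3 := (ContinuousLinearMap.smulRightL ℝ (BodyCoord n) B.conf
    (ContinuousLinearMap.fst ℝ ℝ (ℝ × Shape n))).contDiff.contDiffAt.comp s h1
  have h4 := (ContinuousLinearMap.smulRightL ℝ (ℝ × Shape n) B.conf
    (ContinuousLinearMap.fst ℝ ℝ (Shape n))).contDiff.contDiffAt.comp s (h1.add h2)
  exact h3.add ((h4.add (hw'.clm_comp contDiffAt_const)).clm_comp contDiffAt_const)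

theorem configuration_eq (q : BodyCoord n) : configuration S q =
    (B.rotConf (planarRot (q.1 + q.2.1)) (B.bodyRotConf (planarRot q.2.1) (S.w q.2.2)) :
      C(Ball B.radius, E3)) := by
  ext x i
  simp only [planarRot_add, B.rotConf_apply, B.bodyRotConf_apply, rot_mul]
  rfl

theorem hasFDerivAt_configuration {q : BodyCoord n} (hq : q.2.2 ∈ S.U) :
    HasFDerivAt (configuration S)
      (B.conf.subtypeL.comp ((B.rotConf (planarRot (q.1 + q.2.1))).comp
        ((B.bodyRotConf (planarRot q.2.1)).comp (bodyVelocity S q.2.2)))) q := by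
  have hfun : configuration S = fun q : BodyCoord n => B.conf.subtypeL
      (B.rotConf (planarRot (q.1 + q.2.1)) (B.bodyRotConf (planarRot q.2.1) (S.w q.2.2))) :=
    funext (configuration_eq S)
  have hα : HasFDerivAt (fun q : BodyCoord n => q.1 + q.2.1)
      (ContinuousLinearMap.fst ℝ ℝ (ℝ × Shape n) + (ContinuousLinearMap.fst ℝ ℝ (Shape n)).comp
        (ContinuousLinearMap.snd ℝ ℝ (ℝ × Shape n))) q :=
    hasFDerivAt_fst.add (hasFDerivAt_fst.comp q hasFDerivAt_snd)
  have hβ : HasFDerivAt (fun q : BodyCoord n => q.2.1)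
      ((ContinuousLinearMap.fst ℝ ℝ (Shape n)).comp
        (ContinuousLinearMap.snd ℝ ℝ (ℝ × Shape n))) q :=
    hasFDerivAt_fst.comp q hasFDerivAt_snd
  have hs : HasFDerivAt (fun q : BodyCoord n => S.w q.2.2)
      ((fderiv ℝ S.w q.2.2).comp ((ContinuousLinearMap.snd ℝ ℝ (Shape n)).comp
        (ContinuousLinearMap.snd ℝ ℝ (ℝ × Shape n)))) q :=
    HasFDerivAt.comp q (g := S.w) (S.hasFDerivAt hq) (hasFDerivAt_snd.comp q hasFDerivAt_snd)
  have h1 := HasFDerivAt.comp q (g := fun t => B.rotConf (planarRot t))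
    (B.hasDerivAt_spin (q.1 + q.2.1)).hasFDerivAt hα
  have h2 := HasFDerivAt.comp q (g := fun t => B.bodyRotConf (planarRot t))
    (B.hasDerivAt_turn q.2.1).hasFDerivAt hβ
  have h3 := h1.clm_apply (h2.clm_apply hs)
  rw [hfun]
  refine (B.conf.subtypeL.hasFDerivAt.comp q h3).congr_fderiv ?_
  congr 1
  refine ContinuousLinearMap.ext fun u => ?_
  simp only [Function.comp, add_apply, ContinuousLinearMap.comp_apply,
    ContinuousLinearMap.flip_apply, ContinuousLinearMap.toSpanSingleton_apply,
    ContinuousLinearMap.coe_fst', ContinuousLinearMap.coe_snd', smul_apply, map_add, map_smul,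
    bodyVelocity_apply, ElasticBody.spin_bodyRotConf]
  module

/-- Rotations in space and in the body both preserve the mass form, so the coefficients depend on
the shape only and not on α and β. -/
theorem kineticForm_eq {q : BodyCoord n} (hq : q.2.2 ∈ S.U) (u u' : BodyCoord n) :
    kineticForm S q u u' = B.massForm (bodyVelocity S q.2.2 u) (bodyVelocity S q.2.2 u') := by
  unfold kineticForm
  rw [(hasFDerivAt_configuration S hq).fderiv, ← B.massForm_bodyRotConf (planarRot q.2.1),
    ← B.massForm_rotConf (planarRot (q.1 + q.2.1)), B.massForm_apply]
  rfl

theorem moment_spin (v : B.conf) :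
    B.massForm (B.spin v) (B.spin v) = B.inertia v 2 2 := by
  rw [B.inertia_eq_moment, if_pos rfl, Fin.sum_univ_three, B.massForm_eq_sum, Fin.sum_univ_three]
  have h0 : B.moment 0 0 (B.spin v) (B.spin v) = B.moment 1 1 v v := by
    simp only [B.moment_apply]
    congr 1; funext x
    simp [ElasticBody.coordMul, (B.spin_apply v x).1]
  have h1 : B.moment 1 1 (B.spin v) (B.spin v) = B.moment 0 0 v v := by
    simp only [B.moment_apply]
    congr 1; funext x
    simp [ElasticBody.coordMul, (B.spin_apply v x).2.1]
  have h2 : B.moment 2 2 (B.spin v) (B.spin v) = 0 := by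
    simp only [B.moment_apply]
    rw [← MeasureTheory.integral_zero (Ball B.radius) ℝ (μ := ballVolume B.radius)]
    congr 1; funext x
    simp [ElasticBody.coordMul, (B.spin_apply v x).2.2]
  rw [h0, h1, h2]
  ring

theorem massForm_spin_spin {s : Shape n} (hs : s ∈ S.U) :
    B.massForm (B.spin (S.w s)) (B.spin (S.w s)) = B.I₀ + s.1 2 := by
  rw [moment_spin, S.inertia_eq s hs]
  simp

theorem hasFDerivAt_moment {s : Shape n} (hs : s ∈ S.U) (i j : Fin 3) :
    HasFDerivAt (fun s => B.moment i j (S.w s) (S.w s))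
      ((B.moment i j (S.w s) + (B.moment i j).flip (S.w s)).comp (fderiv ℝ S.w s)) s := by
  have h := ((B.moment i j).hasFDerivAt.comp s (S.hasFDerivAt hs)).clm_apply (S.hasFDerivAt hs)
  refine h.congr_fderiv (ContinuousLinearMap.ext fun u => ?_)
  simp

/-- The off-diagonal second moments vanish on the section. -/
theorem moment_section {s : Shape n} (hs : s ∈ S.U) {i j : Fin 3} (hij : i ≠ j) :
    B.moment i j (S.w s) (S.w s) = 0 := by
  have h1 := B.inertia_eq_moment (S.w s) i j
  rw [S.inertia_eq s hs, if_neg hij, Matrix.diagonal_apply_ne _ hij] at h1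
  linarith

theorem moment_section_fderiv {s : Shape n} (hs : s ∈ S.U) {i j : Fin 3} (hij : i ≠ j)
    (σ : Shape n) : B.moment i j (S.w s) (fderiv ℝ S.w s σ) +
      B.moment j i (S.w s) (fderiv ℝ S.w s σ) = 0 := by
  have h1 : HasFDerivAt (fun s => B.moment i j (S.w s) (S.w s)) (0 : Shape n →L[ℝ] ℝ) s :=
    (hasFDerivAt_const (0 : ℝ) s).congr_of_eventuallyEq (by
      filter_upwards [S.isOpen_U.mem_nhds hs] with s' hs' using moment_section S hs' hij)
  have h2 := congrArg (fun l : Shape n →L[ℝ] ℝ => l σ) ((hasFDerivAt_moment S hs i j).unique h1)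
  simp only [ContinuousLinearMap.comp_apply, add_apply, ContinuousLinearMap.flip_apply,
    zero_apply] at h2
  rw [B.moment_swap i j (fderiv ℝ S.w s σ)] at h2
  exact h2

/-- The second moments are unchanged by v ↦ v ∘ Γ⁻¹, because density and measure are rotation
invariant; this is the derivative of that identity. -/
theorem moment_turn (v : B.conf) (i j : Fin 3) :
    B.moment i j v (B.turn v) + B.moment j i v (B.turn v) = 0 := by
  have h := B.hasDerivAt_turn_zero v
  have h1 := (((B.moment i j).hasFDerivAt.comp_hasDerivAt 0 h)).clm_apply h
  have h2 : HasDerivAt (fun t => B.moment i j (B.bodyRotConf (planarRot t) v)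
      (B.bodyRotConf (planarRot t) v)) 0 0 := by
    simp only [B.moment_bodyRotConf]
    exact hasDerivAt_const _ _
  have h3 := h1.unique h2
  simp only [Function.comp, planarRot_zero, B.bodyRotConf_one, ContinuousLinearMap.id_apply] at h3
  rw [B.moment_swap i j (B.turn v)] at h3
  linarith

/-- A rotation in space moves the mixed moment at a rate given by the difference of two principal
moments. Therefore distinct moments detect such a rotation. -/
theorem moment_zero_one_spin (v : B.conf) :
    B.moment 0 1 v (B.spin v) + B.moment 1 0 v (B.spin v) =
      B.inertia v 1 1 - B.inertia v 0 0 := by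
  have h0 : B.moment 0 1 v (B.spin v) = B.moment 0 0 v v := by
    simp only [B.moment_apply]
    congr 1; funext x
    simp [ElasticBody.coordMul, (B.spin_apply v x).2.1]
  have h1 : B.moment 1 0 v (B.spin v) = - B.moment 1 1 v v := by
    simp only [B.moment_apply]
    rw [← MeasureTheory.integral_neg]
    congr 1; funext x
    simp [ElasticBody.coordMul, (B.spin_apply v x).1]
  rw [B.inertia_eq_moment, B.inertia_eq_moment, if_pos rfl, if_pos rfl, h0, h1]
  ring

theorem spin_v₀_apply (x : Ball B.radius) : (B.spin B.v₀ : C(Ball B.radius, E3)) x =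
    WithLp.toLp 2 ((Pi.single 2 1 : Fin 3 → ℝ) ⨯₃ (x : E3).ofLp) := by
  have h := B.spin_apply B.v₀ x
  ext i
  have hv : (B.v₀ : C(Ball B.radius, E3)) x = (x : E3) := rfl
  rw [hv] at h
  fin_cases i
  · simpa [cross_apply] using h.1
  · simpa [cross_apply] using h.2.1
  · simpa [cross_apply] using h.2.2

theorem S_zero_turn : B.turn (S.w 0) = - B.spin (S.w 0) := by
  rw [S.w_zero]; exact B.turn_v₀

/-- The map `(b, σ) ↦ b A w + Dw σ`, where `A` is the generator of the rotations of the body. -/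
def turnVelocity (s : Shape n) : ℝ × Shape n →L[ℝ] B.conf :=
  (ContinuousLinearMap.fst ℝ ℝ (Shape n)).smulRight (B.turn (S.w s)) +
    (fderiv ℝ S.w s).comp (ContinuousLinearMap.snd ℝ ℝ (Shape n))

/-- At v₀ the turn is an infinitesimal rotation. Transversality keeps it out of the tangent space of
the section, and the section is immersed. -/
theorem injective_turnVelocity_zero : Function.Injective (turnVelocity S 0) := by
  rw [← ContinuousLinearMap.coe_coe, ← LinearMap.ker_eq_bot, LinearMap.ker_eq_bot']
  rintro ⟨b, σ⟩ h
  have h1 : b • B.turn (S.w 0) + fderiv ℝ S.w 0 σ = 0 := h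
  rw [S_zero_turn, S.w_zero] at h1
  have h2 : fderiv ℝ S.w 0 σ = b • B.spin B.v₀ := by
    rw [smul_neg, neg_add_eq_zero] at h1
    exact h1.symm
  have h3 := S.transversal σ (b • (Pi.single 2 1 : Fin 3 → ℝ)) (fun x => by
    rw [h2]
    change b • (B.spin B.v₀ : C(Ball B.radius, E3)) x = _
    rw [spin_v₀_apply, map_smul]
    rfl)
  have hb : b = 0 := by
    have := congrFun h3 2
    simpa using this
  subst hb
  rw [zero_smul] at h2
  have h4 := S.immersion 0 S.zero_mem (h2.trans (map_zero _).symm)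
  rw [h4]; rfl

theorem eventually_injective_turnVelocity :
    ∀ᶠ s in 𝓝 (0 : Shape n), Function.Injective (turnVelocity S s) := by
  have hw := S.contDiffAt S.zero_mem
  have hw' : ContinuousAt (fderiv ℝ S.w) 0 := (hw.fderiv_right (m := 0) (by simp)).continuousAt
  have hc : ContinuousAt (turnVelocity S) 0 := by
    have h2 : ContinuousAt (fun s => B.turn (S.w s)) 0 :=
      B.turn.continuous.continuousAt.comp hw.continuousAt
    have h4 := (ContinuousLinearMap.smulRightL ℝ (ℝ × Shape n) B.conf
      (ContinuousLinearMap.fst ℝ ℝ (Shape n))).continuous.continuousAt.comp h2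
    exact h4.add (hw'.clm_comp continuousAt_const)
  exact hc.eventually
    (ContinuousLinearMap.isOpen_injective.mem_nhds (injective_turnVelocity_zero S))

/-- The kinetic energy is positive definite near `v₀` at the configurations with distinct principal
moments of inertia. -/
theorem injective_bodyVelocity {s : Shape n} (hs : s ∈ S.U)
    (hinj : Function.Injective (turnVelocity S s)) (hJ : s.1 0 ≠ s.1 1) :
    Function.Injective (bodyVelocity S s) := by
  rw [← ContinuousLinearMap.coe_coe, ← LinearMap.ker_eq_bot, LinearMap.ker_eq_bot']
  rintro ⟨a, b, σ⟩ h
  have h1 : a • B.spin (S.w s) + (b • (B.spin (S.w s) + B.turn (S.w s)) +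
      fderiv ℝ S.w s σ) = 0 := h
  -- Take the derivative of the mixed moment of the first two axes along the vanishing velocity.
  -- Turns and tangent vectors of the section do not contribute, so only (a + b) (J₁ - J₀) remains.
  have hab : a + b = 0 := by
    have e1 := congrArg (B.moment 0 1 (S.w s)) h1
    have e2 := congrArg (B.moment 1 0 (S.w s)) h1
    simp only [map_add, map_smul, smul_eq_mul, map_zero] at e1 e2
    have e3 := moment_turn (S.w s) 0 1
    have e4 := moment_section_fderiv S hs (show (0 : Fin 3) ≠ 1 by decide) σ
    have e5 := moment_zero_one_spin (S.w s)
    rw [S.inertia_eq s hs] at e5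
    simp only [Matrix.diagonal_apply_eq] at e5
    have e6 : (a + b) * (s.1 1 - s.1 0) = 0 := by
      linear_combination e1 + e2 - b * e3 - e4 - (a + b) * e5
    exact (mul_eq_zero.1 e6).resolve_right (sub_ne_zero.2 hJ.symm)
  have h2 : turnVelocity S s (b, σ) = 0 := by
    change b • B.turn (S.w s) + fderiv ℝ S.w s σ = 0
    rw [← h1, eq_neg_of_add_eq_zero_left hab]
    module
  have h3 := hinj (h2.trans (map_zero _).symm)
  obtain ⟨rfl, rfl⟩ := Prod.mk.inj h3
  have : a = 0 := by simpa using hab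
  rw [this]; rfl

theorem I₀_pos : 0 < B.I₀ := by
  have h : B.I₀ = B.massForm (B.spin B.v₀) (B.spin B.v₀) := (moment_spin B.v₀).symm
  rw [h]
  refine B.massForm_pos _ fun h0 => ?_
  have hr := B.radius_pos
  set x : Ball B.radius := ⟨EuclideanSpace.single 0 B.radius, by
    rw [mem_closedBall_zero_iff]; simp [abs_of_pos hr]⟩ with hx
  have h1 := (B.spin_apply B.v₀ x).2.1
  rw [h0] at h1
  have h2 : (B.v₀ : C(Ball B.radius, E3)) x 0 = B.radius := by
    change (EuclideanSpace.single 0 B.radius : E3) 0 = _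
    simp
  rw [h2] at h1
  exact hr.ne h1

/-- At v₀ this product is -I₀. Up to sign it is the inertial coupling of spin with the symmetry
direction χ' = -β', by which the conserved momentum controls the angular velocity of the body. -/
theorem eventually_spin_turn_ne_zero :
    ∀ᶠ s in 𝓝 (0 : Shape n), B.massForm (B.spin (S.w s)) (B.turn (S.w s)) ≠ 0 := by
  have hw := (S.contDiffAt S.zero_mem).continuousAt
  have hc : ContinuousAt (fun s => B.massForm (B.spin (S.w s)) (B.turn (S.w s))) 0 :=
    ((B.massForm.continuous.comp B.spin.continuous).continuousAt.comp hw).clm_apply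
      (B.turn.continuous.continuousAt.comp hw)
  refine hc.eventually_ne ?_
  have := massForm_spin_spin S S.zero_mem
  rw [S_zero_turn, map_neg, this]
  have := I₀_pos (B := B)
  simp only [Prod.fst_zero, Pi.zero_apply, add_zero]
  exact neg_ne_zero.2 this.ne'

end SpinOrbit

end

/-! ### Linearisation at the identical deformation: strains and infinitesimal rotations -/

noncomputable section

set_option maxSynthPendingDepth 3

/-- The second derivative of a composition at a critical point. -/
theorem hessian_comp_of_critical {X Y : Type*} [NormedAddCommGroup X] [NormedSpace ℝ X]
    [NormedAddCommGroup Y] [NormedSpace ℝ Y] {f : Y → ℝ} {g : X → Y} {x : X}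
    (hf : ContDiffAt ℝ 2 f (g x)) (hg : ContDiffAt ℝ 2 g x) (hcrit : fderiv ℝ f (g x) = 0)
    (u u' : X) : fderiv ℝ (fderiv ℝ fun x => f (g x)) x u u' =
      fderiv ℝ (fderiv ℝ f) (g x) (fderiv ℝ g x u) (fderiv ℝ g x u') := by
  have h1 : fderiv ℝ (fun x => f (g x)) =ᶠ[𝓝 x]
      fun z => (fderiv ℝ f (g z)).comp (fderiv ℝ g z) := by
    filter_upwards [hg.eventually (by simp),
      hg.continuousAt.eventually (hf.eventually (by simp))] with z hz1 hz2
    exact fderiv_comp z (hz2.differentiableAt (by simp)) (hz1.differentiableAt (by simp))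
  have hf' : DifferentiableAt ℝ (fderiv ℝ f) (g x) :=
    (hf.fderiv_right (m := 1) (by norm_num)).differentiableAt (by simp)
  have hg' : DifferentiableAt ℝ (fderiv ℝ g) x :=
    (hg.fderiv_right (m := 1) (by norm_num)).differentiableAt (by simp)
  have h2 : HasFDerivAt (fun z => fderiv ℝ f (g z))
      ((fderiv ℝ (fderiv ℝ f) (g x)).comp (fderiv ℝ g x)) x :=
    HasFDerivAt.comp x hf'.hasFDerivAt (hg.differentiableAt (by simp)).hasFDerivAt
  have h3 := h2.clm_comp hg'.hasFDerivAt
  rw [h1.fderiv_eq, h3.fderiv, hcrit]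
  simp

namespace SpinOrbit

variable {B : ElasticBody} {n : ℕ} (S : AdaptedSection B n)

namespace ElasticBody

/-- The action `v ↦ Γ v ∘ Γ⁻¹` on configurations. -/
def conjConf (B : ElasticBody) (Γ : SO3) : B.conf →L[ℝ] B.conf :=
  (B.rotConf Γ).comp (B.bodyRotConf Γ)

theorem conjConf_apply (Γ : SO3) (v : B.conf) (x : Ball B.radius) :
    (B.conjConf Γ v : C(Ball B.radius, E3)) x =
      rot Γ ((v : C(Ball B.radius, E3)) (rotBall B.radius Γ⁻¹ x)) := by
  rw [conjConf, ContinuousLinearMap.comp_apply, rotConf_apply, bodyRotConf_apply]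

theorem conjConf_conjConf (Γ Γ' : SO3) (v : B.conf) :
    B.conjConf Γ (B.conjConf Γ' v) = B.conjConf (Γ * Γ') v := by
  refine B.conf_ext fun x i => ?_
  rw [conjConf_apply, conjConf_apply, conjConf_apply, mul_inv_rev, rotBall_mul, rot_mul]

theorem conjConf_one (v : B.conf) : B.conjConf 1 v = v := by
  refine B.conf_ext fun x i => ?_
  rw [conjConf_apply, inv_one, rotBall_one, rot_one]

theorem conjConf_v₀ (Γ : SO3) : B.conjConf Γ B.v₀ = B.v₀ := by
  refine B.conf_ext fun x i => ?_
  rw [conjConf_apply]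
  change rot Γ (rot Γ⁻¹ x) i = (x : E3) i
  rw [← rot_mul, mul_inv_cancel, rot_one]

/-- The derivative at `v₀` of the matrix of second moments. -/
def strain (B : ElasticBody) (i j : Fin 3) : B.conf →L[ℝ] ℝ :=
  B.moment i j B.v₀ + B.moment j i B.v₀

theorem strain_apply (i j : Fin 3) (u : B.conf) :
    B.strain i j u = B.moment i j B.v₀ u + B.moment j i B.v₀ u := rfl

theorem strain_symm (i j : Fin 3) (u : B.conf) : B.strain i j u = B.strain j i u := by
  rw [strain_apply, strain_apply, add_comm]

/-- As v₀ is fixed by the conjugation action, the strain transforms as a tensor. -/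
theorem strain_conjConf (Γ : SO3) (i j : Fin 3) (u : B.conf) :
    B.strain i j (B.conjConf Γ u) = ∑ k, ∑ l, (Γ : Matrix (Fin 3) (Fin 3) ℝ) i k *
      (Γ : Matrix (Fin 3) (Fin 3) ℝ) j l * B.strain k l u := by
  have h : ∀ i j, B.moment i j B.v₀ (B.conjConf Γ u) = ∑ k, ∑ l,
      (Γ : Matrix (Fin 3) (Fin 3) ℝ) i k * (Γ : Matrix (Fin 3) (Fin 3) ℝ) j l *
        B.moment k l B.v₀ u := by
    intro i j
    conv_lhs => rw [← conjConf_v₀ Γ]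
    simp only [conjConf, ContinuousLinearMap.comp_apply, moment_rotConf, moment_bodyRotConf]
  rw [strain_apply, h, h]
  simp only [strain_apply, Fin.sum_univ_three]
  ring

/-- At v₀ this infinitesimal rotation is a turn of the body up to sign, and turns preserve the
second moments. -/
theorem strain_spin (i j : Fin 3) : B.strain i j (B.spin B.v₀) = 0 := by
  have h := moment_turn B.v₀ i j
  rw [turn_v₀, map_neg, map_neg] at h
  rw [strain_apply]
  linarith

end ElasticBody

/-- A rotation that maps the third basis vector to the first one. -/
def cyc : SO3 := ⟨!![0, 0, 1; 1, 0, 0; 0, 1, 0], by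
  rw [Matrix.mem_specialOrthogonalGroup_iff, Matrix.mem_orthogonalGroup_iff]
  constructor
  · ext i j
    fin_cases i <;> fin_cases j <;> simp [Matrix.mul_apply, Fin.sum_univ_three]
  · simp [Matrix.det_fin_three]⟩

namespace ElasticBody

/-- The infinitesimal rotations `x ↦ ξ ∧ x`. -/
def infRot (B : ElasticBody) (ξ : Fin 3 → ℝ) : B.conf :=
  ξ 0 • B.conjConf cyc (B.spin B.v₀) + ξ 1 • B.conjConf (cyc * cyc) (B.spin B.v₀) +
    ξ 2 • B.spin B.v₀

theorem spin_v₀_coord (x : Ball B.radius) : (B.spin B.v₀ : C(Ball B.radius, E3)) x 0 = -(x : E3) 1 ∧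
    (B.spin B.v₀ : C(Ball B.radius, E3)) x 1 = (x : E3) 0 ∧
    (B.spin B.v₀ : C(Ball B.radius, E3)) x 2 = 0 := B.spin_apply B.v₀ x

theorem coe_inv_SO3 (Γ : SO3) :
    ((Γ⁻¹ : SO3) : Matrix (Fin 3) (Fin 3) ℝ) = (Γ : Matrix (Fin 3) (Fin 3) ℝ)ᵀ := rfl

/-- Conjugation by Γ carries the rotation about e₃ to the rotation about Γ e₃, and `cyc` and its
square send e₃ to e₁ and e₂. -/
theorem infRot_apply (ξ : Fin 3 → ℝ) (x : Ball B.radius) :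
    (B.infRot ξ : C(Ball B.radius, E3)) x = WithLp.toLp 2 (ξ ⨯₃ (x : E3).ofLp) := by
  have hr : ∀ Γ : SO3, ∀ i, (rotBall B.radius Γ⁻¹ x : E3) i =
      ∑ k, (Γ : Matrix (Fin 3) (Fin 3) ℝ) k i * (x : E3) k := by
    intro Γ i
    change rot Γ⁻¹ x i = _
    rw [rot_apply, coe_inv_SO3]
    rfl
  have h1 := spin_v₀_coord (B := B) (rotBall B.radius cyc⁻¹ x)
  have h2 := spin_v₀_coord (B := B) (rotBall B.radius (cyc * cyc)⁻¹ x)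
  have h3 := spin_v₀_coord (B := B) x
  have hc2 : ((cyc * cyc : SO3) : Matrix (Fin 3) (Fin 3) ℝ) = !![0, 1, 0; 0, 0, 1; 1, 0, 0] := by
    change (cyc : Matrix (Fin 3) (Fin 3) ℝ) * (cyc : Matrix (Fin 3) (Fin 3) ℝ) = _
    ext i j
    fin_cases i <;> fin_cases j <;> simp [cyc, Matrix.mul_apply, Fin.sum_univ_three]
  have hc : (cyc : Matrix (Fin 3) (Fin 3) ℝ) = !![0, 0, 1; 1, 0, 0; 0, 1, 0] := rfl
  have hexp : ∀ i, (B.infRot ξ : C(Ball B.radius, E3)) x i =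
      ξ 0 * (B.conjConf cyc (B.spin B.v₀) : C(Ball B.radius, E3)) x i +
      ξ 1 * (B.conjConf (cyc * cyc) (B.spin B.v₀) : C(Ball B.radius, E3)) x i +
      ξ 2 * (B.spin B.v₀ : C(Ball B.radius, E3)) x i := fun i => rfl
  ext i
  rw [hexp]
  simp only [conjConf_apply, rot_apply, Fin.sum_univ_three, h1.1, h1.2.1, h1.2.2, h2.1, h2.2.1,
    h2.2.2, hr, hc, hc2]
  fin_cases i
  · simp [h3.1, cross_apply]; ring
  · simp [h3.2.1, cross_apply]; ring
  · simp [h3.2.2, cross_apply]; ring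

theorem strain_infRot (ξ : Fin 3 → ℝ) (i j : Fin 3) : B.strain i j (B.infRot ξ) = 0 := by
  simp only [infRot, map_add, map_smul, strain_conjConf, strain_spin, mul_zero,
    Finset.sum_const_zero, smul_zero, add_zero]

end ElasticBody

theorem strain_fderiv {i j : Fin 3} (hij : i ≠ j) (σ : Shape n) :
    B.strain i j (fderiv ℝ S.w 0 σ) = 0 := by
  have h := moment_section_fderiv S S.zero_mem hij σ
  rw [S.w_zero] at h
  exact h

theorem strain_fderiv_diag (i : Fin 3) (σ : Shape n) :
    ∑ k, B.strain k k (fderiv ℝ S.w 0 σ) - B.strain i i (fderiv ℝ S.w 0 σ) = σ.1 i := by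
  have h1 : HasFDerivAt (fun s : Shape n => ∑ k, B.moment k k (S.w s) (S.w s) -
      B.moment i i (S.w s) (S.w s)) ((ContinuousLinearMap.proj i).comp
        (ContinuousLinearMap.fst ℝ (Fin 3 → ℝ) (Fin n → ℝ))) 0 := by
    have h2 : HasFDerivAt (fun s : Shape n => s.1 i) ((ContinuousLinearMap.proj i).comp
        (ContinuousLinearMap.fst ℝ (Fin 3 → ℝ) (Fin n → ℝ))) 0 :=
      ((ContinuousLinearMap.proj i : (Fin 3 → ℝ) →L[ℝ] ℝ).comp
        (ContinuousLinearMap.fst ℝ (Fin 3 → ℝ) (Fin n → ℝ))).hasFDerivAt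
    refine (h2.const_add B.I₀).congr_of_eventuallyEq ?_
    filter_upwards [S.isOpen_U.mem_nhds S.zero_mem] with s hs
    have := B.inertia_eq_moment (S.w s) i i
    rw [if_pos rfl, S.inertia_eq s hs, Matrix.diagonal_apply_eq] at this
    exact this.symm
  have h3 := (HasFDerivAt.fun_sum fun k (_ : k ∈ Finset.univ) =>
    hasFDerivAt_moment S S.zero_mem k k).sub (hasFDerivAt_moment S S.zero_mem i i)
  have h4 := congrArg (fun l : Shape n →L[ℝ] ℝ => l σ) (h3.unique h1)
  have h5 : ∀ k, ((B.moment k k (S.w 0) + (B.moment k k).flip (S.w 0)).comp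
      (fderiv ℝ S.w 0)) σ = B.strain k k (fderiv ℝ S.w 0 σ) := by
    intro k
    simp only [ContinuousLinearMap.comp_apply, add_apply, ContinuousLinearMap.flip_apply,
      B.strain_apply, S.w_zero]
    rw [B.moment_swap k k _ B.v₀]
  simp only [sub_apply, sum_apply, h5] at h4
  exact h4

/-- A rotation by a rational angle in the first coordinate plane. -/
def pyth : SO3 := ⟨!![3 / 5, -4 / 5, 0; 4 / 5, 3 / 5, 0; 0, 0, 1], by
  rw [Matrix.mem_specialOrthogonalGroup_iff, Matrix.mem_orthogonalGroup_iff]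
  constructor
  · ext i j
    fin_cases i <;> fin_cases j <;> simp [Matrix.mul_apply, Fin.sum_univ_three] <;> norm_num
  · simp [Matrix.det_fin_three]; norm_num⟩

/-- The off-diagonal part of the derivative at `v₀` of the matrix of second moments. -/
def shear (B : ElasticBody) : B.conf →ₗ[ℝ] Fin 3 → ℝ :=
  LinearMap.pi ![(B.strain 0 1 : B.conf →ₗ[ℝ] ℝ), (B.strain 0 2 : B.conf →ₗ[ℝ] ℝ),
    (B.strain 1 2 : B.conf →ₗ[ℝ] ℝ)]

theorem shear_eq_zero_iff (u : B.conf) : shear B u = 0 ↔ ∀ i j, i ≠ j → B.strain i j u = 0 := by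
  constructor
  · intro h
    have h0 : B.strain 0 1 u = 0 := congrFun h 0
    have h1 : B.strain 0 2 u = 0 := congrFun h 1
    have h2 : B.strain 1 2 u = 0 := congrFun h 2
    have h0' := (B.strain_symm 0 1 u).symm.trans h0
    have h1' := (B.strain_symm 0 2 u).symm.trans h1
    have h2' := (B.strain_symm 1 2 u).symm.trans h2
    intro i j hij
    fin_cases i <;> fin_cases j <;> first | exact absurd rfl hij | assumption
  · intro h
    funext k
    fin_cases k
    · exact h 0 1 (by decide)
    · exact h 0 2 (by decide)
    · exact h 1 2 (by decide)

/-- A diagonal strain with unequal first two entries becomes a pure shear of the first two axes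
after a rotation in their plane; cyclic permutations of the axes give the other two shears. The
section supplies the diagonal strain, since J₀ is one of its coordinates. -/
theorem surjective_shear (S : AdaptedSection B n) : Function.Surjective (shear B) := by
  -- diagonal strains, and their images under rotations
  set u : Fin 3 → B.conf := fun k => fderiv ℝ S.w 0 (Pi.single k 1, 0) with hu
  have hoff : ∀ k i j, i ≠ j → B.strain i j (u k) = 0 := fun k i j hij =>
    strain_fderiv S hij _
  have hd := fun k i => strain_fderiv_diag S i (Pi.single k 1, 0)
  simp only [Fin.sum_univ_three] at hd
  have hp : (pyth : Matrix (Fin 3) (Fin 3) ℝ) = !![3 / 5, -4 / 5, 0; 4 / 5, 3 / 5, 0; 0, 0, 1] := rfl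
  have hc : (cyc : Matrix (Fin 3) (Fin 3) ℝ) = !![0, 0, 1; 1, 0, 0; 0, 1, 0] := rfl
  set a : B.conf := B.conjConf pyth (u 0) with ha
  have hs : ∀ i j, B.strain i j a = _ := fun i j => B.strain_conjConf pyth i j (u 0)
  have h0 : B.strain 0 0 (u 0) - B.strain 1 1 (u 0) = -1 := by
    have e0 := hd 0 0
    have e1 := hd 0 1
    simp at e0 e1
    linarith
  have o01 := hoff 0 0 1 (by decide)
  have o02 := hoff 0 0 2 (by decide)
  have o12 := hoff 0 1 2 (by decide)
  have o10 := hoff 0 1 0 (by decide)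
  have o20 := hoff 0 2 0 (by decide)
  have o21 := hoff 0 2 1 (by decide)
  have s01 : B.strain 0 1 a = -12 / 25 := by
    rw [hs]
    simp [Fin.sum_univ_three, hp, o01, o10, o20, o21]
    linarith
  have s02 : B.strain 0 2 a = 0 := by
    rw [hs]
    simp [Fin.sum_univ_three, hp, o02, o12]
  have s12 : B.strain 1 2 a = 0 := by
    rw [hs]
    simp [Fin.sum_univ_three, hp, o02, o12]
  have hcyc : ∀ v : B.conf, B.strain 0 1 (B.conjConf cyc v) = B.strain 0 2 v ∧
      B.strain 0 2 (B.conjConf cyc v) = B.strain 1 2 v ∧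
      B.strain 1 2 (B.conjConf cyc v) = B.strain 0 1 v := by
    intro v
    have h1 := B.strain_symm 2 0 v
    have h2 := B.strain_symm 2 1 v
    refine ⟨?_, ?_, ?_⟩ <;> rw [B.strain_conjConf] <;> simp [Fin.sum_univ_three, hc, h1, h2]
  set b := B.conjConf cyc a with hb
  set c := B.conjConf cyc b with hc'
  obtain ⟨b1, b2, b3⟩ := hcyc a
  obtain ⟨c1, c2, c3⟩ := hcyc b
  rw [← hb] at b1 b2 b3
  rw [← hc'] at c1 c2 c3
  intro y
  -- The vectors a, c, b carry the single shears 01, 02, 12, each of size (3/5) (4/5) (-1) = -12/25.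
  refine ⟨(-25 / 12 * y 0) • a + (-25 / 12 * y 1) • c + (-25 / 12 * y 2) • b, ?_⟩
  funext k
  fin_cases k
  · change B.strain 0 1 _ = y 0
    simp only [map_add, map_smul, smul_eq_mul, c1, b1, b2, s01, s02, s12]
    ring
  · change B.strain 0 2 _ = y 1
    simp only [map_add, map_smul, smul_eq_mul, c2, b2, b3, s01, s02, s12]
    ring
  · change B.strain 1 2 _ = y 2
    simp only [map_add, map_smul, smul_eq_mul, c3, b3, b1, s01, s02, s12]
    ring

/-- A configuration with diagonal matrix of inertia, to first order at `v₀`, is the sum of a tangent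
vector of the section and an infinitesimal rotation. -/
theorem exists_decomposition {u : B.conf} (hu : shear B u = 0) :
    ∃ (σ : Shape n) (ξ : Fin 3 → ℝ), u = fderiv ℝ S.w 0 σ + B.infRot ξ := by
  set Θ : (Shape n × (Fin 3 → ℝ)) →ₗ[ℝ] B.conf :=
    { toFun := fun p => fderiv ℝ S.w 0 p.1 + B.infRot p.2
      map_add' := fun p q => by
        simp only [ElasticBody.infRot, Prod.fst_add, Prod.snd_add, map_add, Pi.add_apply]
        module
      map_smul' := fun c p => by
        simp only [ElasticBody.infRot, Prod.smul_fst, Prod.smul_snd, map_smul, Pi.smul_apply,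
          smul_eq_mul, RingHom.id_apply]
        module } with hΘ
  have hinj : Function.Injective Θ := by
    rw [← LinearMap.ker_eq_bot, LinearMap.ker_eq_bot']
    rintro ⟨σ, ξ⟩ h
    have h1 : fderiv ℝ S.w 0 σ + B.infRot ξ = 0 := h
    have h2 : -ξ = 0 := S.transversal σ (-ξ) fun x => by
      rw [eq_neg_of_add_eq_zero_left h1]
      change -((B.infRot ξ : C(Ball B.radius, E3)) x) = _
      rw [B.infRot_apply, map_neg]
      rfl
    have h3 : ξ = 0 := neg_eq_zero.1 h2
    subst h3
    have h4 : B.infRot 0 = 0 := by simp [ElasticBody.infRot]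
    rw [h4, add_zero] at h1
    have h5 := S.immersion 0 S.zero_mem (h1.trans (map_zero _).symm)
    rw [h5]; rfl
  have hle : LinearMap.range Θ ≤ LinearMap.ker (shear B) := by
    rintro _ ⟨p, rfl⟩
    rw [LinearMap.mem_ker, shear_eq_zero_iff]
    intro i j hij
    change B.strain i j (fderiv ℝ S.w 0 p.1 + B.infRot p.2) = 0
    rw [map_add, strain_fderiv S hij, B.strain_infRot, add_zero]
  -- Both sides have dimension n + 6: shapes and rotation vectors give (3 + n) + 3, and three
  -- independent shears are removed from n + 9.
  have hfin : Module.finrank ℝ (LinearMap.range Θ) = Module.finrank ℝ (LinearMap.ker (shear B)) := by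
    rw [LinearMap.finrank_range_of_inj hinj]
    have h1 := LinearMap.finrank_range_add_finrank_ker (shear B)
    rw [LinearMap.range_eq_top.2 (surjective_shear S), finrank_top, S.codim] at h1
    simp only [Module.finrank_prod, Module.finrank_fin_fun] at h1 ⊢
    omega
  have hmem : u ∈ LinearMap.range Θ := by
    rw [Submodule.eq_of_le_of_finrank_eq hle hfin]
    exact hu
  obtain ⟨p, hp⟩ := hmem
  exact ⟨p.1, p.2, hp.symm⟩

end SpinOrbit

end

/-! ### Invariance of the elastic stiffness and ordering of the response -/

noncomputable section

set_option maxSynthPendingDepth 3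

namespace SpinOrbit

variable {B : ElasticBody} {n : ℕ} {S : AdaptedSection B n}

/-- The derivative at `v₀` of a diagonal element of the matrix of inertia. -/
def inertiaDeriv (B : ElasticBody) (i : Fin 3) : B.conf →L[ℝ] ℝ :=
  ∑ k, B.strain k k - B.strain i i

theorem inertiaDeriv_apply (i : Fin 3) (u : B.conf) :
    inertiaDeriv B i u = ∑ k, B.strain k k u - B.strain i i u := by
  simp [inertiaDeriv, sub_apply, sum_apply]

theorem inertiaDeriv_fderiv (i : Fin 3) (σ : Shape n) :
    inertiaDeriv B i (fderiv ℝ S.w 0 σ) = σ.1 i := by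
  rw [inertiaDeriv_apply, strain_fderiv_diag]

theorem inertiaDeriv_infRot (i : Fin 3) (ξ : Fin 3 → ℝ) : inertiaDeriv B i (B.infRot ξ) = 0 := by
  simp [inertiaDeriv_apply, B.strain_infRot]

namespace ElasticPotential

variable (V : ElasticPotential S)

theorem contDiffAt : ContDiffAt ℝ ∞ V.V B.v₀ := by
  obtain ⟨N, hN, h0, hV⟩ := V.smooth
  exact hV.contDiffAt (hN.mem_nhds h0)

theorem eventually_contDiffAt : ∀ᶠ v in 𝓝 B.v₀, ContDiffAt ℝ ∞ V.V v := by
  obtain ⟨N, hN, h0, hV⟩ := V.smooth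
  filter_upwards [hN.mem_nhds h0] with v hv
  exact hV.contDiffAt (hN.mem_nhds hv)

theorem fderiv_v₀ : fderiv ℝ V.V B.v₀ = 0 := V.isLocalMin.fderiv_eq_zero

theorem comp_conjConf (Γ : SO3) (v : B.conf) : V.V (B.conjConf Γ v) = V.V v := by
  refine V.invariant₂ Γ _ _ ?_
  ext1 x
  rw [B.conjConf_apply]
  rfl

theorem comp_rotConf (Γ : SO3) (v : B.conf) : V.V (B.rotConf Γ v) = V.V v := by
  refine V.invariant₁ Γ _ _ ?_
  ext1 x
  rw [B.rotConf_apply]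
  rfl

/-- The Hessian of the elastic potential at `v₀`. -/
def stiffness : B.conf →L[ℝ] B.conf →L[ℝ] ℝ := fderiv ℝ (fderiv ℝ V.V) B.v₀

theorem stiffness_symm (u u' : B.conf) : V.stiffness u u' = V.stiffness u' u :=
  hessian_symm (V.contDiffAt.of_le (by norm_cast)) u u'

theorem stiffness_nonneg (u : B.conf) : 0 ≤ V.stiffness u u :=
  hessian_nonneg_of_isLocalMin (V.contDiffAt.of_le (by norm_cast)) V.isLocalMin u

theorem stiffness_conjConf (Γ : SO3) (u u' : B.conf) :
    V.stiffness (B.conjConf Γ u) (B.conjConf Γ u') = V.stiffness u u' := by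
  have h := hessian_comp_of_critical (f := V.V) (g := B.conjConf Γ) (x := B.v₀)
    (by rw [B.conjConf_v₀]; exact V.contDiffAt.of_le (by norm_cast))
    (B.conjConf Γ).contDiff.contDiffAt (by rw [B.conjConf_v₀]; exact V.fderiv_v₀) u u'
  simp only [V.comp_conjConf, B.conjConf_v₀, ContinuousLinearMap.fderiv] at h
  exact h.symm

theorem hessian_section (σ σ' : Shape n) : fderiv ℝ (fderiv ℝ fun s => V.V (S.w s)) 0 σ σ' =
    V.stiffness (fderiv ℝ S.w 0 σ) (fderiv ℝ S.w 0 σ') := by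
  have h := hessian_comp_of_critical (f := V.V) (g := S.w) (x := 0)
    (by rw [S.w_zero]; exact V.contDiffAt.of_le (by norm_cast))
    ((S.contDiffAt S.zero_mem).of_le (by norm_cast))
    (by rw [S.w_zero]; exact V.fderiv_v₀) σ σ'
  rw [S.w_zero] at h
  exact h

/-- Invariance under rotations gives dV (spin v) = 0 for all v near v₀. Differentiating at v₀, where
dV vanishes, leaves only the stiffness term. -/
theorem stiffness_spin (u : B.conf) : V.stiffness u (B.spin B.v₀) = 0 := by
  have h1 : (fun v => fderiv ℝ V.V v (B.spin v)) =ᶠ[𝓝 B.v₀] fun _ => 0 := by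
    filter_upwards [V.eventually_contDiffAt] with v hv
    have h2 := B.hasDerivAt_spin_zero v
    have h3 : B.rotConf (planarRot 0) v = v := by
      rw [planarRot_zero, B.rotConf_one]; rfl
    have h4 : HasFDerivAt V.V (fderiv ℝ V.V v) (B.rotConf (planarRot 0) v) := by
      rw [h3]; exact (hv.differentiableAt (by simp)).hasFDerivAt
    have h5 := h4.comp_hasDerivAt (0 : ℝ) h2
    have h6 : (V.V ∘ fun t => B.rotConf (planarRot t) v) = fun _ => V.V v := by
      funext t; exact V.comp_rotConf _ _
    rw [h6] at h5
    exact h5.unique (hasDerivAt_const _ _)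
  have h7 : HasFDerivAt (fderiv ℝ V.V) V.stiffness B.v₀ :=
    ((V.contDiffAt.fderiv_right (m := 1) (by norm_cast)).differentiableAt (by simp)).hasFDerivAt
  have h8 := (h7.clm_apply B.spin.hasFDerivAt).unique
    ((hasFDerivAt_const (0 : ℝ) B.v₀).congr_of_eventuallyEq h1)
  have h9 := congrArg (fun l : B.conf →L[ℝ] ℝ => l u) h8
  simpa [V.fderiv_v₀] using h9

theorem stiffness_infRot (u : B.conf) (ξ : Fin 3 → ℝ) : V.stiffness u (B.infRot ξ) = 0 := by
  have h : ∀ Γ : SO3, V.stiffness u (B.conjConf Γ (B.spin B.v₀)) = 0 := by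
    intro Γ
    rw [← V.stiffness_conjConf Γ⁻¹, B.conjConf_conjConf, inv_mul_cancel, B.conjConf_one,
      V.stiffness_spin]
  simp [ElasticBody.infRot, h, V.stiffness_spin]

/-- The response of the shape to a tidal force `g` that acts on the moments of inertia is ordered
as the components of the force are: this follows from the invariance under a rotation that
exchanges two axes. -/
theorem lt_of_response {Γ : SO3} {i j : Fin 3} (hΓ : Γ * Γ = 1)
    (hshear : ∀ u : B.conf, shear B u = 0 → shear B (B.conjConf Γ u) = 0)
    (hswap : ∀ u : B.conf, shear B u = 0 → ∀ k,
      inertiaDeriv B k (B.conjConf Γ u) = inertiaDeriv B (Equiv.swap i j k) u)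
    {g : Fin 3 → ℝ} {s : Shape n}
    (hs : ∀ σ : Shape n, hessian (fun s => V.V (S.w s)) 0 s σ = -∑ k, g k * σ.1 k)
    (hg : g j < g i) : s.1 i < s.1 j := by
  have hij : i ≠ j := by rintro rfl; exact lt_irrefl _ hg
  set u := fderiv ℝ S.w 0 s with hu
  have hker : ∀ σ : Shape n, shear B (fderiv ℝ S.w 0 σ) = 0 := fun σ =>
    (shear_eq_zero_iff _).2 fun i j hij => strain_fderiv S hij σ
  -- The response equation is given on tangent vectors of the section. It extends to all shear-free
  -- vectors because infinitesimal rotations contribute zero to both sides; this admits the image of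
  -- u under Γ as a test vector.
  have hH : ∀ u', shear B u' = 0 → V.stiffness u u' = -∑ k, g k * inertiaDeriv B k u' := by
    intro u' hu'
    obtain ⟨σ, ξ, rfl⟩ := exists_decomposition S hu'
    rw [map_add, V.stiffness_infRot, ← V.hessian_section, add_zero]
    refine (hs σ).trans ?_
    simp only [map_add, inertiaDeriv_fderiv, inertiaDeriv_infRot, add_zero]
  have hsum : ∀ h : Fin 3 → ℝ, ∑ k, g k * h k - ∑ k, g k * h (Equiv.swap i j k) =
      (g i - g j) * (h i - h j) := by
    intro h
    fin_cases i <;> fin_cases j <;> simp_all [Fin.sum_univ_three, Equiv.swap_apply_def] <;> ring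
  set a := B.conjConf Γ u with ha
  have haa : V.stiffness a a = V.stiffness u u := V.stiffness_conjConf Γ u u
  have hua : V.stiffness u u - V.stiffness u a = -((g i - g j) * (s.1 i - s.1 j)) := by
    rw [hH u (hker s), hH a (hshear u (hker s)), ← hsum]
    have e : ∀ k, inertiaDeriv B k a = s.1 (Equiv.swap i j k) := fun k =>
      (hswap u (hker s) k).trans (inertiaDeriv_fderiv _ _)
    simp only [e, hu, inertiaDeriv_fderiv]
    ring
  -- Nonnegativity of the stiffness on u - a already excludes the reverse strict order of the two
  -- components.
  have hq : V.stiffness (u - a) (u - a) = -2 * ((g i - g j) * (s.1 i - s.1 j)) := by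
    simp only [map_sub, sub_apply]
    rw [haa, V.stiffness_symm a u]
    linarith
  have hnn := V.stiffness_nonneg (u - a)
  rcases lt_trichotomy (s.1 i) (s.1 j) with h | h | h
  · exact h
  · exfalso
    have h0 : V.stiffness (u - a) (u - a) = 0 := by rw [hq, h]; ring
    -- In case of equality u - a is in the kernel of the stiffness. Testing against the direction of
    -- J_i then forces g i = g j.
    set e := fderiv ℝ S.w 0 (Pi.single i 1, 0) with he
    have h1 := eq_zero_of_posSemidef V.stiffness_symm V.stiffness_nonneg h0 e
    have h2 : V.stiffness a e = V.stiffness u (B.conjConf Γ e) := by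
      rw [← V.stiffness_conjConf Γ a e, ha, B.conjConf_conjConf, hΓ, B.conjConf_one]
    rw [map_sub, sub_apply, h2, hH e (hker _), hH _ (hshear e (hker _))] at h1
    simp only [hswap e (hker _)] at h1
    have h3 := hsum fun k => inertiaDeriv B k e
    simp only [he, inertiaDeriv_fderiv, Pi.single_eq_same, Pi.single_eq_of_ne hij.symm] at h1 h3
    linarith
  · exfalso
    have := mul_pos (sub_pos.2 hg) (sub_pos.2 h)
    rw [hq] at hnn
    linarith

/-- The half-turn that exchanges the first two axes. -/
def flip₀₁ : SO3 := ⟨!![0, 1, 0; 1, 0, 0; 0, 0, -1], by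
  rw [Matrix.mem_specialOrthogonalGroup_iff, Matrix.mem_orthogonalGroup_iff]
  constructor
  · ext i j
    fin_cases i <;> fin_cases j <;> simp [Matrix.mul_apply, Fin.sum_univ_three]
  · simp [Matrix.det_fin_three]⟩

/-- The half-turn that exchanges the last two axes. -/
def flip₁₂ : SO3 := ⟨!![-1, 0, 0; 0, 0, 1; 0, 1, 0], by
  rw [Matrix.mem_specialOrthogonalGroup_iff, Matrix.mem_orthogonalGroup_iff]
  constructor
  · ext i j
    fin_cases i <;> fin_cases j <;> simp [Matrix.mul_apply, Fin.sum_univ_three]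
  · simp [Matrix.det_fin_three]⟩

theorem lt_of_response₀₁ {g : Fin 3 → ℝ} {s : Shape n}
    (hs : ∀ σ : Shape n, hessian (fun s => V.V (S.w s)) 0 s σ = -∑ k, g k * σ.1 k)
    (hg : g 1 < g 0) : s.1 0 < s.1 1 := by
  have hΓ : (flip₀₁ : Matrix (Fin 3) (Fin 3) ℝ) = !![0, 1, 0; 1, 0, 0; 0, 0, -1] := rfl
  refine V.lt_of_response (Γ := flip₀₁) ?_ ?_ ?_ hs hg
  · apply Subtype.ext
    change (flip₀₁ : Matrix (Fin 3) (Fin 3) ℝ) * (flip₀₁ : Matrix (Fin 3) (Fin 3) ℝ) = 1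
    rw [hΓ]
    ext i j
    fin_cases i <;> fin_cases j <;> simp [Matrix.mul_apply, Fin.sum_univ_three]
  · intro u hu
    rw [shear_eq_zero_iff] at hu ⊢
    intro i j hij
    rw [B.strain_conjConf, hΓ]
    fin_cases i <;> fin_cases j <;> simp_all [Fin.sum_univ_three]
  · intro u hu k
    rw [inertiaDeriv_apply, inertiaDeriv_apply]
    simp only [B.strain_conjConf, hΓ]
    fin_cases k <;> simp [Fin.sum_univ_three, Equiv.swap_apply_def] <;> ring

theorem lt_of_response₁₂ {g : Fin 3 → ℝ} {s : Shape n}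
    (hs : ∀ σ : Shape n, hessian (fun s => V.V (S.w s)) 0 s σ = -∑ k, g k * σ.1 k)
    (hg : g 2 < g 1) : s.1 1 < s.1 2 := by
  have hΓ : (flip₁₂ : Matrix (Fin 3) (Fin 3) ℝ) = !![-1, 0, 0; 0, 0, 1; 0, 1, 0] := rfl
  refine V.lt_of_response (Γ := flip₁₂) ?_ ?_ ?_ hs hg
  · apply Subtype.ext
    change (flip₁₂ : Matrix (Fin 3) (Fin 3) ℝ) * (flip₁₂ : Matrix (Fin 3) (Fin 3) ℝ) = 1
    rw [hΓ]
    ext i j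
    fin_cases i <;> fin_cases j <;> simp [Matrix.mul_apply, Fin.sum_univ_three]
  · intro u hu
    rw [shear_eq_zero_iff] at hu ⊢
    intro i j hij
    rw [B.strain_conjConf, hΓ]
    fin_cases i <;> fin_cases j <;> simp_all [Fin.sum_univ_three]
  · intro u hu k
    rw [inertiaDeriv_apply, inertiaDeriv_apply]
    simp only [B.strain_conjConf, hΓ]
    fin_cases k <;> simp [Fin.sum_univ_three, Equiv.swap_apply_def] <;> ring

/-- The elastic potential as a function of the shape. -/
def shapePotential (s : Shape n) : ℝ := V.V (S.w s)

theorem eventually_contDiffAt_shapePotential :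
    ∀ᶠ s in 𝓝 (0 : Shape n), ContDiffAt ℝ ∞ V.shapePotential s := by
  have hw := S.contDiffAt S.zero_mem
  have h1 : Filter.Tendsto S.w (𝓝 0) (𝓝 B.v₀) := by
    have := hw.continuousAt.tendsto
    rwa [S.w_zero] at this
  filter_upwards [h1.eventually V.eventually_contDiffAt, S.isOpen_U.mem_nhds S.zero_mem]
    with s h2 h3
  exact h2.comp s (S.contDiffAt h3)

theorem contDiffAt_shapePotential : ContDiffAt ℝ ∞ V.shapePotential 0 :=
  V.eventually_contDiffAt_shapePotential.self_of_nhds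

theorem fderiv_shapePotential_zero : fderiv ℝ V.shapePotential 0 = 0 := by
  have h : IsLocalMin V.shapePotential 0 := by
    have h1 : Filter.Tendsto S.w (𝓝 0) (𝓝 B.v₀) := by
      have := (S.contDiffAt S.zero_mem).continuousAt.tendsto
      rwa [S.w_zero] at this
    filter_upwards [h1.eventually V.isLocalMin] with s hs
    simpa [shapePotential, S.w_zero] using hs
  exact h.fderiv_eq_zero

theorem hessian_shapePotential_pos (σ : Shape n) (hσ : σ ≠ 0) :
    0 < hessian V.shapePotential 0 σ σ :=
  posDef_of_nondegenerate
    (hessian_symm (V.contDiffAt_shapePotential.of_le (by norm_cast)))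
    (fun u => by
      change 0 ≤ fderiv ℝ (fderiv ℝ fun s => V.V (S.w s)) 0 u u
      rw [V.hessian_section]
      exact V.stiffness_nonneg _) V.nondegenerate σ hσ

end ElasticPotential

end SpinOrbit

end

/-! ### Critical points of potentials with a stiff part -/

noncomputable section

set_option maxSynthPendingDepth 3

namespace SpinOrbit

section StiffPotential

variable {E : Type*} [NormedAddCommGroup E] [NormedSpace ℝ E] [FiniteDimensional ℝ E]

/-- The critical points of a potential `f (R, s) + W s / ε` with a nondegenerate minimum of `W` at
`0` and a nondegenerate critical point `R₀` of `f (·, 0)` form a curve for small `ε`. -/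
theorem exists_curve_of_critical_points {f : ℝ × E → ℝ} {W : E → ℝ} {R₀ : ℝ}
    (hf : ContDiffAt ℝ 2 f (R₀, 0)) (hW : ContDiffAt ℝ 2 W 0)
    (hf₁ : fderiv ℝ f (R₀, 0) (1, 0) = 0) (hf₂ : hessian f (R₀, 0) (1, 0) (1, 0) ≠ 0)
    (hW₁ : fderiv ℝ W 0 = 0) (hW₂ : ∀ σ, σ ≠ 0 → 0 < hessian W 0 σ σ) :
    ∃ (C : ℝ) (ψ : ℝ → ℝ × E) (s₁ : E), 0 < C ∧
      (∀ σ, hessian W 0 s₁ σ = -fderiv ℝ f (R₀, 0) (0, σ)) ∧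
      HasDerivAt (fun ε => (ψ ε).2) s₁ 0 ∧ ψ 0 = (R₀, 0) ∧
      (∀ᶠ ε in 𝓝 (0 : ℝ), ‖ψ ε - (R₀, 0)‖ ≤ C * |ε|) ∧
      ∀ᶠ ε in 𝓝 (0 : ℝ), ∀ z : ℝ × E, ‖z - (R₀, 0)‖ ≤ C * |ε| →
        ((fderiv ℝ f z (1, 0) = 0 ∧ ∀ σ, fderiv ℝ W z.2 σ + ε * fderiv ℝ f z (0, σ) = 0) ↔
          z = ψ ε) := by
  have : CompleteSpace E := FiniteDimensional.complete ℝ E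
  -- The shape equation is multiplied by ε, so that the system stays regular at ε = 0.
  set Ψ : ℝ × (ℝ × E) → ℝ × (E →L[ℝ] ℝ) := fun q => (fderiv ℝ f q.2 (1, 0),
    fderiv ℝ W q.2.2 + q.1 • (fderiv ℝ f q.2).comp (ContinuousLinearMap.inr ℝ ℝ E)) with hΨ
  set z₀ : ℝ × E := (R₀, 0) with hz₀
  have hDf : HasFDerivAt (fderiv ℝ f) (hessian f z₀) z₀ :=
    ((hf.fderiv_right (m := 1) (by norm_num)).differentiableAt (by simp)).hasFDerivAt
  have hDW : HasFDerivAt (fderiv ℝ W) (hessian W 0) 0 :=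
    ((hW.fderiv_right (m := 1) (by norm_num)).differentiableAt (by simp)).hasFDerivAt
  have hΨC : ContDiffAt ℝ 1 Ψ (0, z₀) := by
    have h1 : ContDiffAt ℝ 1 (fun q : ℝ × (ℝ × E) => fderiv ℝ f q.2) (0, z₀) :=
      (hf.fderiv_right (m := 1) (by norm_num)).comp (0, z₀) contDiffAt_snd
    have h2 : ContDiffAt ℝ 1 (fun q : ℝ × (ℝ × E) => fderiv ℝ W q.2.2) (0, z₀) :=
      ContDiffAt.comp (g := fderiv ℝ W) (0, z₀) (hW.fderiv_right (m := 1) (by norm_num))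
        (contDiffAt_snd.snd)
    exact (h1.clm_apply contDiffAt_const).prodMk
      (h2.add (contDiffAt_fst.smul (h1.clm_comp contDiffAt_const)))
  have hΨ₀ : Ψ (0, z₀) = 0 := by
    simp only [hΨ, hf₁, zero_smul, add_zero]
    rw [show z₀.2 = (0 : E) from rfl, hW₁]; rfl
  have hD : HasFDerivAt Ψ (fderiv ℝ Ψ (0, z₀)) (0, z₀) :=
    (hΨC.differentiableAt (by simp)).hasFDerivAt
  have hDΨ : ∀ (e : ℝ) (u : ℝ × E), fderiv ℝ Ψ (0, z₀) (e, u) =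
      (hessian f z₀ u (1, 0), hessian W 0 u.2 +
        e • (fderiv ℝ f z₀).comp (ContinuousLinearMap.inr ℝ ℝ E)) := by
    intro e u
    have h0 : HasFDerivAt (fun q : ℝ × (ℝ × E) => q.2)
        (ContinuousLinearMap.snd ℝ ℝ (ℝ × E)) (0, z₀) := hasFDerivAt_snd
    have h1 : HasFDerivAt (fun q : ℝ × (ℝ × E) => fderiv ℝ f q.2)
        ((hessian f z₀).comp (ContinuousLinearMap.snd ℝ ℝ (ℝ × E))) (0, z₀) :=
      HasFDerivAt.comp (g := fderiv ℝ f) (0, z₀) hDf h0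
    have h2 : HasFDerivAt (fun q : ℝ × (ℝ × E) => fderiv ℝ W q.2.2)
        ((hessian W 0).comp ((ContinuousLinearMap.snd ℝ ℝ E).comp
          (ContinuousLinearMap.snd ℝ ℝ (ℝ × E)))) (0, z₀) :=
      HasFDerivAt.comp (g := fderiv ℝ W) (0, z₀) hDW h0.snd
    have h3 : HasFDerivAt (fun q : ℝ × (ℝ × E) => q.1)
        (ContinuousLinearMap.fst ℝ ℝ (ℝ × E)) (0, z₀) := hasFDerivAt_fst
    have h4 := (h1.clm_apply (hasFDerivAt_const ((1 : ℝ), (0 : E)) (0, z₀))).prodMk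
      (h2.add (h3.smul (h1.clm_comp
        (hasFDerivAt_const (ContinuousLinearMap.inr ℝ ℝ E) (0, z₀)))))
    have h5 := congrArg (fun l : ℝ × (ℝ × E) →L[ℝ] ℝ × (E →L[ℝ] ℝ) => l (e, u)) (hD.unique h4)
    refine h5.trans ?_
    simp [ContinuousLinearMap.prod_apply, add_apply]
  obtain ⟨eW, heW⟩ := exists_equiv_of_posDef hW₂
  -- At ε = 0 the partial derivative is block triangular, with diagonal blocks the second
  -- R-derivative of f and the Hessian of W.
  have hinv : (fderiv ℝ Ψ (0, z₀) ∘L ContinuousLinearMap.inr ℝ ℝ (ℝ × E)).IsInvertible := by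
    set L := fderiv ℝ Ψ (0, z₀) ∘L ContinuousLinearMap.inr ℝ ℝ (ℝ × E) with hL
    have hLu : ∀ u, L u = (hessian f z₀ u (1, 0), hessian W 0 u.2) := by
      intro u
      have : L u = fderiv ℝ Ψ (0, z₀) (0, u) := rfl
      rw [this, hDΨ, zero_smul, add_zero]
    have hinj : Function.Injective (L : (ℝ × E) →ₗ[ℝ] ℝ × (E →L[ℝ] ℝ)) := by
      rw [← LinearMap.ker_eq_bot, LinearMap.ker_eq_bot']
      intro u hu
      have hu' : L u = 0 := hu
      rw [hLu, Prod.mk_eq_zero] at hu'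
      have h2 : u.2 = 0 := by
        by_contra h0
        have := hW₂ u.2 h0
        rw [hu'.2] at this
        simp at this
      have h1 : u = u.1 • ((1 : ℝ), (0 : E)) := by ext <;> simp [h2]
      rw [h1, map_smul, smul_apply, smul_eq_mul] at hu'
      have h3 : u.1 = 0 := (mul_eq_zero.1 hu'.1).resolve_right hf₂
      exact Prod.ext h3 h2
    have hfin : Module.finrank ℝ (ℝ × E) = Module.finrank ℝ (ℝ × (E →L[ℝ] ℝ)) := by
      rw [Module.finrank_prod, Module.finrank_prod, eW.toLinearEquiv.finrank_eq]
    refine ⟨(LinearEquiv.ofInjectiveOfFinrankEq (L : (ℝ × E) →ₗ[ℝ] ℝ × (E →L[ℝ] ℝ)) hinj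
      hfin).toContinuousLinearEquiv, ?_⟩
    ext u <;> rfl
  set ψ := hΨC.implicitFunction one_ne_zero hinv with hψ
  have hψ₀ : ψ 0 = z₀ := hΨC.implicitFunction_apply_self one_ne_zero hinv
  have hψeq : ∀ᶠ ε in 𝓝 (0 : ℝ), Ψ (ε, ψ ε) = 0 := by
    have := hΨC.eventually_apply_implicitFunction one_ne_zero hinv
    rwa [hΨ₀] at this
  have hψiff : ∀ᶠ q in 𝓝 ((0 : ℝ), z₀), Ψ q = 0 ↔ ψ q.1 = q.2 := by
    have := hΨC.eventually_apply_eq_iff_implicitFunction one_ne_zero hinv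
    rwa [hΨ₀] at this
  have hψd : DifferentiableAt ℝ ψ 0 :=
    (hΨC.contDiffAt_implicitFunction one_ne_zero hinv).differentiableAt (by simp)
  have hder := hψd.hasDerivAt
  set u₁ := deriv ψ 0 with hu₁
  -- The second component of the derivative of Ψ (ε, ψ ε) = 0 at ε = 0.
  have hs₁ : hessian W 0 u₁.2 + (fderiv ℝ f z₀).comp (ContinuousLinearMap.inr ℝ ℝ E) = 0 := by
    have h1 : HasDerivAt (fun ε : ℝ => (ε, ψ ε)) (1, u₁) 0 := (hasDerivAt_id (0 : ℝ)).prodMk hder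
    have h2 : HasFDerivAt Ψ (fderiv ℝ Ψ (0, z₀)) ((0 : ℝ), ψ 0) := by rw [hψ₀]; exact hD
    have h3 := h2.comp_hasDerivAt (0 : ℝ) h1
    have h4 := h3.unique ((hasDerivAt_const (0 : ℝ) (0 : ℝ × (E →L[ℝ] ℝ))).congr_of_eventuallyEq
      hψeq)
    rw [hDΨ, one_smul, Prod.mk_eq_zero] at h4
    exact h4.2
  obtain ⟨C, hC, hbound⟩ := hder.isBigO_sub.exists_pos
  rw [Asymptotics.isBigOWith_iff] at hbound
  refine ⟨C, ψ, u₁.2, hC, fun σ => ?_, ?_, hψ₀, ?_, ?_⟩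
  · have := congrArg (fun l : E →L[ℝ] ℝ => l σ) hs₁
    simp only [add_apply, zero_apply] at this
    exact eq_neg_of_add_eq_zero_left this
  · exact (ContinuousLinearMap.snd ℝ ℝ E).hasFDerivAt.comp_hasDerivAt (0 : ℝ) hder
  · filter_upwards [hbound] with ε hε
    simpa [hψ₀] using hε
  -- Uniqueness holds in a fixed ball, and the balls of radius C |ε| lie in it for small ε.
  · obtain ⟨r, hr, hball⟩ := Metric.eventually_nhds_iff.1 hψiff
    have h1 : ∀ᶠ ε in 𝓝 (0 : ℝ), |ε| < r := by
      have : Filter.Tendsto (fun ε : ℝ => |ε|) (𝓝 0) (𝓝 0) := by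
        simpa using (continuous_abs.tendsto (0 : ℝ))
      exact this.eventually (gt_mem_nhds hr)
    have h2 : ∀ᶠ ε in 𝓝 (0 : ℝ), C * |ε| < r := by
      have : Filter.Tendsto (fun ε : ℝ => C * |ε|) (𝓝 0) (𝓝 0) :=
        (by fun_prop : Continuous fun ε : ℝ => C * |ε|).tendsto' 0 0 (by simp)
      exact this.eventually (gt_mem_nhds hr)
    filter_upwards [h1, h2] with ε h1 h2 z hz
    have hd : dist ((ε, z) : ℝ × (ℝ × E)) (0, z₀) < r := by
      rw [Prod.dist_eq, max_lt_iff, dist_eq_norm, dist_eq_norm]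
      exact ⟨by simpa using h1, hz.trans_lt h2⟩
    refine Iff.trans ?_ ((hball hd).trans eq_comm)
    rw [hΨ, Prod.mk_eq_zero]
    refine and_congr Iff.rfl ⟨fun h => ?_, fun h σ => ?_⟩
    · exact ContinuousLinearMap.ext fun σ => h σ
    · exact congrArg (fun l : E →L[ℝ] ℝ => l σ) h

/-- For small `ε`, the Hessian of `f (R, s) + W s / ε` is positive definite near `(R₀, 0)`. -/
theorem eventually_stiff_hessian_pos {f : ℝ × E → ℝ} {W : E → ℝ} {R₀ : ℝ}
    (hf : ContDiffAt ℝ 2 f (R₀, 0)) (hW : ContDiffAt ℝ 2 W 0)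
    (hf₂ : 0 < hessian f (R₀, 0) (1, 0) (1, 0)) (hW₂ : ∀ σ, σ ≠ 0 → 0 < hessian W 0 σ σ) :
    ∃ K : ℝ, ∀ᶠ z in 𝓝 (R₀, (0 : E)), ∀ k ≥ K, ∀ u : ℝ × E, u ≠ 0 →
      0 < hessian f z u u + k * hessian W z.2 u.2 u.2 := by
  set z₀ : ℝ × E := (R₀, 0) with hz₀
  obtain ⟨c, hc, hcW⟩ := exists_lower_bound_of_posDef (ContinuousLinearMap.id ℝ E)
    (b := hessian W 0) (fun u _ hu => hW₂ u hu)
  set a := hessian f z₀ (1, 0) (1, 0) with ha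
  set N := ‖hessian f z₀‖ with hN
  have hN0 : 0 ≤ N := norm_nonneg _
  -- Here N bounds the shape block of the Hessian of f, N² / a completes the square in the mixed
  -- term, 1 is a margin, and c compares the norm with the Hessian of W.
  set K := (N + N ^ 2 / a + 1) / c with hK
  set T : (E →L[ℝ] ℝ) →L[ℝ] (ℝ × E) →L[ℝ] ℝ :=
    (ContinuousLinearMap.compL ℝ (ℝ × E) E ℝ).flip (ContinuousLinearMap.snd ℝ ℝ E) with hT
  set b : ℝ × E → (ℝ × E) →L[ℝ] (ℝ × E) →L[ℝ] ℝ := fun z => hessian f z +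
    K • T.comp ((hessian W z.2).comp (ContinuousLinearMap.snd ℝ ℝ E)) with hb
  have hbu : ∀ z u u', b z u u' = hessian f z u u' + K * hessian W z.2 u.2 u'.2 := fun z u u' => rfl
  have hbc : ContinuousAt b z₀ := by
    have h1 : ContinuousAt (hessian f) z₀ :=
      ((hf.fderiv_right (m := 1) (by norm_num)).fderiv_right (m := 0) (by norm_num)).continuousAt
    have h2 : ContinuousAt (fun z : ℝ × E => hessian W z.2) z₀ :=
      ContinuousAt.comp (g := hessian W)
        ((hW.fderiv_right (m := 1) (by norm_num)).fderiv_right (m := 0) (by norm_num)).continuousAt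
        continuousAt_snd
    have h3 : ContinuousAt (fun z : ℝ × E =>
        (hessian W z.2).comp (ContinuousLinearMap.snd ℝ ℝ E)) z₀ := h2.clm_comp continuousAt_const
    have h4 : ContinuousAt (fun z : ℝ × E =>
        T.comp ((hessian W z.2).comp (ContinuousLinearMap.snd ℝ ℝ E))) z₀ :=
      continuousAt_const.clm_comp h3
    exact h1.add (h4.const_smul K)
  have hpos : ∀ u, u ≠ 0 → 0 < b z₀ u u := by
    rintro ⟨r, σ⟩ hu
    have h0 : ((r, σ) : ℝ × E) = r • ((1 : ℝ), (0 : E)) + (0, σ) := by ext <;> simp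
    have hsy := hessian_symm hf (1, 0) (0, σ)
    have h1 : hessian f z₀ (r, σ) (r, σ) = a * r ^ 2 + 2 * r * hessian f z₀ (1, 0) (0, σ) +
        hessian f z₀ (0, σ) (0, σ) := by
      change fderiv ℝ (fderiv ℝ f) z₀ (1, 0) (0, σ) = fderiv ℝ (fderiv ℝ f) z₀ (0, σ) (1, 0) at hsy
      rw [h0]
      simp only [map_add, map_smul, add_apply, smul_apply, smul_eq_mul, ha, hessian]
      rw [hsy]
      ring
    have hn1 : ‖((1 : ℝ), (0 : E))‖ = 1 := by simp [Prod.norm_def]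
    have hn2 : ‖((0 : ℝ), σ)‖ = ‖σ‖ := by simp [Prod.norm_def]
    have h2 : |hessian f z₀ (1, 0) (0, σ)| ≤ N * ‖σ‖ := by
      have := (hessian f z₀).le_opNorm₂ (1, 0) (0, σ)
      rwa [hn1, hn2, mul_one] at this
    have h3 : |hessian f z₀ (0, σ) (0, σ)| ≤ N * ‖σ‖ * ‖σ‖ := by
      have := (hessian f z₀).le_opNorm₂ (0, σ) (0, σ)
      rwa [hn2] at this
    have h4 := hcW σ rfl
    rw [hbu, h1]
    have hKc : K * c = N + N ^ 2 / a + 1 := by rw [hK]; field_simp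
    have hK0 : 0 < K := by positivity
    have h5 : K * (c * ‖σ‖ ^ 2) ≤ K * hessian W 0 σ σ := mul_le_mul_of_nonneg_left h4 hK0.le
    have h6 : (N + N ^ 2 / a + 1) * ‖σ‖ ^ 2 ≤ K * hessian W 0 σ σ := by
      rw [← hKc]; linarith
    have h7 : -(|r| * (N * ‖σ‖)) ≤ r * hessian f z₀ (1, 0) (0, σ) := by
      have := abs_mul r (hessian f z₀ (1, 0) (0, σ))
      have h8 := neg_abs_le (r * hessian f z₀ (1, 0) (0, σ))
      have h9 := mul_le_mul_of_nonneg_left h2 (abs_nonneg r)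
      linarith
    have h8 := neg_abs_le (hessian f z₀ (0, σ) (0, σ))
    have h9 : a * r ^ 2 - 2 * (|r| * (N * ‖σ‖)) + N ^ 2 / a * ‖σ‖ ^ 2 =
        a * (|r| - N / a * ‖σ‖) ^ 2 := by
      rw [← sq_abs r]; field_simp; ring
    have h10 : 0 ≤ a * (|r| - N / a * ‖σ‖) ^ 2 := by positivity
    have h11 : a * (|r| - N / a * ‖σ‖) ^ 2 + ‖σ‖ ^ 2 ≤ a * r ^ 2 + 2 * r *
        hessian f z₀ (1, 0) (0, σ) + hessian f z₀ (0, σ) (0, σ) + K * hessian W 0 σ σ := by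
      nlinarith
    by_cases hσ : σ = 0
    · have hr : r ≠ 0 := by rintro rfl; exact hu (by rw [hσ]; rfl)
      refine lt_of_lt_of_le ?_ h11
      rw [hσ]
      simp only [norm_zero, mul_zero, sub_zero, sq_abs]
      positivity
    · have : 0 < ‖σ‖ := norm_pos_iff.2 hσ
      exact lt_of_lt_of_le (by positivity) h11
  obtain ⟨d, hd, hd'⟩ := eventually_lower_bound_of_posDef (ContinuousLinearMap.id ℝ (ℝ × E)) hbc
    (fun u _ hu => hpos u hu)
  obtain ⟨c', hc', hWc'⟩ := eventually_lower_bound_of_posDef (ContinuousLinearMap.id ℝ E)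
    (f := hessian W) (y₀ := 0)
    ((hW.fderiv_right (m := 1) (by norm_num)).fderiv_right (m := 0) (by norm_num)).continuousAt
    (fun u _ hu => hW₂ u hu)
  refine ⟨K, ?_⟩
  have hsnd : Filter.Tendsto Prod.snd (𝓝 z₀) (𝓝 (0 : E)) := continuousAt_snd
  filter_upwards [hd', hsnd.eventually hWc'] with z h1 h2 k hk u hu
  have h3 := h1 u rfl
  have h4 := h2 u.2 rfl
  rw [hbu] at h3
  have h5 : 0 < d * ‖u‖ ^ 2 := by have := norm_pos_iff.2 hu; positivity
  have h6 : 0 ≤ (k - K) * hessian W z.2 u.2 u.2 :=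
    mul_nonneg (sub_nonneg.2 hk) (le_trans (by positivity) h4)
  linarith

end StiffPotential

end SpinOrbit

end

/-! ### Decomposition of the effective potential -/

noncomputable section

set_option maxSynthPendingDepth 3

namespace SpinOrbit

variable {B : ElasticBody} {n : ℕ} {S : AdaptedSection B n}

theorem ElasticBody.mass_pos : 0 < B.mass := by
  have h1 : ∫ x, (1 : C(Ball B.radius, ℝ)) x * B.density x ∂(ballVolume B.radius) = B.mass := by
    simp [ElasticBody.mass]
  have h2 : 0 ≤ B.mass := MeasureTheory.integral_nonneg fun x => (B.density_pos x).le
  refine lt_of_le_of_ne h2 fun h => ?_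
  have h3 := B.eq_zero_of_integral_eq_zero (1 : C(Ball B.radius, ℝ)) (fun x => zero_le_one)
    (h1.trans h.symm)
  exact one_ne_zero (α := ℝ) (h3 ⟨0, by simp [B.radius_pos.le]⟩)

/-- The part of the effective potential that depends only on the distance and on the shape, and is
bounded as the body becomes rigid. -/
def softPotential (B : ElasticBody) (μ κ p : ℝ) (z : ℝ × Shape n) : ℝ :=
  p ^ 2 / (2 * (B.mass * z.1 ^ 2 + B.I₀ + z.2.1 2)) - μ * B.mass / z.1 +
    κ * (μ / z.1 ^ 3) * (2 * z.2.1 0 - z.2.1 1 - z.2.1 2)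

/-- The coefficient of the libration term of the effective potential. -/
def tidalCoeff (μ κ : ℝ) (z : ℝ × Shape n) : ℝ := 3 * κ * (μ / z.1 ^ 3) * (z.2.1 1 - z.2.1 0)

/-- Writing cos² = 1 - sin² isolates a libration term that vanishes to second order on χ + β = 0. -/
theorem effectivePotential_eq (V : ElasticPotential S) (μ κ p ε : ℝ) (y : Coord n) :
    effectivePotential S V μ κ p ε y =
      softPotential B μ κ p (y.1, y.2.2.2) + ε⁻¹ * V.shapePotential y.2.2.2 +
        tidalCoeff μ κ (y.1, y.2.2.2) * Real.sin (y.2.1 + y.2.2.1) ^ 2 := by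
  simp only [effectivePotential, softPotential, tidalCoeff, gravity,
    ElasticPotential.shapePotential, Real.cos_sq']
  ring

theorem contDiffAt_softPotential (μ κ p : ℝ) {z : ℝ × Shape n} (h₁ : 0 < z.1)
    (h₂ : 0 < B.I₀ + z.2.1 2) : ContDiffAt ℝ ∞ (softPotential B μ κ p) z := by
  have hm := B.mass_pos
  have hJ : ∀ i : Fin 3, ContDiffAt ℝ ∞ (fun z : ℝ × Shape n => z.2.1 i) z := fun i => by fun_prop
  have h3 : 2 * (B.mass * z.1 ^ 2 + B.I₀ + z.2.1 2) ≠ 0 := by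
    have : 0 < B.mass * z.1 ^ 2 := by positivity
    linarith
  have hq : ContDiffAt ℝ ∞ (fun z : ℝ × Shape n => μ / z.1 ^ 3) z :=
    contDiffAt_const.div (contDiffAt_fst.pow 3) (pow_ne_zero 3 h₁.ne')
  unfold softPotential
  refine ContDiffAt.add (ContDiffAt.sub (ContDiffAt.div contDiffAt_const ?_ h3)
    (contDiffAt_const.div contDiffAt_fst h₁.ne')) ?_
  · exact contDiffAt_const.mul (((contDiffAt_const.mul (contDiffAt_fst.pow 2)).add
      contDiffAt_const).add (hJ 2))
  · exact (contDiffAt_const.mul hq).mul (((contDiffAt_const.mul (hJ 0)).sub (hJ 1)).sub (hJ 2))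

theorem contDiffAt_tidalCoeff (μ κ : ℝ) {z : ℝ × Shape n} (h₁ : 0 < z.1) :
    ContDiffAt ℝ ∞ (tidalCoeff μ κ) z := by
  have hJ : ∀ i : Fin 3, ContDiffAt ℝ ∞ (fun z : ℝ × Shape n => z.2.1 i) z := fun i => by fun_prop
  have hq : ContDiffAt ℝ ∞ (fun z : ℝ × Shape n => μ / z.1 ^ 3) z :=
    contDiffAt_const.div (contDiffAt_fst.pow 3) (pow_ne_zero 3 h₁.ne')
  unfold tidalCoeff
  exact (contDiffAt_const.mul hq).mul ((hJ 1).sub (hJ 0))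

theorem softPotential_zero (μ κ p R : ℝ) :
    softPotential B μ κ p (R, (0 : Shape n)) = orbitalPotential B μ p R := by
  simp [softPotential, orbitalPotential]
  ring

/-- The first and second derivatives of the restriction of a function to a line, expressed by the
derivatives of the function. -/
theorem deriv_deriv_line {E : Type*} [NormedAddCommGroup E] [NormedSpace ℝ E] {f : ℝ × E → ℝ}
    {R₀ : ℝ} (hf : ContDiffAt ℝ 2 f (R₀, 0)) :
    deriv (fun R => f (R, 0)) R₀ = fderiv ℝ f (R₀, 0) (1, 0) ∧
      deriv (deriv fun R => f (R, 0)) R₀ = hessian f (R₀, 0) (1, 0) (1, 0) := by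
  have hl : ∀ R : ℝ, HasDerivAt (fun R : ℝ => (R, (0 : E))) (1, 0) R := fun R =>
    (hasDerivAt_id R).prodMk (hasDerivAt_const R 0)
  have h1 : ∀ᶠ R in 𝓝 R₀, deriv (fun R => f (R, 0)) R = fderiv ℝ f (R, 0) (1, 0) := by
    have hc : ContinuousAt (fun R : ℝ => (R, (0 : E))) R₀ := (hl R₀).continuousAt
    filter_upwards [hc.eventually (hf.eventually (by simp))] with R hR
    exact ((hR.differentiableAt (by simp)).hasFDerivAt.comp_hasDerivAt R (hl R)).deriv
  refine ⟨h1.self_of_nhds, ?_⟩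
  have hD : HasFDerivAt (fderiv ℝ f) (hessian f (R₀, 0)) (R₀, 0) :=
    ((hf.fderiv_right (m := 1) (by norm_num)).differentiableAt (by simp)).hasFDerivAt
  have h2 : HasDerivAt (fun R : ℝ => fderiv ℝ f (R, 0)) (hessian f (R₀, 0) (1, 0)) R₀ :=
    HasFDerivAt.comp_hasDerivAt R₀ (l := fderiv ℝ f) hD (hl R₀)
  have h3 := h2.clm_apply (hasDerivAt_const R₀ ((1 : ℝ), (0 : E)))
  rw [map_zero, add_zero] at h3
  exact (Filter.EventuallyEq.deriv_eq h1).trans h3.deriv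

/-- The tide contributes in the ratio 2 : -1 : -1 and the centrifugal term only along the third
moment; nothing acts along z. These are the coefficients to which the ordering of the response is
applied. -/
theorem fderiv_softPotential_zero (μ κ p : ℝ) {R : ℝ} (hR : 0 < R) (σ : Shape n) :
    fderiv ℝ (softPotential B μ κ p) (R, 0) (0, σ) =
      ∑ k, ![2 * (κ * (μ / R ^ 3)), -(κ * (μ / R ^ 3)),
        -(κ * (μ / R ^ 3)) - p ^ 2 / (2 * (B.mass * R ^ 2 + B.I₀) ^ 2)] k * σ.1 k := by
  have hI := I₀_pos (B := B)
  have hm := B.mass_pos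
  set A := B.mass * R ^ 2 + B.I₀ with hA
  have hA0 : 0 < A := by positivity
  have hf := contDiffAt_softPotential (B := B) μ κ p (z := (R, (0 : Shape n))) hR (by simpa using hI)
  have hl : HasDerivAt (fun t : ℝ => ((R, t • σ) : ℝ × Shape n)) (0, σ) 0 := by
    have := (hasDerivAt_const (0 : ℝ) R).prodMk ((hasDerivAt_id (0 : ℝ)).smul_const σ)
    simpa using this
  have h0 : ((R, (0 : ℝ) • σ) : ℝ × Shape n) = (R, 0) := by rw [zero_smul]
  have h1 := HasFDerivAt.comp_hasDerivAt (0 : ℝ) (l := softPotential B μ κ p)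
    (by rw [h0]; exact (hf.differentiableAt (by simp)).hasFDerivAt) hl
  have h2 : (softPotential B μ κ p ∘ fun t : ℝ => ((R, t • σ) : ℝ × Shape n)) = fun t =>
      p ^ 2 / 2 * (A + t * σ.1 2)⁻¹ - μ * B.mass / R +
        t * (κ * (μ / R ^ 3) * (2 * σ.1 0 - σ.1 1 - σ.1 2)) := by
    funext t
    simp only [softPotential, Function.comp_apply, Prod.smul_fst, Pi.smul_apply, smul_eq_mul, hA]
    rw [div_mul_eq_div_mul_one_div, one_div]
    ring
  rw [h2] at h1
  have h3 : HasDerivAt (fun t : ℝ => A + t * σ.1 2) (σ.1 2) 0 := by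
    simpa using ((hasDerivAt_id (0 : ℝ)).mul_const (σ.1 2)).const_add A
  have h4 := (((h3.inv (by simpa using hA0.ne')).const_mul (p ^ 2 / 2)).sub_const
    (μ * B.mass / R)).add ((hasDerivAt_id (0 : ℝ)).mul_const
      (κ * (μ / R ^ 3) * (2 * σ.1 0 - σ.1 1 - σ.1 2)))
  rw [h1.unique h4]
  simp only [Fin.sum_univ_three, zero_mul, add_zero, Matrix.cons_val]
  rw [mul_comm 2 (A ^ 2), ← div_div]
  ring

/-- For p = 0 only the attraction is left, and its derivative in R never vanishes. -/
theorem angularMomentum_ne_zero {μ p R₀ : ℝ} (hμ : 0 < μ) (hR₀ : 0 < R₀)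
    (hmin : IsLocalMin (orbitalPotential B μ p) R₀) : p ≠ 0 := by
  rintro rfl
  have h1 : orbitalPotential B μ 0 = fun R => -(μ * B.mass / R) := by
    funext R; simp [orbitalPotential]
  have h2 := hmin.deriv_eq_zero
  rw [h1] at h2
  have h3 : HasDerivAt (fun R : ℝ => -(μ * B.mass / R)) (μ * B.mass / R₀ ^ 2) R₀ := by
    have := ((hasDerivAt_inv hR₀.ne').const_mul (μ * B.mass)).neg
    rw [show μ * B.mass / R₀ ^ 2 = -(μ * B.mass * -(R₀ ^ 2)⁻¹) by ring]
    exact this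
  rw [h3.deriv] at h2
  have := B.mass_pos
  have : 0 < μ * B.mass / R₀ ^ 2 := by positivity
  linarith

theorem hessian_softPotential_pos {μ κ p R₀ : ℝ} (hR₀ : 0 < R₀)
    (hmin : IsLocalMin (orbitalPotential B μ p) R₀)
    (hnondeg : deriv (deriv (orbitalPotential B μ p)) R₀ ≠ 0) :
    fderiv ℝ (softPotential B μ κ p) (R₀, (0 : Shape n)) (1, 0) = 0 ∧
      0 < hessian (softPotential B μ κ p) (R₀, (0 : Shape n)) (1, 0) (1, 0) := by
  have hI := I₀_pos (B := B)
  have hf := (contDiffAt_softPotential (B := B) μ κ p (z := (R₀, (0 : Shape n))) hR₀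
    (by simpa using hI)).of_le (show (2 : ℕ∞ω) ≤ ∞ by norm_cast)
  have h1 := deriv_deriv_line hf
  simp only [softPotential_zero] at h1
  refine ⟨h1.1.symm.trans hmin.deriv_eq_zero, ?_⟩
  rw [← h1.2]
  have ho : ContDiffAt ℝ 2 (orbitalPotential B μ p) R₀ := by
    have h2 : ContDiffAt ℝ 2 (fun R : ℝ => softPotential B μ κ p (R, (0 : Shape n))) R₀ :=
      ContDiffAt.comp (g := softPotential B μ κ p) R₀ hf (contDiffAt_id.prodMk contDiffAt_const)
    simpa only [softPotential_zero] using h2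
  have h3 := hessian_nonneg_of_isLocalMin ho hmin 1
  have h4 : fderiv ℝ (fderiv ℝ (orbitalPotential B μ p)) R₀ 1 1 =
      deriv (deriv (orbitalPotential B μ p)) R₀ := by
    have h5 : deriv (orbitalPotential B μ p) = fun R => fderiv ℝ (orbitalPotential B μ p) R 1 := by
      funext R; exact fderiv_apply_one_eq_deriv.symm
    have h6 : HasDerivAt (fderiv ℝ (orbitalPotential B μ p))
        (fderiv ℝ (fderiv ℝ (orbitalPotential B μ p)) R₀ 1) R₀ :=
      ((ho.fderiv_right (m := 1) (by norm_num)).differentiableAt (by simp)).hasFDerivAt.hasDerivAt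
    rw [h5, (h6.clm_apply (hasDerivAt_const R₀ (1 : ℝ))).deriv]
    simp
  rw [h4] at h3
  exact lt_of_le_of_ne h3 hnondeg.symm

end SpinOrbit

end

/-! ### The Hessian with libration, and existence of the resonance -/

noncomputable section

set_option maxSynthPendingDepth 3

namespace SpinOrbit

section Libration

variable {E F : Type*} [NormedAddCommGroup E] [NormedSpace ℝ E] [NormedAddCommGroup F]
  [NormedSpace ℝ F]

theorem hasFDerivAt_libration {Φ T : F → ℝ} (A : E →L[ℝ] F) (l : E →L[ℝ] ℝ) {y : E}
    (hΦ : DifferentiableAt ℝ Φ (A y)) (hT : DifferentiableAt ℝ T (A y)) :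
    HasFDerivAt (fun x => Φ (A x) + T (A x) * Real.sin (l x) ^ 2)
      ((fderiv ℝ Φ (A y)).comp A + (Real.sin (l y) ^ 2 • (fderiv ℝ T (A y)).comp A +
        (T (A y) * (2 * Real.sin (l y) * Real.cos (l y))) • l)) y := by
  have h1 : HasFDerivAt (fun x => Φ (A x)) ((fderiv ℝ Φ (A y)).comp A) y :=
    HasFDerivAt.comp (g := Φ) y hΦ.hasFDerivAt A.hasFDerivAt
  have h2 : HasFDerivAt (fun x => T (A x)) ((fderiv ℝ T (A y)).comp A) y :=
    HasFDerivAt.comp (g := T) y hT.hasFDerivAt A.hasFDerivAt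
  have h3 : HasDerivAt (fun t : ℝ => Real.sin t ^ 2) (2 * Real.sin (l y) * Real.cos (l y)) (l y) := by
    simpa using (Real.hasDerivAt_sin (l y)).fun_pow 2
  have h4 : HasFDerivAt (fun x => Real.sin (l x) ^ 2)
      ((2 * Real.sin (l y) * Real.cos (l y)) • l) y :=
    HasDerivAt.comp_hasFDerivAt (h₂ := fun t : ℝ => Real.sin t ^ 2) y h3 l.hasFDerivAt
  refine (h1.add (h2.mul h4)).congr_fderiv ?_
  rw [smul_smul]
  abel

/-- Where l = 0 the factor sin² vanishes to second order, so no derivative of T survives and there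
is no mixed term between angle and radius or shape. -/
theorem hessian_libration {Φ T : F → ℝ} (A : E →L[ℝ] F) (l : E →L[ℝ] ℝ) {y : E}
    (hΦ : ContDiffAt ℝ 2 Φ (A y)) (hT : ContDiffAt ℝ 2 T (A y)) (hl : l y = 0) (u : E) :
    hessian (fun x => Φ (A x) + T (A x) * Real.sin (l x) ^ 2) y u u =
      hessian Φ (A y) (A u) (A u) + 2 * T (A y) * l u ^ 2 := by
  have hA : HasFDerivAt (fun x => A x) A y := A.hasFDerivAt
  have hL : HasFDerivAt (fun x => l x) l y := l.hasFDerivAt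
  have h1 : fderiv ℝ (fun x => Φ (A x) + T (A x) * Real.sin (l x) ^ 2) =ᶠ[𝓝 y] fun x =>
      (fderiv ℝ Φ (A x)).comp A + (Real.sin (l x) ^ 2 • (fderiv ℝ T (A x)).comp A +
        (T (A x) * (2 * Real.sin (l x) * Real.cos (l x))) • l) := by
    filter_upwards [A.continuous.continuousAt.eventually (hΦ.eventually (by simp)),
      A.continuous.continuousAt.eventually (hT.eventually (by simp))] with x h1 h2
    exact (hasFDerivAt_libration A l (h1.differentiableAt (by simp))
      (h2.differentiableAt (by simp))).fderiv
  have hD : ∀ {Φ : F → ℝ}, ContDiffAt ℝ 2 Φ (A y) → HasFDerivAt (fun x => (fderiv ℝ Φ (A x)).comp A)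
      (((ContinuousLinearMap.compL ℝ E F ℝ).flip A).comp ((hessian Φ (A y)).comp A)) y := by
    intro Φ hΦ
    have h2 : HasFDerivAt (fun x => fderiv ℝ Φ (A x)) ((hessian Φ (A y)).comp A) y :=
      HasFDerivAt.comp (g := fderiv ℝ Φ) y
        ((hΦ.fderiv_right (m := 1) (by norm_num)).differentiableAt (by simp)).hasFDerivAt hA
    exact HasFDerivAt.comp (g := fun g : F →L[ℝ] ℝ => g.comp A) y
      ((ContinuousLinearMap.compL ℝ E F ℝ).flip A).hasFDerivAt h2
  have hs : HasFDerivAt (fun x => Real.sin (l x) ^ 2) ((0 : ℝ) • l) y := by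
    have h3 : HasDerivAt (fun t : ℝ => Real.sin t ^ 2) 0 (l y) := by
      have := (Real.hasDerivAt_sin (l y)).fun_pow 2
      simpa [hl] using this
    exact HasDerivAt.comp_hasFDerivAt (h₂ := fun t : ℝ => Real.sin t ^ 2) y h3 hL
  have hc : HasFDerivAt (fun x => 2 * Real.sin (l x) * Real.cos (l x)) ((2 : ℝ) • l) y := by
    have h3 : HasDerivAt (fun t : ℝ => 2 * Real.sin t * Real.cos t) 2 (l y) := by
      have := ((Real.hasDerivAt_sin (l y)).const_mul 2).fun_mul (Real.hasDerivAt_cos (l y))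
      simpa [hl] using this
    exact HasDerivAt.comp_hasFDerivAt (h₂ := fun t : ℝ => 2 * Real.sin t * Real.cos t) y h3 hL
  have hTA : HasFDerivAt (fun x => T (A x)) ((fderiv ℝ T (A y)).comp A) y :=
    HasFDerivAt.comp (g := T) y (hT.differentiableAt (by simp)).hasFDerivAt hA
  have h2 := (hD hΦ).add ((hs.smul (hD hT)).add ((hTA.mul hc).smul_const l))
  have h3 := congrArg (fun L : E →L[ℝ] E →L[ℝ] ℝ => L u u)
    ((h2.congr_of_eventuallyEq h1).fderiv)
  refine h3.trans ?_
  simp [hl, add_apply]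
  ring

theorem hessian_add_mul_snd {f : ℝ × F → ℝ} {W : F → ℝ} (k : ℝ) {z : ℝ × F}
    (hf : ContDiffAt ℝ 2 f z) (hW : ContDiffAt ℝ 2 W z.2) :
    ContDiffAt ℝ 2 (fun z => f z + k * W z.2) z ∧
    (∀ u, fderiv ℝ (fun z => f z + k * W z.2) z u = fderiv ℝ f z u + k * fderiv ℝ W z.2 u.2) ∧
    ∀ u, hessian (fun z => f z + k * W z.2) z u u =
      hessian f z u u + k * hessian W z.2 u.2 u.2 := by
  have hW' : ContDiffAt ℝ 2 (fun z : ℝ × F => W z.2) z :=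
    ContDiffAt.comp (g := W) z hW contDiffAt_snd
  have h1 : ∀ᶠ x in 𝓝 z, HasFDerivAt (fun z : ℝ × F => f z + k * W z.2)
      (fderiv ℝ f x + k • (fderiv ℝ W x.2).comp (ContinuousLinearMap.snd ℝ ℝ F)) x := by
    filter_upwards [hf.eventually (by simp),
      (continuousAt_snd (p := z)).eventually (hW.eventually (by simp))] with x h1 h2
    have h3 : HasFDerivAt (fun z : ℝ × F => W z.2)
        ((fderiv ℝ W x.2).comp (ContinuousLinearMap.snd ℝ ℝ F)) x :=
      HasFDerivAt.comp (g := W) x (h2.differentiableAt (by simp)).hasFDerivAt hasFDerivAt_snd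
    exact (h1.differentiableAt (by simp)).hasFDerivAt.add (h3.const_mul k)
  refine ⟨hf.add (contDiffAt_const.mul hW'), fun u => ?_, fun u => ?_⟩
  · rw [h1.self_of_nhds.fderiv]; rfl
  · have h2 : fderiv ℝ (fun z : ℝ × F => f z + k * W z.2) =ᶠ[𝓝 z] fun x =>
        fderiv ℝ f x + k • (fderiv ℝ W x.2).comp (ContinuousLinearMap.snd ℝ ℝ F) := by
      filter_upwards [h1] with x hx using hx.fderiv
    have h3 : HasFDerivAt (fderiv ℝ f) (hessian f z) z :=
      ((hf.fderiv_right (m := 1) (by norm_num)).differentiableAt (by simp)).hasFDerivAt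
    have h4 : HasFDerivAt (fun x : ℝ × F => fderiv ℝ W x.2)
        ((hessian W z.2).comp (ContinuousLinearMap.snd ℝ ℝ F)) z :=
      HasFDerivAt.comp (g := fderiv ℝ W) z
        ((hW.fderiv_right (m := 1) (by norm_num)).differentiableAt (by simp)).hasFDerivAt
        hasFDerivAt_snd
    have h5 : HasFDerivAt (fun x : ℝ × F =>
        (fderiv ℝ W x.2).comp (ContinuousLinearMap.snd ℝ ℝ F))
        (((ContinuousLinearMap.compL ℝ (ℝ × F) F ℝ).flip (ContinuousLinearMap.snd ℝ ℝ F)).comp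
          ((hessian W z.2).comp (ContinuousLinearMap.snd ℝ ℝ F))) z :=
      HasFDerivAt.comp (g := fun g : F →L[ℝ] ℝ => g.comp (ContinuousLinearMap.snd ℝ ℝ F)) z
        ((ContinuousLinearMap.compL ℝ (ℝ × F) F ℝ).flip
          (ContinuousLinearMap.snd ℝ ℝ F)).hasFDerivAt h4
    have h6 := congrArg (fun L : ℝ × F →L[ℝ] ℝ × F →L[ℝ] ℝ => L u u)
      (((h3.add (h5.const_smul k)).congr_of_eventuallyEq h2).fderiv)
    refine h6.trans ?_
    rfl

end Libration

variable {B : ElasticBody} {n : ℕ} {S : AdaptedSection B n}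

/-- The projection of the reduced coordinates to `(R, J, z)`. -/
def toRadiusShape (n : ℕ) : Coord n →L[ℝ] ℝ × Shape n :=
  (ContinuousLinearMap.fst ℝ _ _).prod ((ContinuousLinearMap.snd ℝ _ _).comp
    ((ContinuousLinearMap.snd ℝ _ _).comp (ContinuousLinearMap.snd ℝ _ _)))

/-- The libration angle `χ + β`. -/
def toAngle (n : ℕ) : Coord n →L[ℝ] ℝ :=
  (ContinuousLinearMap.fst ℝ _ _).comp (ContinuousLinearMap.snd ℝ _ _) +
    (ContinuousLinearMap.fst ℝ _ _).comp
      ((ContinuousLinearMap.snd ℝ _ _).comp (ContinuousLinearMap.snd ℝ _ _))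

theorem toRadiusShape_apply (y : Coord n) : toRadiusShape n y = (y.1, y.2.2.2) := rfl

theorem toAngle_apply (y : Coord n) : toAngle n y = y.2.1 + y.2.2.1 := rfl

/-- The effective potential in the resonance, as a function of `(R, J, z)`. -/
def radialPotential (V : ElasticPotential S) (μ κ p ε : ℝ) (z : ℝ × Shape n) : ℝ :=
  softPotential B μ κ p z + ε⁻¹ * V.shapePotential z.2

theorem effectivePotential_eq_libration (V : ElasticPotential S) (μ κ p ε : ℝ) :
    effectivePotential S V μ κ p ε = fun y => radialPotential V μ κ p ε (toRadiusShape n y) +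
      tidalCoeff μ κ (toRadiusShape n y) * Real.sin (toAngle n y) ^ 2 := by
  funext y
  rw [effectivePotential_eq]
  rfl

/-- The curve of critical points supplies the resonance, the elastic response its order, and
stiffness with T > 0 the positive Hessian. The property P lets any further condition valid near (R₀,
0) be imposed at the same ε₀. -/
theorem exists_resonance (V : ElasticPotential S) {μ κ p R₀ : ℝ} (hμ : 0 < μ) (hκ : 0 < κ)
    (hR₀ : 0 < R₀) (hmin : IsLocalMin (orbitalPotential B μ p) R₀)
    (hnondeg : deriv (deriv (orbitalPotential B μ p)) R₀ ≠ 0)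
    {P : ℝ × Shape n → Prop} (hP : ∀ᶠ z in 𝓝 (R₀, (0 : Shape n)), P z) :
    ∃ ε₀ > 0, ∃ C > 0, ∀ ε : ℝ, 0 < ε → ε < ε₀ → ∃ (R : ℝ) (s : Shape n),
      IsResonance S V μ κ p ε R₀ (C * ε) R s ∧
      (∀ (R' : ℝ) (s' : Shape n), IsResonance S V μ κ p ε R₀ (C * ε) R' s' → R' = R ∧ s' = s) ∧
      P (R, s) := by
  have hI := I₀_pos (B := B)
  have hm := B.mass_pos
  have hp := angularMomentum_ne_zero hμ hR₀ hmin
  obtain ⟨hf₁, hf₂⟩ := hessian_softPotential_pos (n := n) (κ := κ) hR₀ hmin hnondeg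
  have hsoft : ∀ z : ℝ × Shape n, 0 < z.1 → 0 < B.I₀ + z.2.1 2 →
      ContDiffAt ℝ 2 (softPotential B μ κ p) z := fun z h1 h2 =>
    (contDiffAt_softPotential μ κ p h1 h2).of_le (by norm_cast)
  have hf := hsoft (R₀, 0) hR₀ (by simpa using hI)
  have hW : ContDiffAt ℝ 2 V.shapePotential 0 := V.contDiffAt_shapePotential.of_le (by norm_cast)
  obtain ⟨C, ψ, s₁, hC, hs₁, hψ', hψ₀, hψC, hψiff⟩ := exists_curve_of_critical_points hf hW hf₁
    hf₂.ne' V.fderiv_shapePotential_zero V.hessian_shapePotential_pos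
  obtain ⟨K, hK⟩ := eventually_stiff_hessian_pos hf hW hf₂ V.hessian_shapePotential_pos
  set c := κ * (μ / R₀ ^ 3) with hc
  have hc0 : 0 < c := by positivity
  set d := p ^ 2 / (2 * (B.mass * R₀ ^ 2 + B.I₀) ^ 2) with hd
  have hd0 : 0 < d := by
    have : 0 < p ^ 2 := by positivity
    positivity
  have hs₁' : ∀ σ : Shape n, hessian (fun s => V.V (S.w s)) 0 s₁ σ =
      -∑ k, ![2 * c, -c, -c - d] k * σ.1 k := fun σ => by
    rw [← fderiv_softPotential_zero μ κ p hR₀ σ]; exact hs₁ σ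
  -- The force components satisfy 2 c > -c > -c - d, because c > 0 and d > 0; the latter uses p ≠ 0.
  have h01 : s₁.1 0 < s₁.1 1 := V.lt_of_response₀₁ hs₁' (by simp; linarith)
  have h12 : s₁.1 1 < s₁.1 2 := V.lt_of_response₁₂ hs₁' (by simp; linarith)
  -- the order of the moments of inertia along the curve
  have hord : ∀ i j : Fin 3, s₁.1 i < s₁.1 j →
      ∀ᶠ ε in 𝓝[>] (0 : ℝ), (ψ ε).2.1 i < (ψ ε).2.1 j := by
    intro i j hij
    set pr : Fin 3 → (Fin 3 → ℝ) →L[ℝ] ℝ := fun k => ContinuousLinearMap.proj k with hpr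
    set ℓ : Shape n →L[ℝ] ℝ :=
      (pr j - pr i).comp (ContinuousLinearMap.fst ℝ (Fin 3 → ℝ) (Fin n → ℝ)) with hℓ
    have h1 : HasDerivAt (fun ε => ℓ (ψ ε).2) (ℓ s₁) 0 := ℓ.hasFDerivAt.comp_hasDerivAt (0 : ℝ) hψ'
    have h2 : 0 < ℓ s₁ := sub_pos.2 hij
    have h3 := (hasDerivAt_iff_tendsto_slope.1 h1).eventually (lt_mem_nhds h2)
    have h4 : ∀ᶠ ε in 𝓝[>] (0 : ℝ), 0 < slope (fun ε => ℓ (ψ ε).2) 0 ε :=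
      h3.filter_mono (nhdsWithin_mono _ fun x hx => ne_of_gt hx)
    filter_upwards [h4, self_mem_nhdsWithin] with ε h5 h6
    have h6 : 0 < ε := h6
    rw [slope_def_field, hψ₀] at h5
    simp only [map_zero, sub_zero] at h5
    have h7 : 0 < ℓ (ψ ε).2 := by
      have := mul_pos h5 h6
      rwa [div_mul_cancel₀ _ h6.ne'] at this
    exact sub_pos.1 h7
  -- the neighbourhood of `(R₀, 0)` in which everything is smooth
  have hgood : ∀ᶠ z in 𝓝 (R₀, (0 : Shape n)), 0 < z.1 ∧ z.2 ∈ S.U ∧ 0 < B.I₀ + z.2.1 2 ∧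
      ContDiffAt ℝ 2 V.shapePotential z.2 := by
    have hsnd : Filter.Tendsto Prod.snd (𝓝 (R₀, (0 : Shape n))) (𝓝 0) := continuousAt_snd
    have hJ : ContinuousAt (fun z : ℝ × Shape n => B.I₀ + z.2.1 2) (R₀, 0) := by fun_prop
    filter_upwards [(continuousAt_fst (p := (R₀, (0 : Shape n)))).eventually (lt_mem_nhds hR₀),
      hsnd.eventually (S.isOpen_U.mem_nhds S.zero_mem),
      hJ.eventually (lt_mem_nhds (show (0 : ℝ) < B.I₀ + 0 by linarith)),
      hsnd.eventually V.eventually_contDiffAt_shapePotential] with z h1 h2 h3 h4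
    exact ⟨h1, h2, h3, h4.of_le (by norm_cast)⟩
  -- On χ + β = 0 the libration term has no differential, so criticality is a condition on (R, s)
  -- alone; multiplying its shape part by ε > 0 gives the system solved by the curve.
  have hcrit : ∀ ε : ℝ, 0 < ε → ∀ z : ℝ × Shape n, 0 < z.1 → 0 < B.I₀ + z.2.1 2 →
      ContDiffAt ℝ 2 V.shapePotential z.2 → ∀ y ∈ resonanceManifold z.1 z.2,
      (HasFDerivAt (effectivePotential S V μ κ p ε) (0 : Coord n →L[ℝ] ℝ) y ↔
        fderiv ℝ (softPotential B μ κ p) z (1, 0) = 0 ∧ ∀ σ,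
          fderiv ℝ V.shapePotential z.2 σ + ε * fderiv ℝ (softPotential B μ κ p) z (0, σ) = 0) := by
    rintro ε hε z h1 h2 h3 y ⟨hy1, hy2, hy3⟩
    have hAy : toRadiusShape n y = z := Prod.ext hy1 hy3
    have hly : toAngle n y = 0 := hy2
    obtain ⟨hr1, hr2, -⟩ := hessian_add_mul_snd ε⁻¹ (hsoft z h1 h2) h3
    have h4 := hasFDerivAt_libration (Φ := radialPotential V μ κ p ε) (T := tidalCoeff μ κ)
      (toRadiusShape n) (toAngle n) (y := y) (by rw [hAy]; exact hr1.differentiableAt (by simp))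
      (by rw [hAy]; exact (contDiffAt_tidalCoeff μ κ h1).differentiableAt (by simp))
    rw [← effectivePotential_eq_libration, hAy, hly] at h4
    simp only [Real.sin_zero, ne_eq, OfNat.ofNat_ne_zero, not_false_eq_true, zero_pow, zero_smul,
      mul_zero, zero_mul, add_zero] at h4
    have h5 : ∀ u : Coord n, ((fderiv ℝ (radialPotential V μ κ p ε) z).comp (toRadiusShape n)) u =
        fderiv ℝ (softPotential B μ κ p) z (u.1, u.2.2.2) +
          ε⁻¹ * fderiv ℝ V.shapePotential z.2 u.2.2.2 := fun u => hr2 (u.1, u.2.2.2)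
    have h6 : HasFDerivAt (effectivePotential S V μ κ p ε) (0 : Coord n →L[ℝ] ℝ) y ↔
        ∀ u : Coord n, fderiv ℝ (softPotential B μ κ p) z (u.1, u.2.2.2) +
          ε⁻¹ * fderiv ℝ V.shapePotential z.2 u.2.2.2 = 0 := by
      constructor
      · intro h u
        rw [← h5, ← h.unique h4]; rfl
      · intro h
        refine h4.congr_fderiv (ContinuousLinearMap.ext fun u => ?_)
        rw [h5, h]; rfl
    rw [h6]
    constructor
    · intro h
      refine ⟨by simpa using h (1, 0, 0, 0), fun σ => ?_⟩
      have := h (0, 0, 0, σ)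
      simp only at this
      field_simp at this
      linarith
    · rintro ⟨h7, h8⟩ u
      have h9 : ((u.1, u.2.2.2) : ℝ × Shape n) = u.1 • (1, 0) + (0, u.2.2.2) := by ext <;> simp
      rw [h9, map_add, map_smul, h7, smul_zero, zero_add]
      have := h8 u.2.2.2
      field_simp
      linarith
  have hψc : Filter.Tendsto ψ (𝓝 0) (𝓝 (R₀, 0)) := by
    rw [tendsto_iff_norm_sub_tendsto_zero]
    refine squeeze_zero' (Filter.Eventually.of_forall fun _ => norm_nonneg _) hψC ?_
    exact (by fun_prop : Continuous fun ε : ℝ => C * |ε|).tendsto' 0 0 (by simp)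
  have hwithin : ∀ {q : ℝ → Prop}, (∀ᶠ ε in 𝓝 0, q ε) → ∀ᶠ ε in 𝓝[>] (0 : ℝ), q ε := fun h =>
    h.filter_mono nhdsWithin_le_nhds
  have hgoodball : ∀ᶠ ε in 𝓝 (0 : ℝ), ∀ z : ℝ × Shape n, ‖z - (R₀, 0)‖ ≤ C * |ε| →
      0 < z.1 ∧ z.2 ∈ S.U ∧ 0 < B.I₀ + z.2.1 2 ∧ ContDiffAt ℝ 2 V.shapePotential z.2 := by
    obtain ⟨r, hr, hball⟩ := Metric.eventually_nhds_iff.1 hgood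
    have h2 : ∀ᶠ ε in 𝓝 (0 : ℝ), C * |ε| < r :=
      ((by fun_prop : Continuous fun ε : ℝ => C * |ε|).tendsto' 0 0 (by simp)).eventually
        (gt_mem_nhds hr)
    filter_upwards [h2] with ε h2 z hz
    exact hball ((dist_eq_norm _ _).trans_lt (hz.trans_lt h2))
  have hKε : ∀ᶠ ε in 𝓝[>] (0 : ℝ), K ≤ ε⁻¹ :=
    tendsto_inv_nhdsGT_zero.eventually (Filter.eventually_ge_atTop K)
  have hall := (hord 0 1 h01).and ((hord 1 2 h12).and ((hwithin hψC).and ((hwithin hψiff).and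
    ((hwithin hgoodball).and (hKε.and ((hwithin (hψc.eventually hK)).and
      (hwithin (hψc.eventually hP))))))))
  obtain ⟨ε₀, hε₀, hsub⟩ := mem_nhdsGT_iff_exists_Ioo_subset.1 hall
  refine ⟨ε₀, hε₀, C, hC, fun ε hε hεlt => ?_⟩
  obtain ⟨ho1, ho2, hb, hiff, hg, hk, hposdef, hPψ⟩ := hsub ⟨hε, hεlt⟩
  rw [abs_of_pos hε] at hb hiff hg
  have hnorm : ∀ z : ℝ × Shape n, ‖z - (R₀, 0)‖ ≤ C * ε ↔ ‖z.2‖ ≤ C * ε ∧ |z.1 - R₀| ≤ C * ε := by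
    intro z
    rw [Prod.norm_def, max_le_iff, and_comm]
    simp
  obtain ⟨hg1, hg2, hg3, hg4⟩ := hg _ hb
  refine ⟨(ψ ε).1, (ψ ε).2, ?_, ?_, hPψ⟩
  · refine ⟨hg1, hg2, fun y hy => ?_, fun y hy u hu => ?_, ((hnorm _).1 hb).1, ((hnorm _).1 hb).2,
      ho1, ho2⟩
    · exact (hcrit ε hε (ψ ε) hg1 hg3 hg4 y hy).2 ((hiff _ hb).2 rfl)
    · obtain ⟨hy1, hy2, hy3⟩ := hy
      have hAy : toRadiusShape n y = ψ ε := Prod.ext hy1 hy3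
      obtain ⟨hr1, -, hr3⟩ := hessian_add_mul_snd ε⁻¹ (hsoft (ψ ε) hg1 hg3) hg4
      have h4 := hessian_libration (Φ := radialPotential V μ κ p ε) (T := tidalCoeff μ κ)
        (toRadiusShape n) (toAngle n) (y := y) (by rw [hAy]; exact hr1)
        (by rw [hAy]; exact (contDiffAt_tidalCoeff μ κ hg1).of_le (by norm_cast)) hy2 u
      rw [← effectivePotential_eq_libration, hAy] at h4
      rw [h4]
      have h5 : hessian (radialPotential V μ κ p ε) (ψ ε) (toRadiusShape n u) (toRadiusShape n u) = _ :=
        hr3 (toRadiusShape n u)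
      rw [h5]
      have hT : 0 < tidalCoeff μ κ (ψ ε) := by
        have := sub_pos.2 ho1
        unfold tidalCoeff
        positivity
      -- A direction without radius and shape part is transversal only through the angle, where T >
      -- 0 is needed; every other direction is covered by the stiff Hessian.
      by_cases h6 : toRadiusShape n u = 0
      · have h7 : toAngle n u ≠ 0 := by
          intro h7
          refine hu ⟨u.2.1, ?_⟩
          rw [toRadiusShape_apply, Prod.mk_eq_zero] at h6
          rw [toAngle_apply] at h7
          have h8 : u.2.2.1 = -u.2.1 := by linarith
          rw [← h8]
          exact Prod.ext h6.1 (Prod.ext rfl (Prod.ext rfl h6.2))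
        rw [h6]
        simp only [map_zero, Prod.snd_zero, mul_zero, zero_add]
        positivity
      · have := hposdef ε⁻¹ hk _ h6
        positivity
  -- Uniqueness uses only closeness to (R₀, 0) and criticality at the one point with χ = β = 0.
  · intro R' s' h
    have hz := (hnorm (R', s')).2 ⟨h.shape_small, h.radius_close⟩
    obtain ⟨hz1, hz2, hz3, hz4⟩ := hg _ hz
    have h1 : ((R', 0, 0, s') : Coord n) ∈ resonanceManifold R' s' := ⟨rfl, by simp, rfl⟩
    have h2 := (hiff _ hz).1 ((hcrit ε hε (R', s') hz1 hz3 hz4 _ h1).1 (h.critical _ h1))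
    exact ⟨congrArg Prod.fst h2, congrArg Prod.snd h2⟩

end SpinOrbit

end

/-! ### Routh reduction: the reduced Lagrangian as a mechanical system -/

noncomputable section

set_option maxSynthPendingDepth 3

namespace SpinOrbit

variable {B : ElasticBody} {n : ℕ} (S : AdaptedSection B n)

/-- The kinetic energy of the body relative to its center of mass, as a bilinear form in the
velocities of `(α, β, J, z)`. -/
def bodyMetric (s : Shape n) : BodyCoord n →L[ℝ] BodyCoord n →L[ℝ] ℝ :=
  (((B.massForm.comp (bodyVelocity S s)).flip).comp (bodyVelocity S s)).flip

theorem bodyMetric_apply (s : Shape n) (u u' : BodyCoord n) :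
    bodyMetric S s u u' = B.massForm (bodyVelocity S s u) (bodyVelocity S s u') := rfl

theorem bodyMetric_symm (s : Shape n) (u u' : BodyCoord n) :
    bodyMetric S s u u' = bodyMetric S s u' u := B.massForm_symm _ _

theorem contDiffAt_bodyMetric {s : Shape n} (hs : s ∈ S.U) : ContDiffAt ℝ ∞ (bodyMetric S) s :=
  ContDiffAt.clm_flip (ContDiffAt.clm_comp (ContDiffAt.clm_flip
    (contDiffAt_const.clm_comp (contDiffAt_bodyVelocity S hs))) (contDiffAt_bodyVelocity S hs))

theorem bodyMetric_spin_spin {s : Shape n} (hs : s ∈ S.U) :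
    bodyMetric S s (1, 0, 0) (1, 0, 0) = B.I₀ + s.1 2 := by
  rw [bodyMetric_apply, bodyVelocity_apply]
  simp only [one_smul, zero_smul, map_zero, add_zero]
  exact massForm_spin_spin S hs

theorem bodyMetric_spin_turn (s : Shape n) :
    bodyMetric S s (1, 0, 0) (1, -1, 0) = -B.massForm (B.spin (S.w s)) (B.turn (S.w s)) := by
  rw [bodyMetric_apply, bodyVelocity_apply, bodyVelocity_apply]
  simp only [one_smul, zero_smul, map_zero, add_zero, neg_smul, map_add, map_neg]
  ring

/-- The moment of inertia of the whole system about the vertical axis. -/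
def totalInertia (y : Coord n) : ℝ :=
  B.mass * y.1 ^ 2 + bodyMetric S y.2.2.2 (1, 0, 0) (1, 0, 0)

/-- The projection of the velocities to those of `(α, β, J, z)`. -/
def toBody (n : ℕ) : Coord n →L[ℝ] BodyCoord n := ContinuousLinearMap.snd ℝ _ _

/-- The momentum of the rotation, as a function of the velocities. -/
def spinForm (s : Shape n) : Coord n →L[ℝ] ℝ := (bodyMetric S s (1, 0, 0)).comp (toBody n)

/-- The quadratic part of the reduced Lagrangian. -/
def reducedMetric (y : Coord n) : Coord n →L[ℝ] Coord n →L[ℝ] ℝ :=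
  B.mass • (ContinuousLinearMap.fst ℝ ℝ (BodyCoord n)).smulRight
      (ContinuousLinearMap.fst ℝ ℝ (BodyCoord n)) +
    ((((bodyMetric S y.2.2.2).comp (toBody n)).flip).comp (toBody n)).flip -
    (totalInertia S y)⁻¹ • (spinForm S y.2.2.2).smulRight (spinForm S y.2.2.2)

theorem reducedMetric_apply (y v v' : Coord n) : reducedMetric S y v v' =
    B.mass * (v.1 * v'.1) + bodyMetric S y.2.2.2 v.2 v'.2 - (totalInertia S y)⁻¹ *
      (bodyMetric S y.2.2.2 (1, 0, 0) v.2 * bodyMetric S y.2.2.2 (1, 0, 0) v'.2) := rfl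

/-- The linear part of the reduced Lagrangian. -/
def reducedMomentum (p : ℝ) (y : Coord n) : Coord n →L[ℝ] ℝ :=
  (p * (totalInertia S y)⁻¹) • spinForm S y.2.2.2

theorem reducedMomentum_apply (p : ℝ) (y v : Coord n) : reducedMomentum S p y v =
    p * (totalInertia S y)⁻¹ * bodyMetric S y.2.2.2 (1, 0, 0) v.2 := rfl

theorem reducedMetric_symm (y u u' : Coord n) :
    reducedMetric S y u u' = reducedMetric S y u' u := by
  rw [reducedMetric_apply, reducedMetric_apply, bodyMetric_symm]
  ring

theorem bodyMetric_nonneg (s : Shape n) (u : BodyCoord n) : 0 ≤ bodyMetric S s u u := by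
  rw [bodyMetric_apply]
  by_cases h : bodyVelocity S s u = 0
  · rw [h]; simp
  · exact (B.massForm_pos _ h).le

theorem totalInertia_pos {y : Coord n} (hy : 0 < y.1) : 0 < totalInertia S y := by
  have hm := B.mass_pos
  have h := bodyMetric_nonneg S y.2.2.2 (1, 0, 0)
  unfold totalInertia
  positivity

/-- The reduced metric is the full kinetic form evaluated at the value c of ψ' that makes the
angular momentum zero. It is thus a sum of nonnegative terms, which vanish together only for v = 0.
-/
theorem reducedMetric_pos {y : Coord n} (hy : 0 < y.1)
    (hinj : Function.Injective (bodyVelocity S y.2.2.2)) (v : Coord n) (hv : v ≠ 0) :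
    0 < reducedMetric S y v v := by
  have hm := B.mass_pos
  set s := y.2.2.2 with hs
  have hD := totalInertia_pos S hy
  set D := totalInertia S y with hDd
  set a := bodyMetric S s (1, 0, 0) v.2 with ha
  set c := -a / D with hc
  have hDe : D = B.mass * y.1 ^ 2 + bodyMetric S s (1, 0, 0) (1, 0, 0) := rfl
  have hkey : reducedMetric S y v v = B.mass * v.1 ^ 2 + B.mass * y.1 ^ 2 * c ^ 2 +
      bodyMetric S s (v.2 + c • (1, 0, 0)) (v.2 + c • (1, 0, 0)) := by
    rw [reducedMetric_apply]
    simp only [map_add, map_smul, add_apply, smul_apply, smul_eq_mul]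
    rw [bodyMetric_symm S s v.2 (1, 0, 0), ← hs, ← ha]
    have h1 : bodyMetric S s (1, 0, 0) (1, 0, 0) = D - B.mass * y.1 ^ 2 := by rw [hDe]; ring
    rw [h1, hc, ← hDd]
    field_simp
    ring
  rw [hkey]
  have h0 := bodyMetric_nonneg S s (v.2 + c • (1, 0, 0))
  by_cases h1 : v.1 = 0
  · by_cases h2 : c = 0
    · have h3 : v.2 ≠ 0 := fun h3 => hv (Prod.ext h1 h3)
      have h4 : 0 < bodyMetric S s (v.2 + c • (1, 0, 0)) (v.2 + c • (1, 0, 0)) := by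
        rw [h2, zero_smul, add_zero, bodyMetric_apply]
        exact B.massForm_pos _ fun h => h3 (hinj (h.trans (map_zero _).symm))
      positivity
    · positivity
  · positivity

theorem contDiffAt_shape {y : Coord n} : ContDiffAt ℝ ∞ (fun y : Coord n => y.2.2.2) y :=
  contDiffAt_snd.snd.snd

theorem contDiffAt_bodyMetric_comp {y : Coord n} (hs : y.2.2.2 ∈ S.U) :
    ContDiffAt ℝ ∞ (fun y : Coord n => bodyMetric S y.2.2.2) y :=
  ContDiffAt.comp (g := bodyMetric S) y (contDiffAt_bodyMetric S hs) contDiffAt_shape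

theorem contDiffAt_inv_totalInertia {y : Coord n} (hy : 0 < y.1) (hs : y.2.2.2 ∈ S.U) :
    ContDiffAt ℝ ∞ (fun y => (totalInertia S y)⁻¹) y := by
  refine ContDiffAt.inv ?_ (totalInertia_pos S hy).ne'
  exact (contDiffAt_const.mul (contDiffAt_fst.pow 2)).add
    (((contDiffAt_bodyMetric_comp S hs).clm_apply contDiffAt_const).clm_apply contDiffAt_const)

theorem contDiffAt_spinForm {y : Coord n} (hs : y.2.2.2 ∈ S.U) :
    ContDiffAt ℝ ∞ (fun y : Coord n => spinForm S y.2.2.2) y :=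
  ((contDiffAt_bodyMetric_comp S hs).clm_apply contDiffAt_const).clm_comp contDiffAt_const

theorem contDiffAt_reducedMomentum (p : ℝ) {y : Coord n} (hy : 0 < y.1) (hs : y.2.2.2 ∈ S.U) :
    ContDiffAt ℝ ∞ (reducedMomentum S p) y :=
  (contDiffAt_const.mul (contDiffAt_inv_totalInertia S hy hs)).smul (contDiffAt_spinForm S hs)

theorem contDiffAt_reducedMetric {y : Coord n} (hy : 0 < y.1) (hs : y.2.2.2 ∈ S.U) :
    ContDiffAt ℝ ∞ (reducedMetric S) y := by
  have h1 := contDiffAt_spinForm S hs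
  have h2 : ContDiffAt ℝ ∞ (fun y : Coord n =>
      (spinForm S y.2.2.2).smulRight (spinForm S y.2.2.2)) y :=
    ((ContinuousLinearMap.smulRightL ℝ (Coord n) (Coord n →L[ℝ] ℝ)).contDiff.contDiffAt.comp y
      h1).clm_apply h1
  have h3 : ContDiffAt ℝ ∞ (fun y : Coord n =>
      ((((bodyMetric S y.2.2.2).comp (toBody n)).flip).comp (toBody n)).flip) y :=
    ContDiffAt.clm_flip (ContDiffAt.clm_comp (ContDiffAt.clm_flip
      ((contDiffAt_bodyMetric_comp S hs).clm_comp contDiffAt_const)) contDiffAt_const)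
  exact (contDiffAt_const.add h3).sub ((contDiffAt_inv_totalInertia S hy hs).smul h2)

/-- Eliminating ψ' completes a square: the part quadratic in p joins the potential, the linear part
is the gyroscopic term, and the rest corrects the metric. The denominators agree because the spin
inertia on the section is I₀ + J₂. -/
theorem reducedLagrangian_eq (V : ElasticPotential S) (μ κ p ε : ℝ) {y : Coord n} (hy : 0 < y.1)
    (hs : y.2.2.2 ∈ S.U) (v : Coord n) : reducedLagrangian S V μ κ p ε y v =
      1 / 2 * reducedMetric S y v v + reducedMomentum S p y v -
        effectivePotential S V μ κ p ε y := by
  have hD := totalInertia_pos S hy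
  have hk : ∀ u u', kineticForm S y.2 u u' = bodyMetric S y.2.2.2 u u' := fun u u' =>
    kineticForm_eq S hs u u'
  have hk' : ∀ u u', kineticForm S (y.2 + (0, 0, 0)) u u' = bodyMetric S y.2.2.2 u u' := by
    intro u u'
    rw [show y.2 + ((0, 0, 0) : BodyCoord n) = y.2 from add_zero _, hk]
  have hψ : psiVelocity S p y v =
      (p - bodyMetric S y.2.2.2 (1, 0, 0) v.2) / totalInertia S y := by
    rw [psiVelocity, hk, hk]; rfl
  have hT := bodyMetric_spin_spin S hs
  have hDe : totalInertia S y = B.mass * y.1 ^ 2 + B.I₀ + y.2.2.2.1 2 := by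
    rw [totalInertia, hT]; ring
  rw [reducedLagrangian, lagrangian, kineticEnergy, hk', hψ, reducedMetric_apply,
    reducedMomentum_apply, effectivePotential, ← hDe]
  set c := (p - bodyMetric S y.2.2.2 (1, 0, 0) v.2) / totalInertia S y with hc
  have hv : v.2 + ((c, 0, 0) : BodyCoord n) = v.2 + c • (1, 0, 0) := by
    congr 1
    ext <;> simp
  rw [hv]
  simp only [map_add, map_smul, add_apply, smul_apply, smul_eq_mul]
  rw [bodyMetric_symm S _ v.2 (1, 0, 0)]
  set a := bodyMetric S y.2.2.2 (1, 0, 0) v.2 with ha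
  set D := totalInertia S y with hDd
  have h1 : bodyMetric S y.2.2.2 (1, 0, 0) (1, 0, 0) = D - B.mass * y.1 ^ 2 := by
    rw [hDd, totalInertia]; ring
  rw [h1, hc]
  field_simp
  ring

/-- The dissipative force. -/
def dissipativeForce {S : AdaptedSection B n} (D : Dissipation S) (y v : Coord n) :
    Coord n →L[ℝ] ℝ :=
  (fderiv ℝ (D.F y.2.2.2) v.2.2).comp ((ContinuousLinearMap.snd ℝ _ _).comp (toBody n))

end SpinOrbit

end

/-! ### Dissipation, and the Lagrange equations in terms of the reduced metric -/

noncomputable section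

set_option maxSynthPendingDepth 3

namespace SpinOrbit

variable {B : ElasticBody} {n : ℕ} {S : AdaptedSection B n}

theorem AdaptedSection.isOpen_regular (S : AdaptedSection B n) : IsOpen S.regular := by
  have h : ∀ i : Fin 3, Continuous fun s : Shape n => s.1 i := fun i => by fun_prop
  have he : S.regular = S.U ∩ ({s | s.1 0 ≠ s.1 1} ∩ ({s | s.1 0 ≠ s.1 2} ∩ {s | s.1 1 ≠ s.1 2})) :=
    rfl
  rw [he]
  exact S.isOpen_U.inter ((isOpen_ne_fun (h 0) (h 1)).inter ((isOpen_ne_fun (h 0) (h 2)).inter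
    (isOpen_ne_fun (h 1) (h 2))))

namespace Dissipation

variable (D : Dissipation S)

theorem contDiffAt {s : Shape n} (hs : s ∈ S.regular) (w : ℝ × Shape n) :
    ContDiffAt ℝ ∞ (Function.uncurry D.F) (s, w) :=
  D.smooth.contDiffAt ((S.isOpen_regular.prod isOpen_univ).mem_nhds ⟨hs, trivial⟩)

theorem hasFDerivAt {s : Shape n} (hs : s ∈ S.regular) (w : ℝ × Shape n) :
    HasFDerivAt (D.F s) ((fderiv ℝ (Function.uncurry D.F) (s, w)).comp
      (ContinuousLinearMap.inr ℝ (Shape n) (ℝ × Shape n))) w :=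
  HasFDerivAt.comp (g := Function.uncurry D.F) w
    ((D.contDiffAt hs w).differentiableAt (by simp)).hasFDerivAt (hasFDerivAt_prodMk_right s w)

theorem fderiv_zero {s : Shape n} (hs : s ∈ S.regular) : fderiv ℝ (D.F s) 0 = 0 :=
  (D.isLocalMin s hs).fderiv_eq_zero

theorem contDiffAt_section {s : Shape n} (hs : s ∈ S.regular) (w : ℝ × Shape n) :
    ContDiffAt ℝ ∞ (D.F s) w :=
  ContDiffAt.comp (g := Function.uncurry D.F) w (D.contDiffAt hs w)
    (contDiffAt_const.prodMk contDiffAt_id)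

theorem hessian_pos {s : Shape n} (hs : s ∈ S.regular) (w : ℝ × Shape n) (hw : w ≠ 0) :
    0 < hessian (D.F s) 0 w w := by
  have h := (D.contDiffAt_section hs 0).of_le (show (2 : ℕ∞ω) ≤ ∞ by norm_cast)
  exact posDef_of_nondegenerate (hessian_symm h)
    (hessian_nonneg_of_isLocalMin h (D.isLocalMin s hs)) (D.nondegenerate s hs) w hw

/-- Near velocity zero, the dissipation is positive. -/
theorem eventually_dissipative {s : Shape n} (hs : s ∈ S.regular) :
    ∀ᶠ q : Shape n × (ℝ × Shape n) in 𝓝 (s, 0), q.2 ≠ 0 → 0 < fderiv ℝ (D.F q.1) q.2 q.2 := by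
  set f := Function.uncurry D.F with hf
  -- Here Q retains the velocity directions only, so the growth lemma gives positivity in the
  -- velocities uniformly in nearby shapes.
  set Q : Shape n × (ℝ × Shape n) →L[ℝ] Shape n × (ℝ × Shape n) :=
    (ContinuousLinearMap.inr ℝ (Shape n) (ℝ × Shape n)).comp
      (ContinuousLinearMap.snd ℝ (Shape n) (ℝ × Shape n)) with hQ
  have hfC : ContDiffAt ℝ 2 f (s, 0) := (D.contDiffAt hs 0).of_le (by norm_cast)
  have hpos : ∀ u, Q u = u → u ≠ 0 → 0 < fderiv ℝ (fderiv ℝ f) (s, 0) u u := by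
    rintro ⟨σ, w⟩ hu hu0
    have hσ : σ = 0 := (congrArg Prod.fst hu).symm
    subst hσ
    have hw : w ≠ 0 := by rintro rfl; exact hu0 rfl
    have h1 : fderiv ℝ (D.F s) = fun w => (fderiv ℝ f (s, w)).comp
        (ContinuousLinearMap.inr ℝ (Shape n) (ℝ × Shape n)) :=
      funext fun w => (D.hasFDerivAt hs w).fderiv
    have h2 : HasFDerivAt (fderiv ℝ f) (fderiv ℝ (fderiv ℝ f) (s, 0)) (s, 0) :=
      ((hfC.fderiv_right (m := 1) (by norm_num)).differentiableAt (by simp)).hasFDerivAt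
    have h3 : HasFDerivAt (fun w => fderiv ℝ f (s, w)) ((fderiv ℝ (fderiv ℝ f) (s, 0)).comp
        (ContinuousLinearMap.inr ℝ (Shape n) (ℝ × Shape n))) (0 : ℝ × Shape n) :=
      HasFDerivAt.comp (g := fderiv ℝ f) 0 h2 (hasFDerivAt_prodMk_right s 0)
    have h4 := h3.clm_comp (hasFDerivAt_const
      (ContinuousLinearMap.inr ℝ (Shape n) (ℝ × Shape n)) (0 : ℝ × Shape n))
    have h5 := D.hessian_pos hs w hw
    rw [hessian, h1, h4.fderiv] at h5
    simpa using h5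
  obtain ⟨r, hr, h⟩ := growth_of_hessian_posDef Q hfC hpos
  have hreg : ∀ᶠ q : Shape n × (ℝ × Shape n) in 𝓝 (s, 0), q.1 ∈ S.regular :=
    (continuous_fst.tendsto (s, (0 : ℝ × Shape n))).eventually (S.isOpen_regular.mem_nhds hs)
  filter_upwards [hreg, Metric.ball_mem_nhds _ hr] with q hq hball hq0
  rw [Metric.mem_ball, Prod.dist_eq, max_lt_iff, dist_eq_norm, dist_zero_right] at hball
  have h1 := (D.hasFDerivAt hq 0).fderiv
  have h2 := (h (q.1, 0) (by simpa [Prod.norm_def, hr] using hball.1) (0, q.2) rfl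
    (fun h0 => hq0 (congrArg Prod.snd h0)) (by simpa [Prod.norm_def, hr] using hball.2) (by
      have := congrArg (fun l : ℝ × Shape n →L[ℝ] ℝ => l q.2) h1
      rw [D.fderiv_zero hq] at this
      exact this.symm)).1
  rw [(D.hasFDerivAt hq q.2).fderiv]
  simpa using h2

theorem contDiffAt_dissipativeForce {y : Coord n} (hs : y.2.2.2 ∈ S.regular) (v : Coord n) :
    ContDiffAt ℝ 1 (Function.uncurry (dissipativeForce D)) (y, v) := by
  have hpair : ContDiffAt ℝ 1 (fun x : Coord n × Coord n => (x.1.2.2.2, x.2.2.2)) (y, v) :=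
    (contDiffAt_fst.snd.snd.snd).prodMk contDiffAt_snd.snd.snd
  have h1 : ContDiffAt ℝ 1 (fun x : Coord n × Coord n =>
      fderiv ℝ (Function.uncurry D.F) (x.1.2.2.2, x.2.2.2)) (y, v) :=
    ContDiffAt.comp (g := fderiv ℝ (Function.uncurry D.F)) (y, v)
      ((D.contDiffAt hs v.2.2).fderiv_right (by norm_cast)) hpair
  have h2 : Function.uncurry (dissipativeForce D) =ᶠ[𝓝 (y, v)] fun x =>
      ((fderiv ℝ (Function.uncurry D.F) (x.1.2.2.2, x.2.2.2)).comp
        (ContinuousLinearMap.inr ℝ (Shape n) (ℝ × Shape n))).comp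
          ((ContinuousLinearMap.snd ℝ _ _).comp (toBody n)) := by
    have hc : ContinuousAt (fun x : Coord n × Coord n => x.1.2.2.2) (y, v) := by fun_prop
    filter_upwards [hc.eventually (S.isOpen_regular.mem_nhds hs)] with x hx
    change (fderiv ℝ (D.F x.1.2.2.2) x.2.2.2).comp _ = _
    rw [(D.hasFDerivAt hx x.2.2.2).fderiv]
  exact ((h1.clm_comp contDiffAt_const).clm_comp contDiffAt_const).congr_of_eventuallyEq h2

end Dissipation

section Equations

variable (V : ElasticPotential S) (μ κ p ε : ℝ)

theorem contDiffAt_radialPotential {z : ℝ × Shape n} (h₁ : 0 < z.1) (h₂ : 0 < B.I₀ + z.2.1 2)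
    (h₃ : ContDiffAt ℝ 2 V.shapePotential z.2) :
    ContDiffAt ℝ 2 (radialPotential V μ κ p ε) z :=
  (hessian_add_mul_snd ε⁻¹ ((contDiffAt_softPotential μ κ p h₁ h₂).of_le (by norm_cast)) h₃).1

theorem contDiffAt_effectivePotential {y : Coord n} (h₁ : 0 < y.1) (h₂ : 0 < B.I₀ + y.2.2.2.1 2)
    (h₃ : ContDiffAt ℝ 2 V.shapePotential y.2.2.2) :
    ContDiffAt ℝ 2 (effectivePotential S V μ κ p ε) y := by
  have h4 : ContDiffAt ℝ 2 (fun y => radialPotential V μ κ p ε (toRadiusShape n y)) y :=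
    ContDiffAt.comp (g := radialPotential V μ κ p ε) y
      (contDiffAt_radialPotential V μ κ p ε h₁ h₂ h₃) (toRadiusShape n).contDiff.contDiffAt
  have h5 : ContDiffAt ℝ 2 (fun y => tidalCoeff μ κ (toRadiusShape n y)) y :=
    ContDiffAt.comp (g := tidalCoeff μ κ) y ((contDiffAt_tidalCoeff μ κ h₁).of_le (by norm_cast))
      (toRadiusShape n).contDiff.contDiffAt
  rw [effectivePotential_eq_libration]
  exact h4.add (h5.mul ((Real.contDiff_sin.contDiffAt.comp y (toAngle n).contDiff.contDiffAt).pow 2))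

/-- The derivative of the effective potential in the direction of `χ`. -/
theorem fderiv_effectivePotential_angle {y : Coord n} (h₁ : 0 < y.1)
    (h₂ : 0 < B.I₀ + y.2.2.2.1 2) (h₃ : ContDiffAt ℝ 2 V.shapePotential y.2.2.2) :
    fderiv ℝ (effectivePotential S V μ κ p ε) y (0, 1, 0, 0) =
      tidalCoeff μ κ (y.1, y.2.2.2) *
        (2 * Real.sin (y.2.1 + y.2.2.1) * Real.cos (y.2.1 + y.2.2.1)) := by
  have h4 := hasFDerivAt_libration (Φ := radialPotential V μ κ p ε) (T := tidalCoeff μ κ)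
    (toRadiusShape n) (toAngle n) (y := y)
    ((contDiffAt_radialPotential V μ κ p ε (z := toRadiusShape n y) h₁ h₂ h₃).differentiableAt
      (by simp))
    ((contDiffAt_tidalCoeff μ κ h₁).differentiableAt (by simp))
  rw [← effectivePotential_eq_libration] at h4
  rw [h4.fderiv]
  have h5 : toRadiusShape n ((0, 1, 0, 0) : Coord n) = 0 := rfl
  have h6 : toAngle n ((0, 1, 0, 0) : Coord n) = 1 := by simp [toAngle_apply]
  simp only [add_apply, ContinuousLinearMap.comp_apply, smul_apply, h5, h6, map_zero, mul_zero,
    smul_eq_mul, zero_add, mul_one]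
  rfl

theorem fderiv_reducedLagrangian_velocity {y : Coord n} (hy : 0 < y.1) (hs : y.2.2.2 ∈ S.U)
    (v : Coord n) : fderiv ℝ (fun u => reducedLagrangian S V μ κ p ε y u) v =
      reducedMetric S y v + reducedMomentum S p y := by
  have h1 : (fun u => reducedLagrangian S V μ κ p ε y u) = fun u =>
      1 / 2 * reducedMetric S y u u + reducedMomentum S p y u -
        effectivePotential S V μ κ p ε y := funext (reducedLagrangian_eq S V μ κ p ε hy hs)
  have h2 : HasFDerivAt (fun u => reducedMetric S y u u)
      (reducedMetric S y v + (reducedMetric S y).flip v) v := by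
    have := (reducedMetric S y).hasFDerivAt (x := v) |>.clm_apply (hasFDerivAt_id v)
    refine this.congr_fderiv ?_
    ext <;> simp
  have h3 := ((h2.const_mul (1 / 2)).add (reducedMomentum S p y).hasFDerivAt).sub_const
    (effectivePotential S V μ κ p ε y)
  rw [h1]
  refine h3.fderiv.trans ?_
  refine ContinuousLinearMap.ext fun u => ?_
  simp only [add_apply, smul_apply, ContinuousLinearMap.flip_apply, smul_eq_mul]
  rw [reducedMetric_symm S y u v]
  ring

theorem fderiv_reducedLagrangian_position (D : Dissipation S) {y : Coord n} (hy : 0 < y.1)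
    (hs : y.2.2.2 ∈ S.regular) (h₂ : 0 < B.I₀ + y.2.2.2.1 2)
    (h₃ : ContDiffAt ℝ 2 V.shapePotential y.2.2.2) (v : Coord n) :
    fderiv ℝ (fun x => reducedLagrangian S V μ κ p ε x v) y -
        fderiv ℝ (fun u : Coord n => D.F y.2.2.2 u.2.2) v =
      generalizedForce (reducedMetric S) (reducedMomentum S p) (effectivePotential S V μ κ p ε)
        (dissipativeForce D) y v := by
  have hU : y.2.2.2 ∈ S.U := hs.1
  have h1 : (fun x => reducedLagrangian S V μ κ p ε x v) =ᶠ[𝓝 y] fun x =>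
      1 / 2 * reducedMetric S x v v + reducedMomentum S p x v -
        effectivePotential S V μ κ p ε x := by
    have hc : ContinuousAt (fun y : Coord n => y.2.2.2) y := by fun_prop
    filter_upwards [(continuousAt_fst (p := y)).eventually (lt_mem_nhds hy),
      hc.eventually (S.isOpen_U.mem_nhds hU)] with x hx1 hx2
    exact reducedLagrangian_eq S V μ κ p ε hx1 hx2 v
  have hG : HasFDerivAt (reducedMetric S) (fderiv ℝ (reducedMetric S) y) y :=
    ((contDiffAt_reducedMetric S hy hU).differentiableAt (by simp)).hasFDerivAt
  have hb : HasFDerivAt (reducedMomentum S p) (fderiv ℝ (reducedMomentum S p) y) y :=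
    ((contDiffAt_reducedMomentum S p hy hU).differentiableAt (by simp)).hasFDerivAt
  have hW := ((contDiffAt_effectivePotential V μ κ p ε hy h₂ h₃).differentiableAt
    (by simp)).hasFDerivAt
  have hv : HasFDerivAt (fun _ : Coord n => v) (0 : Coord n →L[ℝ] Coord n) y :=
    hasFDerivAt_const v y
  have h2 := ((((hG.clm_apply hv).clm_apply hv).const_mul (1 / 2)).add (hb.clm_apply hv)).sub hW
  have h3 : HasFDerivAt (fun u : Coord n => D.F y.2.2.2 u.2.2) (dissipativeForce D y v) v := by
    have h4 : HasFDerivAt (D.F y.2.2.2) (fderiv ℝ (D.F y.2.2.2) v.2.2) v.2.2 :=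
      ((D.contDiffAt_section hs v.2.2).differentiableAt (by simp)).hasFDerivAt
    exact HasFDerivAt.comp (g := D.F y.2.2.2) v h4
      ((ContinuousLinearMap.snd ℝ ℝ (ℝ × Shape n)).comp (toBody n)).hasFDerivAt
  rw [(h2.congr_of_eventuallyEq h1).fderiv, h3.fderiv, generalizedForce]
  refine ContinuousLinearMap.ext fun u => ?_
  simp only [add_apply, sub_apply, smul_apply, ContinuousLinearMap.flip_apply,
    ContinuousLinearMap.comp_apply, zero_apply, map_zero, zero_add]

/-- The shapes near which the Lagrange equations are regular. -/
structure IsRegularShape (s : Shape n) : Prop where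
  mem : s ∈ S.U
  smooth : ContDiffAt ℝ 2 V.shapePotential s
  injective : Function.Injective (turnVelocity S s)
  coupling : B.massForm (B.spin (S.w s)) (B.turn (S.w s)) ≠ 0
  inertia_pos : 0 < B.I₀ + s.1 2

theorem eventually_isRegularShape : ∀ᶠ s in 𝓝 (0 : Shape n), IsRegularShape V s := by
  have hJ : ContinuousAt (fun s : Shape n => B.I₀ + s.1 2) 0 := by fun_prop
  filter_upwards [S.isOpen_U.mem_nhds S.zero_mem, V.eventually_contDiffAt_shapePotential,
    eventually_injective_turnVelocity S, eventually_spin_turn_ne_zero S,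
    hJ.eventually (lt_mem_nhds (show (0 : ℝ) < B.I₀ + 0 by linarith [I₀_pos (B := B)]))]
    with s h1 h2 h3 h4 h5
  exact ⟨h1, h2.of_le (by norm_cast), h3, h4, h5⟩

/-- The momentum formula is needed at all times of I and requires only the domain conditions. The
force formula is needed at t alone, so regularity of the shape is assumed only there. -/
theorem equation_iff (D : Dissipation S) {I : Set ℝ} {y v : ℝ → Coord n} {t : ℝ} (ht : t ∈ I)
    (hdom : ∀ τ ∈ I, 0 < (y τ).1 ∧ (y τ).2.2.2 ∈ S.regular)
    (hreg : IsRegularShape V (y t).2.2.2) :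
    HasDerivWithinAt (fun τ => fderiv ℝ (fun u => reducedLagrangian S V μ κ p ε (y τ) u) (v τ))
      (fderiv ℝ (fun x => reducedLagrangian S V μ κ p ε x (v t)) (y t)
        - fderiv ℝ (fun u : Coord n => D.F (y t).2.2.2 u.2.2) (v t)) I t ↔
    HasDerivWithinAt (fun τ => reducedMetric S (y τ) (v τ) + reducedMomentum S p (y τ))
      (generalizedForce (reducedMetric S) (reducedMomentum S p) (effectivePotential S V μ κ p ε)
        (dissipativeForce D) (y t) (v t)) I t := by
  rw [fderiv_reducedLagrangian_position V μ κ p ε D (hdom t ht).1 (hdom t ht).2 hreg.inertia_pos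
    hreg.smooth]
  have h : ∀ τ ∈ I, fderiv ℝ (fun u => reducedLagrangian S V μ κ p ε (y τ) u) (v τ) =
      reducedMetric S (y τ) (v τ) + reducedMomentum S p (y τ) := fun τ hτ =>
    fderiv_reducedLagrangian_velocity V μ κ p ε (hdom τ hτ).1 (hdom τ hτ).2.1 (v τ)
  exact ⟨fun h' => h'.congr (fun τ hτ => (h τ hτ).symm) (h t ht).symm,
    fun h' => h'.congr h (h t ht)⟩

end Equations

end SpinOrbit

end

/-! ### Motions without dissipation -/

noncomputable section

set_option maxSynthPendingDepth 3

section HalfLine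

variable {E F : Type*} [NormedAddCommGroup E] [NormedSpace ℝ E] [NormedAddCommGroup F]
  [NormedSpace ℝ F]

theorem eq_of_hasDerivWithinAt_zero {f f' : ℝ → E}
    (hf : ∀ t, 0 ≤ t → HasDerivWithinAt f (f' t) (Set.Ici 0) t) (h0 : ∀ t, 0 ≤ t → f' t = 0)
    {t : ℝ} (ht : 0 ≤ t) : f t = f 0 := by
  have h := (convex_Ici (0 : ℝ)).norm_image_sub_le_of_norm_hasDerivWithin_le (C := 0)
    (fun x hx => hf x hx) (fun x hx => by rw [h0 x hx]; simp) (Set.mem_Ici.2 le_rfl)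
    (Set.mem_Ici.2 ht)
  rw [zero_mul] at h
  exact sub_eq_zero.1 (norm_le_zero_iff.1 h)

theorem deriv_eq_zero_of_const {f : ℝ → E} {f' : E} {t : ℝ} (ht : 0 ≤ t)
    (hf : HasDerivWithinAt f f' (Set.Ici 0) t) (hc : ∀ τ, 0 ≤ τ → f τ = f 0) : f' = 0 :=
  (uniqueDiffOn_Ici (0 : ℝ) t ht).eq_deriv _ hf
    ((hasDerivWithinAt_const t _ (f 0)).congr (fun τ hτ => hc τ hτ) (hc t ht))

theorem hasDerivWithinAt_clm_comp (L : E →L[ℝ] F) {y : ℝ → E} {v : E} {I : Set ℝ} {t : ℝ}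
    (h : HasDerivWithinAt y v I t) : HasDerivWithinAt (fun t => L (y t)) (L v) I t :=
  L.hasFDerivAt.comp_hasDerivWithinAt t h

/-- No differentiability is required: `fderiv` is 0 where g is not differentiable. -/
theorem fderiv_eq_zero_of_invariant {g : E → F} {y w : E} (h : ∀ t : ℝ, g (y + t • w) = g y) :
    fderiv ℝ g y w = 0 := by
  by_cases hd : DifferentiableAt ℝ g y
  · have h1 : HasDerivAt (fun t : ℝ => y + t • w) w 0 := by
      simpa using ((hasDerivAt_id (0 : ℝ)).smul_const w).const_add y
    have h2 : HasFDerivAt g (fderiv ℝ g y) (y + (0 : ℝ) • w) := by simpa using hd.hasFDerivAt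
    have h3 := HasFDerivAt.comp_hasDerivAt (0 : ℝ) (l := g) h2 h1
    have h4 : (g ∘ fun t : ℝ => y + t • w) = fun _ => g y := funext h
    rw [h4] at h3
    exact h3.unique (hasDerivAt_const _ _)
  · rw [fderiv_zero_of_not_differentiableAt hd]; rfl

end HalfLine

namespace SpinOrbit

variable {B : ElasticBody} {n : ℕ} {S : AdaptedSection B n}

/-- The projection of the positions along the orbits of the symmetry `χ ↦ χ + c`, `β ↦ β - c`. -/
def toNormal (n : ℕ) : Coord n →L[ℝ] Coord n :=
  (ContinuousLinearMap.fst ℝ _ _).prod ((toAngle n).prod ((0 : Coord n →L[ℝ] ℝ).prod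
    ((ContinuousLinearMap.snd ℝ _ _).comp
      ((ContinuousLinearMap.snd ℝ _ _).comp (ContinuousLinearMap.snd ℝ _ _)))))

theorem toNormal_apply (y : Coord n) :
    toNormal n y = (y.1, y.2.1 + y.2.2.1, 0, y.2.2.2) := rfl

/-- The positions near the resonance manifold. -/
structure IsNearResonance (V : ElasticPotential S) (y : Coord n) : Prop where
  radius_pos : 0 < y.1
  regular : y.2.2.2 ∈ S.regular
  shape : IsRegularShape V y.2.2.2
  ordered : y.2.2.2.1 0 < y.2.2.2.1 1
  angle : |y.2.1 + y.2.2.1| < Real.pi / 2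

theorem isNearResonance_toNormal {V : ElasticPotential S} {y : Coord n} :
    IsNearResonance V (toNormal n y) ↔ IsNearResonance V y := by
  have h : (toNormal n y).2.1 + (toNormal n y).2.2.1 = y.2.1 + y.2.2.1 := by
    simp [toNormal_apply]
  constructor <;> rintro ⟨h1, h2, h3, h4, h5⟩ <;> exact ⟨h1, h2, h3, h4, by simpa [h] using h5⟩

/-- A motion near the resonance manifold without dissipation is an equilibrium. -/
theorem stationary_of_no_dissipation (V : ElasticPotential S) {μ κ p ε : ℝ} (hμ : 0 < μ)
    (hκ : 0 < κ) (hp : p ≠ 0) (D : Dissipation S) {y v : ℝ → Coord n}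
    (hnear : ∀ t, 0 ≤ t → IsNearResonance V (y t))
    (hL : ∀ t, 0 ≤ t → LagrangeEquations (reducedMetric S) (reducedMomentum S p)
      (effectivePotential S V μ κ p ε) (dissipativeForce D) (Set.Ici 0) y v t)
    (hv : ∀ t, 0 ≤ t → (v t).2.2 = 0) :
    v 0 = 0 ∧ fderiv ℝ (effectivePotential S V μ κ p ε) (y 0) = 0 := by
  have hy : ∀ t, 0 ≤ t → HasDerivWithinAt y (v t) (Set.Ici 0) t := fun t ht => (hL t ht).1
  set q : Coord n →L[ℝ] ℝ × Shape n :=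
    (ContinuousLinearMap.snd ℝ ℝ (ℝ × Shape n)).comp (toBody n) with hq
  have hs : ∀ t, 0 ≤ t → (y t).2.2 = (y 0).2.2 := fun t ht =>
    eq_of_hasDerivWithinAt_zero (fun t ht => hasDerivWithinAt_clm_comp q (hy t ht)) hv ht
  set s := (y 0).2.2.2 with hs₀
  have hst : ∀ t, 0 ≤ t → (y t).2.2.2 = s := fun t ht => by rw [hs t ht]
  set k := bodyMetric S s with hk
  set k₁ := k (1, 0, 0) (1, 0, 0) with hk₁
  -- The coupling of the spin with the symmetry direction; it is nonzero near v₀.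
  set τ := k (1, 0, 0) (1, -1, 0) with hτ
  have hτ0 : τ ≠ 0 := by
    rw [hτ, hk, bodyMetric_spin_turn]
    exact neg_ne_zero.2 (hnear 0 le_rfl).shape.coupling
  have hv2 : ∀ t, 0 ≤ t → (v t).2 = (v t).2.1 • ((1 : ℝ), (0 : ℝ), (0 : Shape n)) := by
    intro t ht
    refine Prod.ext (by simp) ?_
    rw [hv t ht]
    ext <;> simp
  set J : ℝ → ℝ := fun t => totalInertia S (y t) with hJ
  have hJe : ∀ t, 0 ≤ t → J t = B.mass * (y t).1 ^ 2 + k₁ := by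
    intro t ht
    rw [hJ]; simp only [totalInertia]; rw [hst t ht]
  -- With β', J', z' equal to zero this is χ' + ψ', the absolute angular velocity. All momenta
  -- without radial component turn out to be fixed multiples of it.
  set a : ℝ → ℝ := fun t => (v t).2.1 - (J t)⁻¹ * ((v t).2.1 * k₁) + p * (J t)⁻¹ with ha
  have hmom : ∀ (w : Coord n), w.1 = 0 → ∀ t, 0 ≤ t →
      (reducedMetric S (y t) (v t) + reducedMomentum S p (y t)) w = k (1, 0, 0) w.2 * a t := by
    intro w hw t ht
    rw [add_apply, reducedMetric_apply, reducedMomentum_apply, hst t ht, hv2 t ht, hw]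
    simp only [map_smul, smul_apply, smul_eq_mul, ← hk]
    rw [← hk₁, ha]
    ring
  have hmomd : ∀ (w : Coord n) (t : ℝ), 0 ≤ t → HasDerivWithinAt
      (fun t => (reducedMetric S (y t) (v t) + reducedMomentum S p (y t)) w)
      (generalizedForce (reducedMetric S) (reducedMomentum S p) (effectivePotential S V μ κ p ε)
        (dissipativeForce D) (y t) (v t) w) (Set.Ici 0) t := fun w t ht =>
    hasDerivWithinAt_clm_comp (ContinuousLinearMap.apply ℝ ℝ w) (hL t ht).2.2
  have hF : ∀ t, 0 ≤ t → dissipativeForce D (y t) (v t) = 0 := by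
    intro t ht
    rw [dissipativeForce, hv t ht, D.fderiv_zero (hnear t ht).regular]
    rfl
  -- Metric and gyroscopic term depend on radius and shape only, so along the angles just the
  -- potential exerts a force.
  have hforce : ∀ w : Coord n, toRadiusShape n w = 0 → ∀ t, 0 ≤ t →
      generalizedForce (reducedMetric S) (reducedMomentum S p) (effectivePotential S V μ κ p ε)
        (dissipativeForce D) (y t) (v t) w = -fderiv ℝ (effectivePotential S V μ κ p ε) (y t) w := by
    intro w hw t ht
    rw [toRadiusShape_apply, Prod.mk_eq_zero] at hw
    have h1 : ∀ c : ℝ, (y t + c • w).1 = (y t).1 := fun c => by simp [hw.1]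
    have h2 : ∀ c : ℝ, (y t + c • w).2.2.2 = (y t).2.2.2 := fun c => by simp [hw.2]
    have h3 : ∀ c : ℝ, totalInertia S (y t + c • w) = totalInertia S (y t) := fun c => by
      simp only [totalInertia, h1, h2]
    have h4 : fderiv ℝ (reducedMetric S) (y t) w = 0 := fderiv_eq_zero_of_invariant fun c => by
      simp only [reducedMetric, h2, h3]
    have h5 : fderiv ℝ (reducedMomentum S p) (y t) w = 0 := fderiv_eq_zero_of_invariant fun c => by
      simp only [reducedMomentum, h2, h3]
    rw [generalizedForce, hF t ht]
    simp only [add_apply, sub_apply, smul_apply, ContinuousLinearMap.flip_apply, h4, h5,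
      zero_apply, smul_zero, zero_add, sub_zero, zero_sub]
  -- the angular velocity of the body is constant
  have ha_const : ∀ t, 0 ≤ t → a t = a 0 := by
    have h1 : ∀ t, 0 ≤ t → generalizedForce (reducedMetric S) (reducedMomentum S p)
        (effectivePotential S V μ κ p ε) (dissipativeForce D) (y t) (v t) (0, 1, -1, 0) = 0 := by
      intro t ht
      rw [hforce _ rfl t ht, neg_eq_zero]
      refine fderiv_eq_zero_of_invariant fun c => ?_
      rw [effectivePotential_eq_libration]
      have h2 : toRadiusShape n ((0, 1, -1, 0) : Coord n) = 0 := rfl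
      have h3 : toAngle n ((0, 1, -1, 0) : Coord n) = 0 := by simp [toAngle_apply]
      simp only [map_add, map_smul, h2, h3, smul_zero, add_zero]
    intro t ht
    have h2 := eq_of_hasDerivWithinAt_zero (hmomd (0, 1, -1, 0)) h1 ht
    rw [hmom _ rfl t ht, hmom _ rfl 0 le_rfl] at h2
    exact mul_left_cancel₀ hτ0 h2
  -- The momentum conjugate to χ is a multiple of a, hence constant, so the tidal torque vanishes;
  -- with |χ + β| < π / 2 this leaves only χ + β = 0.
  have hangle : ∀ t, 0 ≤ t → toAngle n (y t) = 0 := by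
    intro t ht
    have hn := hnear t ht
    have h1 := deriv_eq_zero_of_const ht (hmomd (0, 1, 0, 0) t ht) fun t ht => by
      rw [hmom _ rfl t ht, hmom _ rfl 0 le_rfl, ha_const t ht]
    rw [hforce _ rfl t ht, fderiv_effectivePotential_angle V μ κ p ε hn.radius_pos
      hn.shape.inertia_pos hn.shape.smooth, neg_eq_zero] at h1
    have hT : 0 < tidalCoeff μ κ ((y t).1, (y t).2.2.2) := by
      have h2 := sub_pos.2 hn.ordered
      have h3 := hn.radius_pos
      unfold tidalCoeff
      positivity
    obtain ⟨hl, hr⟩ := abs_lt.1 hn.angle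
    have hcos := Real.cos_pos_of_mem_Ioo ⟨hl, hr⟩
    have hsin : Real.sin ((y t).2.1 + (y t).2.2.1) = 0 := by
      rcases mul_eq_zero.1 h1 with h | h
      · exact absurd h hT.ne'
      · rcases mul_eq_zero.1 h with h | h
        · simpa using h
        · exact absurd h hcos.ne'
    have hpi := Real.pi_pos
    rw [toAngle_apply]
    exact (Real.sin_eq_zero_iff_of_lt_of_lt (by linarith) (by linarith)).1 hsin
  have hχ : ∀ t, 0 ≤ t → (v t).2.1 = 0 := by
    intro t ht
    have h1 := deriv_eq_zero_of_const ht (hasDerivWithinAt_clm_comp (toAngle n) (hy t ht))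
      fun t ht => by rw [hangle t ht, hangle 0 le_rfl]
    rw [toAngle_apply, hv t ht] at h1
    simpa using h1
  have hm := B.mass_pos
  -- With χ' = 0 the constant a is p divided by the total inertia, which is injective in R > 0 for
  -- fixed shape.
  have hR : ∀ t, 0 ≤ t → (y t).1 = (y 0).1 := by
    intro t ht
    have h1 := ha_const t ht
    simp only [ha, hχ t ht, hχ 0 le_rfl, zero_mul, mul_zero, sub_zero, zero_add] at h1
    have h2 := inv_injective (mul_left_cancel₀ hp h1)
    rw [hJe t ht, hJe 0 le_rfl] at h2
    have h3 : (y t).1 ^ 2 = (y 0).1 ^ 2 := mul_left_cancel₀ hm.ne' (by linarith)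
    exact (pow_left_inj₀ (hnear t ht).radius_pos.le (hnear 0 le_rfl).radius_pos.le two_ne_zero).1 h3
  have hv0 : ∀ t, 0 ≤ t → v t = 0 := by
    intro t ht
    have h1 : (v t).1 = 0 := deriv_eq_zero_of_const ht
      (hasDerivWithinAt_clm_comp (ContinuousLinearMap.fst ℝ ℝ (BodyCoord n)) (hy t ht)) hR
    exact Prod.ext h1 (Prod.ext (hχ t ht) (hv t ht))
  refine ⟨hv0 0 le_rfl, ?_⟩
  have hconst : ∀ t, 0 ≤ t → y t = y 0 := fun t ht => eq_of_hasDerivWithinAt_zero hy hv0 ht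
  have h1 := deriv_eq_zero_of_const le_rfl (hL 0 le_rfl).2.2 fun t ht => by
    rw [hconst t ht, hv0 t ht, hv0 0 le_rfl]
  rw [generalizedForce, hF 0 le_rfl, hv0 0 le_rfl] at h1
  simpa using h1

end SpinOrbit

end

/-! ### Asymptotic stability of the resonance manifold -/

noncomputable section

set_option maxSynthPendingDepth 3

namespace SpinOrbit

variable {B : ElasticBody} {n : ℕ} {S : AdaptedSection B n}

theorem toNormal_toNormal (y : Coord n) : toNormal n (toNormal n y) = toNormal n y := by
  simp [toNormal_apply]

/-- The point of the resonance manifold with `χ = β = 0`. -/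
def basePoint (R : ℝ) (s : Shape n) : Coord n := (R, 0, 0, s)

theorem toNormal_basePoint (R : ℝ) (s : Shape n) : toNormal n (basePoint R s) = basePoint R s := by
  simp [toNormal_apply, basePoint]

theorem mem_resonanceManifold_iff {R : ℝ} {s : Shape n} {y : Coord n} :
    y ∈ resonanceManifold R s ↔ toNormal n y = basePoint R s := by
  simp [resonanceManifold, toNormal_apply, basePoint, Prod.ext_iff]

/-- The point y - Q y + y₀, with Q = `toNormal` and y₀ = `basePoint`, lies on the manifold and
differs from y by Q y - y₀. -/
theorem infDist_le {R : ℝ} {s : Shape n} {y v : Coord n} {η : ℝ}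
    (hy : ‖toNormal n y - basePoint R s‖ < η) (hv : ‖v‖ < η) :
    Metric.infDist (y, v) (resonanceManifold R s ×ˢ {0}) < η := by
  have hmem : ((y - toNormal n y + basePoint R s, 0) : Coord n × Coord n) ∈
      resonanceManifold R s ×ˢ ({0} : Set (Coord n)) := by
    refine ⟨mem_resonanceManifold_iff.2 ?_, rfl⟩
    rw [map_add, map_sub, toNormal_toNormal, sub_self, zero_add, toNormal_basePoint]
  refine (Metric.infDist_le_dist_of_mem hmem).trans_lt ?_
  rw [Prod.dist_eq, max_lt_iff, dist_eq_norm, dist_zero_right]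
  refine ⟨?_, hv⟩
  rwa [show y - (y - toNormal n y + basePoint R s) = toNormal n y - basePoint R s by abel]

/-- Every point of the manifold is projected to the base point, so the operator norm controls the
normal distance. The added 1 makes the bounds strict and covers the velocity. -/
theorem norm_lt_of_infDist_lt {R : ℝ} {s : Shape n} {y v : Coord n} {δ : ℝ}
    (h : Metric.infDist (y, v) (resonanceManifold R s ×ˢ {0}) < δ) :
    ‖toNormal n y - basePoint R s‖ < (‖toNormal n‖ + 1) * δ ∧ ‖v‖ < (‖toNormal n‖ + 1) * δ := by
  have hne : (resonanceManifold R s ×ˢ ({0} : Set (Coord n))).Nonempty :=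
    ⟨(basePoint R s, 0), mem_resonanceManifold_iff.2 (toNormal_basePoint R s), rfl⟩
  obtain ⟨⟨m, c⟩, ⟨hm, hc⟩, hd⟩ := (Metric.infDist_lt_iff hne).1 h
  have hc : c = 0 := hc
  subst hc
  rw [Prod.dist_eq, max_lt_iff, dist_eq_norm, dist_zero_right] at hd
  have hδ : 0 < δ := (norm_nonneg _).trans_lt hd.1
  have hQ := norm_nonneg (toNormal n)
  constructor
  · rw [← mem_resonanceManifold_iff.1 hm, ← map_sub]
    have h1 := (toNormal n).le_opNorm (y - m)
    have h2 : ‖toNormal n‖ * ‖y - m‖ ≤ ‖toNormal n‖ * δ := mul_le_mul_of_nonneg_left hd.1.le hQ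
    nlinarith
  · have := hd.2
    simp only at this
    nlinarith [mul_nonneg hQ hδ.le]

theorem isSolution_iff (V : ElasticPotential S) (μ κ p ε : ℝ) (D : Dissipation S) {I : Set ℝ}
    {y v : ℝ → Coord n} (hnear : ∀ t ∈ I, IsNearResonance V (y t)) :
    IsSolution S V μ κ p ε D I y v ↔ ∀ t ∈ I, LagrangeEquations (reducedMetric S)
      (reducedMomentum S p) (effectivePotential S V μ κ p ε) (dissipativeForce D) I y v t := by
  have hdom : ∀ τ ∈ I, 0 < (y τ).1 ∧ (y τ).2.2.2 ∈ S.regular := fun τ hτ =>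
    ⟨(hnear τ hτ).radius_pos, (hnear τ hτ).regular⟩
  constructor
  · intro h t ht
    exact ⟨h.hasDeriv t ht, h.differentiable t ht,
      (equation_iff V μ κ p ε D ht hdom (hnear t ht).shape).1 (h.equation t ht)⟩
  · intro h
    exact ⟨hdom, fun t ht => (h t ht).1, fun t ht => (h t ht).2.1,
      fun t ht => (equation_iff V μ κ p ε D ht hdom (hnear t ht).shape).2 (h t ht).2.2⟩

/-- Nearness is required only at the time t, because the domain conditions come with the solution.
Stability needs this form, as it is not yet known that the trajectory stays near. -/
theorem IsSolution.lagrangeEquations {V : ElasticPotential S} {μ κ p ε : ℝ} {D : Dissipation S}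
    {I : Set ℝ} {y v : ℝ → Coord n} (h : IsSolution S V μ κ p ε D I y v) {t : ℝ} (ht : t ∈ I)
    (hnear : IsNearResonance V (y t)) : LagrangeEquations (reducedMetric S)
      (reducedMomentum S p) (effectivePotential S V μ κ p ε) (dissipativeForce D) I y v t :=
  ⟨h.hasDeriv t ht, h.differentiable t ht,
    (equation_iff V μ κ p ε D ht h.mem_domain hnear.shape).1 (h.equation t ht)⟩

/-- The criterion `asymptoticStability_of_dissipation` applies with Q = `toNormal`, whose kernel is
the tangent direction of the manifold. A motion without dissipation must then be at the base point
modulo Q. -/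
theorem asymptoticallyStable_resonanceManifold (V : ElasticPotential S) {μ κ p ε R₀ δ R : ℝ}
    {s : Shape n} (hμ : 0 < μ) (hκ : 0 < κ) (hp : p ≠ 0)
    (hres : IsResonance S V μ κ p ε R₀ δ R s) (hs : ∀ᶠ s' in 𝓝 s, IsRegularShape V s')
    (D : Dissipation S) :
    AsymptoticallyStable S V μ κ p ε D (resonanceManifold R s) := by
  set Q := toNormal n with hQ
  set y₀ : Coord n := basePoint R s with hy₀
  set W := effectivePotential S V μ κ p ε with hWdef
  have hmem : y₀ ∈ resonanceManifold R s := mem_resonanceManifold_iff.2 (toNormal_basePoint R s)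
  have hs0 := hs.self_of_nhds
  have hreg : s ∈ S.regular := ⟨hres.mem, hres.ordered.1.ne,
    (hres.ordered.1.trans hres.ordered.2).ne, hres.ordered.2.ne⟩
  have hshape : ContinuousAt (fun y : Coord n => y.2.2.2) y₀ := by fun_prop
  have hnear : ∀ᶠ y in 𝓝 y₀, IsNearResonance V y := by
    have hJ : ∀ i : Fin 3, Continuous fun s : Shape n => s.1 i := fun i => by fun_prop
    have hang : ContinuousAt (fun y : Coord n => |y.2.1 + y.2.2.1|) y₀ := by fun_prop
    filter_upwards [(continuousAt_fst (p := y₀)).eventually (lt_mem_nhds hres.pos),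
      hshape.eventually (S.isOpen_regular.mem_nhds hreg), hshape.eventually hs,
      hshape.eventually ((isOpen_lt (hJ 0) (hJ 1)).mem_nhds hres.ordered.1),
      hang.eventually (gt_mem_nhds (show |(0 : ℝ) + 0| < Real.pi / 2 by
        simp [Real.pi_pos]))] with y h1 h2 h3 h4 h5
    exact ⟨h1, h2, h3, h4, h5⟩
  have hW : ContDiffAt ℝ 2 W y₀ :=
    contDiffAt_effectivePotential V μ κ p ε hres.pos hs0.inertia_pos hs0.smooth
  have hWcrit : fderiv ℝ W y₀ = 0 := (hres.critical y₀ hmem).fderiv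
  have hWQ : ∀ y, W (Q y) = W y := by
    intro y
    rw [hWdef, effectivePotential_eq_libration]
    have h1 : toRadiusShape n (Q y) = toRadiusShape n y := rfl
    have h2 : toAngle n (Q y) = toAngle n y := by simp [hQ, toAngle_apply, toNormal_apply]
    simp only [h1, h2]
  -- A tangent vector (0, c, -c, 0) is annihilated by Q, so a nonzero fixed vector of Q is
  -- transversal to the manifold.
  have hWpos : ∀ u, Q u = u → u ≠ 0 → 0 < fderiv ℝ (fderiv ℝ W) y₀ u u := by
    intro u hu hu0
    refine hres.transversal_min y₀ hmem u ?_
    rintro ⟨c, rfl⟩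
    refine hu0 (hu.symm.trans ?_)
    simp [hQ, toNormal_apply]
  obtain ⟨r₁, hr₁, hgrowth⟩ := growth_of_hessian_posDef Q hW hWpos
  have hgrowth₀ : ∀ y, ‖Q y - y₀‖ < r₁ → Q y ≠ y₀ →
      0 < fderiv ℝ W (Q y) (Q y - y₀) ∧ W y₀ < W (Q y) := by
    intro y hy hne
    have h1 := hgrowth y₀ (by simpa using hr₁) (Q y - y₀)
      (by rw [map_sub, hQ, toNormal_toNormal, hy₀, toNormal_basePoint]) (sub_ne_zero.2 hne) hy
      (by rw [hWcrit]; rfl)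
    rwa [add_sub_cancel] at h1
  have hQ₀ : Q y₀ = y₀ := toNormal_basePoint R s
  have hQc : Filter.Tendsto Q (𝓝 y₀) (𝓝 y₀) := by
    have := Q.continuous.tendsto y₀
    rwa [hQ₀] at this
  have hWmin : ∀ᶠ y in 𝓝 y₀, Q y ≠ y₀ → W y₀ < W y := by
    filter_upwards [hQc.eventually (Metric.ball_mem_nhds y₀ hr₁)] with y hy hne
    rw [← hWQ y]
    exact (hgrowth₀ y ((dist_eq_norm _ _).symm.trans_lt hy) hne).2
  have hdiss : ∀ᶠ x : Coord n × Coord n in 𝓝 (y₀, 0), x.2.2.2 ≠ 0 →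
      0 < dissipativeForce D x.1 x.2 x.2 := by
    have hc : Filter.Tendsto (fun x : Coord n × Coord n => (x.1.2.2.2, x.2.2.2)) (𝓝 (y₀, 0))
        (𝓝 (s, 0)) := Continuous.tendsto (by fun_prop) _
    exact hc.eventually (D.eventually_dissipative hreg)
  have hdiss' : ∀ᶠ x : Coord n × Coord n in 𝓝 (y₀, 0), 0 ≤ dissipativeForce D x.1 x.2 x.2 := by
    filter_upwards [hdiss] with x hx
    by_cases h0 : x.2.2.2 = 0
    · change 0 ≤ fderiv ℝ (D.F x.1.2.2.2) x.2.2.2 x.2.2.2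
      rw [h0, map_zero]
    · exact (hx h0).le
  obtain ⟨r₂, hr₂, hnear'⟩ := Metric.eventually_nhds_iff.1 hnear
  obtain ⟨r₃, hr₃, hdiss₃⟩ := Metric.eventually_nhds_iff.1 hdiss
  set ρ := min r₁ (min r₂ r₃) with hρ
  have hρ0 : 0 < ρ := lt_min hr₁ (lt_min hr₂ hr₃)
  have hnearρ : ∀ y, ‖Q y - y₀‖ < ρ → IsNearResonance V y := fun y hy =>
    isNearResonance_toNormal.1 (hnear' ((dist_eq_norm _ _).trans_lt
      (hy.trans_le ((min_le_right _ _).trans (min_le_left _ _)))))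
  have hFQ : ∀ y v, dissipativeForce D (Q y) v = dissipativeForce D y v := fun y v => rfl
  have hdissρ : ∀ y v, ‖Q y - y₀‖ < ρ → ‖v‖ < ρ → v.2.2 ≠ 0 → 0 < dissipativeForce D y v v := by
    intro y v hy hv
    have hd : dist (Q y, v) (y₀, 0) < r₃ := by
      have h3 : ρ ≤ r₃ := (min_le_right _ _).trans (min_le_right _ _)
      rw [Prod.dist_eq, max_lt_iff, dist_eq_norm, dist_zero_right]
      exact ⟨hy.trans_le h3, hv.trans_le h3⟩
    exact hdiss₃ hd
  obtain ⟨r, hr, hrρ, hstable, hglobal, hattr⟩ := asymptoticStability_of_dissipation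
    (G := reducedMetric S) (b := reducedMomentum S p) (W := W) (F := dissipativeForce D)
    (Q := Q) (y₀ := y₀) (ρ := ρ) toNormal_toNormal hQ₀ (fun y => rfl) (fun y => rfl) hWQ hFQ
    ((contDiffAt_reducedMetric S hres.pos hres.mem).of_le (by norm_cast))
    ((contDiffAt_reducedMomentum S p hres.pos hres.mem).of_le (by norm_cast)) hW
    (D.contDiffAt_dissipativeForce hreg 0)
    (Filter.Eventually.of_forall fun y u u' => reducedMetric_symm S y u u')
    (reducedMetric_pos S hres.pos (injective_bodyVelocity S hres.mem hs0.injective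
      hres.ordered.1.ne)) hWmin hdiss' hρ0 (by
      intro y v hyv hL hF0
      have hv : ∀ t, 0 ≤ t → (v t).2.2 = 0 := fun t ht => by
        by_contra hne
        exact (hdissρ (y t) (v t) (hyv t ht).1 (hyv t ht).2 hne).ne' (hF0 t ht)
      obtain ⟨hv0, hcrit⟩ := stationary_of_no_dissipation V hμ hκ hp D
        (fun t ht => hnearρ _ (hyv t ht).1) hL hv
      -- The motion rests at a critical point, whereas the potential increases radially at every
      -- other point of the slice near y₀.
      refine ⟨?_, hv0⟩
      by_contra hne
      have h1 := (hgrowth₀ (y 0) ((hyv 0 le_rfl).1.trans_le (min_le_left _ _)) hne).1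
      rw [(fderiv_of_projection_invariant toNormal_toNormal hWQ (y 0)).1, hcrit] at h1
      exact lt_irrefl _ h1)
  set L := ‖Q‖ + 1 with hL
  have hL0 : 0 < L := by positivity
  have hdiv : ∀ {δ : ℝ} {a c : Coord n},
      Metric.infDist (a, c) (resonanceManifold R s ×ˢ {0}) < δ / L →
      ‖Q a - y₀‖ < δ ∧ ‖c‖ < δ := by
    intro δ a c h
    have := norm_lt_of_infDist_lt h
    rwa [mul_div_cancel₀ _ hL0.ne'] at this
  refine ⟨fun η hη => ?_, ?_, ?_⟩
  · obtain ⟨δ, hδ, h⟩ := hstable η hη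
    refine ⟨δ / L, div_pos hδ hL0, fun T y v hsol h0 t ht => ?_⟩
    obtain ⟨h1, h2⟩ := hdiv h0
    obtain ⟨h3, h4⟩ := h T y v (fun t ht => (hsol.hasDeriv t ht).continuousWithinAt)
      (fun t ht => (hsol.differentiable t ht).continuousWithinAt)
      (fun t ht h5 _ => hsol.lagrangeEquations ht (hnearρ _ (h5.trans_le hrρ))) h1 h2 t ht
    exact infDist_le h3 h4
  · obtain ⟨δ, hδ, h⟩ := hglobal
    refine ⟨δ / L, div_pos hδ hL0, fun a c h0 => ?_⟩
    obtain ⟨h1, h2⟩ := hdiv h0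
    obtain ⟨y, v, hy0, hv0, h3⟩ := h a c h1 h2
    refine ⟨y, v, hy0, hv0, (isSolution_iff V μ κ p ε D fun t ht =>
      hnearρ _ ((h3 t ht).1.trans_le hrρ)).2 fun t ht => (h3 t ht).2⟩
  · obtain ⟨δ, hδ, h⟩ := hattr
    refine ⟨δ / L, div_pos hδ hL0, fun y v hsol h0 => ?_⟩
    obtain ⟨h1, h2⟩ := hdiv h0
    obtain ⟨h3, h4⟩ := h y v (fun t ht => (hsol.hasDeriv t ht).continuousWithinAt)
      (fun t ht => (hsol.differentiable t ht).continuousWithinAt)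
      (fun t ht h5 _ => hsol.lagrangeEquations ht (hnearρ _ (h5.trans_le hrρ))) h1 h2
    rw [Metric.tendsto_atTop]
    intro η hη
    obtain ⟨T, hT⟩ := Filter.eventually_atTop.1
      ((h3.eventually (gt_mem_nhds hη)).and (h4.eventually (gt_mem_nhds hη)))
    refine ⟨T, fun t ht => ?_⟩
    rw [Real.dist_0_eq_abs, abs_of_nonneg Metric.infDist_nonneg]
    exact infDist_le (hT t ht).1 (hT t ht).2

end SpinOrbit

end

open SpinOrbit in
theorem theorem4p1 (B : ElasticBody) (n : ℕ) (S : AdaptedSection B n) (V : ElasticPotential S)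
    (G M κ p R₀ : ℝ) (hG : 0 < G) (hM : 0 < M) (hκ : 0 < κ) (hR₀ : 0 < R₀)
    (hmin : IsLocalMin (orbitalPotential B (G * M) p) R₀)
    (hnondeg : deriv (deriv (orbitalPotential B (G * M) p)) R₀ ≠ 0) :
    ∃ ε₀ > 0, ∃ C > 0, ∀ ε : ℝ, 0 < ε → ε < ε₀ →
      ∃ (R : ℝ) (s : Shape n),
        IsResonance S V (G * M) κ p ε R₀ (C * ε) R s ∧
        (∀ (R' : ℝ) (s' : Shape n),
          IsResonance S V (G * M) κ p ε R₀ (C * ε) R' s' → R' = R ∧ s' = s) ∧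
        ∀ D : Dissipation S,
          AsymptoticallyStable S V (G * M) κ p ε D (resonanceManifold R s) := by
  have hμ : 0 < G * M := mul_pos hG hM
  have hsnd : Filter.Tendsto Prod.snd (𝓝 (R₀, (0 : Shape n))) (𝓝 0) := continuousAt_snd
  -- The extra condition asks for regular shapes in a neighbourhood of the resonant shape, since
  -- stability concerns nearby shapes as well.
  obtain ⟨ε₀, hε₀, C, hC, h⟩ := exists_resonance V hμ hκ hR₀ hmin hnondeg
    (hsnd.eventually (eventually_isRegularShape V).eventually_nhds)
  refine ⟨ε₀, hε₀, C, hC, fun ε hε hlt => ?_⟩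
  obtain ⟨R, s, hres, huniq, hs⟩ := h ε hε hlt
  exact ⟨R, s, hres, huniq, fun D => asymptoticallyStable_resonanceManifold V hμ hκ
    (angularMomentum_ne_zero hμ hR₀ hmin) hres hs D⟩
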